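/- Let $d\ge 0$, let $F:(\mathbb{C}^d,0)\to(\mathbb{C}^d,0)$ be a germ of biholomorphism which is contracting, i.e. every open neighbourhood $W$ of $0$ contains an open neighbourhood $U$ of $0$ such that $F(U)$ is relatively compact in $U$ and $\bigcap_{n\ge 0}F^n(U)=\{0\}$. Let $I\subseteq\mathcal{O}_{\mathbb{C}^d,0}$ be an ideal of germs of holomorphic functions that is invariant under $F$, i.e. $\varphi\circ F\in I$ for all $\varphi\in I$. For $\lambda\in\mathbb{C}^d$ and $\alpha\in\mathbb{N}^d$ write $\lambda^\alpha=\lambda_1^{\alpha_1}\cdots\lambda_d^{\alpha_d}$. A germ of biholomorphism $G$ of $(\mathbb{C}^d,0)$ is in Poincaré–Dulac normal form with ordered spectrum $\lambda$ if $1>|\lambda_i|\ge|\lambda_j|>0$ for $i\le j$; the linear part of the $i$-th component of $G$ is $\lambda_i x_i+\epsilon_i x_{i-1}$ with $\epsilon_i\in\{0,1\}$, and $\epsilon_i\neq 0$ only if $i\geq 2$ and $\lambda_i=\lambda_{i-1}$; and every monomial $x^\alpha$ occurring in the $i$-th component of $G-D_0G$ satisfies $\lambda^\alpha=\lambda_i$.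 A polynomial is $\lambda$-homogeneous if there is $\gamma\in\mathbb{N}^d$ such that all of its monomials $x^\alpha$ satisfy $\lambda^\alpha=\lambda^\gamma$. It is weighted homogeneous for positive integer weights $w=(w_1,\dots,w_d)$ if, for some $n\in\mathbb{N}$, all of its monomials satisfy $\sum_k w_k\alpha_k=n$. Then there exist a germ of biholomorphism $\Phi$ of $(\mathbb{C}^d,0)$ and $\lambda\in\mathbb{C}^d$ such that $\Phi\circ F\circ\Phi^{-1}$ is in Poincaré–Dulac normal form with ordered spectrum $\lambda$. Moreover, for every such pair $(\Phi,\lambda)$, there are positive integer weights $w=(w_1,\dots,w_d)$, an integer $r\ge 0$ and polynomials $P^{(1)},\dots,P^{(r)}\in\mathbb{C}[z_1,\dots,z_d]$, each of them both $\lambda$-homogeneous and weighted homogeneous for the weights $w$, such that in the coordinates $z=\Phi(x)$ the ideal $I$ is generated by $P^{(1)},\dots,P^{(r)}$, that is $I=\langle P^{(1)}\circ\Phi,\dots,P^{(r)}\circ\Phi\rangle$, and for every $i\in\{1,\dots,r\}$ the ideal $\langle P^{(1)}\circ\Phi,\dots,P^{(i)}\circ\Phi\rangle$ is invariant under $F$.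 -/

import Mathlib

open Filter Topology

noncomputable section

/-- The ring `𝒪_{ℂ^d,0}` of germs at the origin of holomorphic functions on `ℂ^d`. -/
def holGermSubring (d : ℕ) : Subring (Germ (𝓝 (0 : Fin d → ℂ)) ℂ) where
  carrier := {g | ∃ f : (Fin d → ℂ) → ℂ, AnalyticAt ℂ f 0 ∧ Germ.ofFun f = g}
  mul_mem' := by
    rintro _ _ ⟨f, hf, rfl⟩ ⟨g, hg, rfl⟩
    exact ⟨f * g, hf.mul hg, rfl⟩
  one_mem' := ⟨1, analyticAt_const, rfl⟩
  add_mem' := by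
    rintro _ _ ⟨f, hf, rfl⟩ ⟨g, hg, rfl⟩
    exact ⟨f + g, hf.add hg, rfl⟩
  zero_mem' := ⟨0, analyticAt_const, rfl⟩
  neg_mem' := by
    rintro _ ⟨f, hf, rfl⟩
    exact ⟨-f, hf.neg, rfl⟩

abbrev HolGerm (d : ℕ) : Type := holGermSubring d

theorem mem_holGermSubring {d : ℕ} {g : Germ (𝓝 (0 : Fin d → ℂ)) ℂ} :
    g ∈ holGermSubring d ↔
      ∃ f : (Fin d → ℂ) → ℂ, AnalyticAt ℂ f 0 ∧ Germ.ofFun f = g := Iff.rfl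

/-- A (representative of a) germ of biholomorphism `(ℂ^d, 0) → (ℂ^d, 0)`, with a representative of
its inverse germ. Values away from the origin are irrelevant. -/
structure BiholGerm (d : ℕ) where
  toFun : (Fin d → ℂ) → (Fin d → ℂ)
  invFun : (Fin d → ℂ) → (Fin d → ℂ)
  map_zero : toFun 0 = 0
  inv_map_zero : invFun 0 = 0
  analyticAt_toFun : AnalyticAt ℂ toFun 0
  analyticAt_invFun : AnalyticAt ℂ invFun 0
  left_inv : ∀ᶠ x in 𝓝 0, invFun (toFun x) = x
  right_inv : ∀ᶠ x in 𝓝 0, toFun (invFun x) = x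

namespace BiholGerm

variable {d : ℕ}

instance : CoeFun (BiholGerm d) (fun _ => (Fin d → ℂ) → (Fin d → ℂ)) := ⟨toFun⟩

theorem tendsto_zero (F : BiholGerm d) : Tendsto F (𝓝 0) (𝓝 0) := by
  simpa [F.map_zero] using F.analyticAt_toFun.continuousAt.tendsto

/-- The action `φ ↦ φ ∘ F` of `F` on germs of holomorphic functions. -/
def pullback (F : BiholGerm d) : HolGerm d →+* HolGerm d where
  toFun φ := ⟨(φ : Germ (𝓝 (0 : Fin d → ℂ)) ℂ).compTendsto F F.tendsto_zero, by
    obtain ⟨f, hf, hfφ⟩ := mem_holGermSubring.1 φ.2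
    rw [← hfφ]
    refine ⟨f ∘ F, AnalyticAt.comp ?_ F.analyticAt_toFun, rfl⟩
    rw [F.map_zero]
    exact hf⟩
  map_one' := rfl
  map_zero' := rfl
  map_mul' φ ψ := by
    apply Subtype.ext
    obtain ⟨f, -, hf⟩ := mem_holGermSubring.1 φ.2
    obtain ⟨g, -, hg⟩ := mem_holGermSubring.1 ψ.2
    simp only [Subring.coe_mul, ← hf, ← hg]
    rfl
  map_add' φ ψ := by
    apply Subtype.ext
    obtain ⟨f, -, hf⟩ := mem_holGermSubring.1 φ.2
    obtain ⟨g, -, hg⟩ := mem_holGermSubring.1 ψ.2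
    simp only [Subring.coe_add, ← hf, ← hg]
    rfl

/-- `F` is contracting: every open neighbourhood `W` of `0` contains an open neighbourhood `U` of
`0` such that `F(U)` is relatively compact in `U` and `⋂ₙ Fⁿ(U) = {0}`. -/
def IsContracting (F : BiholGerm d) : Prop :=
  ∀ W : Set (Fin d → ℂ), IsOpen W → (0 : Fin d → ℂ) ∈ W →
    ∃ U : Set (Fin d → ℂ), IsOpen U ∧ (0 : Fin d → ℂ) ∈ U ∧ U ⊆ W ∧
      IsCompact (closure (F '' U)) ∧ closure (F '' U) ⊆ U ∧
      ⋂ n : ℕ, F^[n] '' U = {0}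

/-- The ideal `I` is invariant under `F`: `φ ∘ F ∈ I` for all `φ ∈ I`. -/
def LeavesInvariant (F : BiholGerm d) (I : Ideal (HolGerm d)) : Prop :=
  ∀ φ ∈ I, F.pullback φ ∈ I

end BiholGerm

/-- The germ at the origin of a polynomial function. -/
def polyGerm {d : ℕ} (P : MvPolynomial (Fin d) ℂ) : HolGerm d :=
  ⟨Germ.ofFun fun x => MvPolynomial.eval x P,
    _, AnalyticOnNhd.eval_mvPolynomial P 0 (Set.mem_univ _), rfl⟩

/-- `λ^α = λ₁^{α₁} ⋯ λ_d^{α_d}`. -/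
def multiPow {d : ℕ} (lam : Fin d → ℂ) (α : Fin d →₀ ℕ) : ℂ := ∏ i, lam i ^ α i

/-- `1 > |λ_i| ≥ |λ_j| > 0` for `i ≤ j`. -/
def NicelyOrdered {d : ℕ} (lam : Fin d → ℂ) : Prop :=
  (∀ i, ‖lam i‖ < 1 ∧ 0 < ‖lam i‖) ∧ ∀ i j, i ≤ j → ‖lam j‖ ≤ ‖lam i‖

/-- Lower Jordan normal form: row `i` of `A` represents `λ_i x_i + ε_i x_{i-1}`, where
`ε_i ∈ {0, 1}` is nonzero only if `λ_i = λ_{i-1}`. -/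
def IsLowerJordan {d : ℕ} (A : Matrix (Fin d) (Fin d) ℂ) : Prop :=
  ∀ i j, i ≠ j → A i j ≠ 0 → (j : ℕ) + 1 = i ∧ A i j = 1 ∧ A i i = A j j

/-- The monomial `x^α` is `λ`-resonant with respect to the `i`-th coordinate. -/
def IsResonant {d : ℕ} (lam : Fin d → ℂ) (i : Fin d) (α : Fin d →₀ ℕ) : Prop :=
  (2 ≤ ∑ k, α k ∨ ∃ j : Fin d, (j : ℕ) + 1 = i ∧ α = Finsupp.single j 1) ∧
    multiPow lam α = lam i

/-- `G` is in Poincaré–Dulac normal form with ordered spectrum `λ`. Since all `|λ_i| < 1`, only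
finitely many monomials are resonant, so the components of `G - D₀G` are polynomials. -/
def IsPoincareDulac {d : ℕ} (G : BiholGerm d) (lam : Fin d → ℂ) : Prop :=
  IsLowerJordan (LinearMap.toMatrix' (fderiv ℂ G 0).toLinearMap) ∧
  (∀ i, LinearMap.toMatrix' (fderiv ℂ G 0).toLinearMap i i = lam i) ∧
  NicelyOrdered lam ∧
  ∃ N : Fin d → MvPolynomial (Fin d) ℂ,
    (∀ i, ∀ α ∈ (N i).support, IsResonant lam i α) ∧
    ∀ᶠ x in 𝓝 (0 : Fin d → ℂ), ∀ i, G x i - fderiv ℂ G 0 x i = MvPolynomial.eval x (N i)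

/-- The holomorphic coordinates `z = Φ(x)` put `F` in Poincaré–Dulac normal form with ordered
spectrum `λ`: the germ `G = Φ ∘ F ∘ Φ⁻¹` is in that form. -/
def IsPoincareDulacCoord {d : ℕ} (F Φ : BiholGerm d) (lam : Fin d → ℂ) : Prop :=
  ∃ G : BiholGerm d, (∀ᶠ x in 𝓝 (0 : Fin d → ℂ), G (Φ x) = Φ (F x)) ∧ IsPoincareDulac G lam

/-- `P` is `λ`-homogeneous: all its monomials `x^α` have the same value of `λ^α`, namely `λ^γ`
for some `γ ∈ ℕ^d`. -/
def IsLambdaHomogeneous {d : ℕ} (lam : Fin d → ℂ) (P : MvPolynomial (Fin d) ℂ) : Prop :=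
  ∃ γ : Fin d →₀ ℕ, ∀ α ∈ P.support, multiPow lam α = multiPow lam γ

end

/-! The action `φ ↦ φ ∘ F` on the local ring 𝒪 of germs is treated as linear algebra: 𝒪 is infinite
dimensional, but the quotients 𝒪/𝔪^k are finite dimensional, and ideals are closed for the 𝔪-adic
topology.

Generators. For G in normal form, G^* x_i - λ_i x_i is a combination of resonant monomials in
earlier coordinates, so each x_i is a generalized eigenvector of G^* for λ_i
(`IsPoincareDulac.X_mem_maxGenEigenspace`). Eigenvalues multiply along products, hence polynomials
all of whose monomials satisfy λ^α = c ("isotypic") are generalized eigenvectors for c. As |λ_i| <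
1, only finitely many α share a value λ^α, and every germ is, modulo each 𝔪^k, a finite sum of
isotypic polynomials. The invariant ideal I + 𝔪^k contains the components of its elements for
distinct eigenvalues, and Krull's theorem puts them in I (`isotypic_part_mem`). Thus I is generated
by isotypic polynomials, finitely many since 𝒪 is Noetherian. Since G^* - c is nilpotent along each
generator P, inserting ..., (G^* - c)P, P in this order keeps all initial segments invariant
(`IsFlagGenerated.exists_insert`). Finally λ^α = λ^β is a linear relation for the positive reals
-log|λ_i|, and suitable positive integers satisfy the same relations (`exists_nat_weights`).

Noetherianity is proved by Grauert division in ℓ¹ spaces of power series: on a suitable small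
polydisc leading terms dominate, and division is the inversion of a perturbation of the identity
(`exists_division`).

Existence of Φ. Cauchy estimates show that the powers of D₀F tend to 0. Then F^* - c is surjective
on 𝔪^k for large k (`BiholGerm.exists_pullback_sub_smul_eq`), so generalized eigenvectors of the
transpose of D₀F lift to generalized eigenvectors of F^*. Lifting an ordered Jordan basis gives
coordinates; the components of the conjugated germ are again generalized eigenvectors, hence
isotypic polynomials, which is resonance. -/

noncomputable section

/-! ### Absolutely summable families and operators prescribed on unit vectors. -/

section

/-- The Banach space of absolutely summable complex families. -/
abbrev EllOne (ι : Type*) : Type _ := lp (fun _ : ι => ℂ) 1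

namespace EllOne

variable {ι κ : Type*} {E : Type*} [NormedAddCommGroup E] [NormedSpace ℂ E]

theorem hasSum_norm (a : EllOne ι) : HasSum (fun i => ‖a i‖) ‖a‖ := by
  simpa using lp.hasSum_norm (p := 1) (by simp) a

theorem norm_apply_le (a : EllOne ι) (i : ι) : ‖a i‖ ≤ ‖a‖ :=
  lp.norm_apply_le_norm (by simp) a i

theorem summable_norm_smul (a : EllOne ι) {v : ι → E} {M : ℝ} (hv : ∀ i, ‖v i‖ ≤ M) :
    Summable fun i => ‖a i • v i‖ := by
  refine Summable.of_nonneg_of_le (fun _ => norm_nonneg _) (fun i => ?_)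
    (a.hasSum_norm.summable.mul_right M)
  rw [norm_smul]
  exact mul_le_mul_of_nonneg_left (hv i) (norm_nonneg _)

theorem norm_tsum_smul_le (a : EllOne ι) {v : ι → E} {C : ℝ}
    (h : ∀ i, a i ≠ 0 → ‖v i‖ ≤ C) : ‖∑' i, a i • v i‖ ≤ C * ‖a‖ := by
  refine tsum_of_norm_bounded (a.hasSum_norm.mul_left C) fun i => ?_
  rw [norm_smul, mul_comm]
  by_cases hi : a i = 0
  · simp [hi]
  · exact mul_le_mul_of_nonneg_right (h i hi) (norm_nonneg _)

theorem coe_add_apply (a b : EllOne ι) (i : ι) : (a + b) i = a i + b i := rfl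

theorem coe_smul_apply (c : ℂ) (a : EllOne ι) (i : ι) : (c • a) i = c * a i := rfl

variable [CompleteSpace E]

/-- The continuous linear map on `ℓ¹` sending the unit vectors to a given bounded family. -/
def lift (v : ι → E) (M : ℝ) (hv : ∀ i, ‖v i‖ ≤ M) : EllOne ι →L[ℂ] E :=
  LinearMap.mkContinuous
    { toFun := fun a => ∑' i, a i • v i
      map_add' := fun a b => by
        rw [← Summable.tsum_add (a.summable_norm_smul hv).of_norm
          (b.summable_norm_smul hv).of_norm]
        exact tsum_congr fun i => by rw [coe_add_apply, add_smul]
      map_smul' := fun c a => by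
        rw [RingHom.id_apply, ← tsum_const_smul'']
        exact tsum_congr fun i => by rw [coe_smul_apply, mul_smul] } M
    fun a => a.norm_tsum_smul_le fun i _ => hv i

theorem hasSum_lift (v : ι → E) (M : ℝ) (hv : ∀ i, ‖v i‖ ≤ M) (a : EllOne ι) :
    HasSum (fun i => a i • v i) (lift v M hv a) :=
  (a.summable_norm_smul hv).of_norm.hasSum

open Classical in
/-- Unit vectors of `ℓ¹`. -/
def unit (i : ι) : EllOne ι := lp.single 1 i (1 : ℂ)

theorem unit_apply_self (i : ι) : (unit i : EllOne ι) i = 1 := by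
  classical
  exact lp.single_apply_self (E := fun _ : ι => ℂ) 1 i 1

theorem unit_apply_ne {i j : ι} (h : j ≠ i) : (unit i : EllOne ι) j = 0 := by
  classical
  exact lp.single_apply_ne (E := fun _ : ι => ℂ) 1 i 1 h

theorem norm_unit (i : ι) : ‖(unit i : EllOne ι)‖ = 1 := by
  classical
  rw [unit, lp.norm_single (E := fun _ : ι => ℂ) (p := 1) (by simp), norm_one]

theorem hasSum_unit (a : EllOne ι) : HasSum (fun i => a i • unit i) a := by
  classical
  convert lp.hasSum_single (E := fun _ : ι => ℂ) (p := 1) (by simp) a using 2 with i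
  rw [unit, ← lp.single_smul]
  simp

@[simp]
theorem lift_unit (v : ι → E) (M : ℝ) (hv : ∀ i, ‖v i‖ ≤ M) (i : ι) :
    lift v M hv (unit i) = v i := by
  refine (hasSum_lift v M hv (unit i)).unique ?_
  convert hasSum_single i (fun j hj => ?_) using 1
  · rw [unit_apply_self, one_smul]
  · rw [unit_apply_ne hj, zero_smul]

/-- Each family is the sum of its multiples of unit vectors, so identities for evaluation, division
and composition need checking on monomials only. -/
theorem ext_unit {F : Type*} [NormedAddCommGroup F] [NormedSpace ℂ F]
    {A B : EllOne ι →L[ℂ] F} (h : ∀ i, A (unit i) = B (unit i)) : A = B := by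
  ext a
  have hA := a.hasSum_unit.mapL A
  have hB := a.hasSum_unit.mapL B
  simp only [map_smul, h] at hA hB
  exact hA.unique hB

/-- Closedness carries support conditions, such as order of vanishing, through infinite sums. -/
theorem lift_mem (v : ι → E) (M : ℝ) (hv : ∀ i, ‖v i‖ ≤ M) (a : EllOne ι)
    {W : Submodule ℂ E} (hW : IsClosed (W : Set E)) (h : ∀ i, a i ≠ 0 → v i ∈ W) :
    lift v M hv a ∈ W := by
  refine hW.mem_of_tendsto (hasSum_lift v M hv a) (Eventually.of_forall fun s => ?_)
  refine W.sum_mem fun i _ => ?_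
  by_cases hi : a i = 0
  · simp [hi]
  · exact W.smul_mem _ (h i hi)

theorem opNorm_lift_le (v : ι → E) (M : ℝ) (hM : 0 ≤ M) (hv : ∀ i, ‖v i‖ ≤ M) :
    ‖lift v M hv‖ ≤ M :=
  LinearMap.mkContinuous_norm_le _ hM _

theorem exists_of_summable {c : ι → ℂ} (h : Summable fun i => ‖c i‖) :
    ∃ a : EllOne ι, (∀ i, a i = c i) ∧ ‖a‖ = ∑' i, ‖c i‖ := by
  have hm : Memℓp c 1 := by
    refine memℓp_gen ?_
    simpa using h
  refine ⟨⟨c, hm⟩, fun _ => rfl, ?_⟩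
  exact ((hasSum_norm (⟨c, hm⟩ : EllOne ι)).tsum_eq).symm

/-- The closed subspace of families supported in a set. -/
def supportedOn (S : Set ι) : Submodule ℂ (EllOne ι) where
  carrier := {a | ∀ i, i ∉ S → a i = 0}
  add_mem' ha hb i hi := by simp [ha i hi, hb i hi]
  zero_mem' i _ := rfl
  smul_mem' c a ha i hi := by simp [ha i hi]

theorem mem_supportedOn {S : Set ι} {a : EllOne ι} :
    a ∈ supportedOn S ↔ ∀ i, i ∉ S → a i = 0 := Iff.rfl

theorem unit_mem_supportedOn {S : Set ι} {i : ι} (h : i ∈ S) : unit i ∈ supportedOn S :=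
  fun _ hj => unit_apply_ne fun e => hj (e ▸ h)

theorem isClosed_supportedOn (S : Set ι) : IsClosed (supportedOn S : Set (EllOne ι)) := by
  have : (supportedOn S : Set (EllOne ι)) = ⋂ i ∈ Sᶜ, {a | a i = 0} := by
    ext a
    simp [mem_supportedOn]
  rw [this]
  refine isClosed_biInter fun i _ => isClosed_eq ?_ continuous_const
  refine (LinearMap.mkContinuous (⟨⟨fun a : EllOne ι => a i, fun _ _ => rfl⟩, fun _ _ => rfl⟩ :
    EllOne ι →ₗ[ℂ] ℂ) 1 fun a => ?_).continuous
  rw [one_mul]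
  exact norm_apply_le a i

end EllOne

end

/-! ### Power series on the closed unit polydisc. -/

section

section MultiPow

variable {d : ℕ}

@[simp]
theorem multiPow_zero (y : Fin d → ℂ) : multiPow y 0 = 1 := by simp [multiPow]

theorem multiPow_add (y : Fin d → ℂ) (α β : Fin d →₀ ℕ) :
    multiPow y (α + β) = multiPow y α * multiPow y β := by
  simp [multiPow, pow_add, Finset.prod_mul_distrib]

@[simp]
theorem multiPow_single (y : Fin d → ℂ) (i : Fin d) (n : ℕ) :
    multiPow y (Finsupp.single i n) = y i ^ n := by
  rw [multiPow, Finset.prod_eq_single i]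
  · simp
  · intro j _ hj
    simp [Finsupp.single_eq_of_ne hj]
  · simp

theorem multiPow_mul (x y : Fin d → ℂ) (α : Fin d →₀ ℕ) :
    multiPow (fun i => x i * y i) α = multiPow x α * multiPow y α := by
  simp [multiPow, mul_pow, Finset.prod_mul_distrib]

theorem multiPow_ne_zero {y : Fin d → ℂ} (hy : ∀ i, y i ≠ 0) (α : Fin d →₀ ℕ) :
    multiPow y α ≠ 0 :=
  Finset.prod_ne_zero_iff.2 fun i _ => pow_ne_zero _ (hy i)

theorem norm_multiPow (y : Fin d → ℂ) (α : Fin d →₀ ℕ) :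
    ‖multiPow y α‖ = ∏ i, ‖y i‖ ^ α i := by
  simp [multiPow, norm_prod]

theorem norm_multiPow_le_one {y : Fin d → ℂ} (hy : ∀ i, ‖y i‖ ≤ 1) (α : Fin d →₀ ℕ) :
    ‖multiPow y α‖ ≤ 1 := by
  rw [norm_multiPow]
  exact Finset.prod_le_one (fun i _ => by positivity) fun i _ => pow_le_one₀ (norm_nonneg _) (hy i)

theorem multiPow_const (t : ℂ) (α : Fin d →₀ ℕ) :
    multiPow (fun _ => t) α = t ^ α.degree := by
  rw [multiPow, Finset.prod_pow_eq_pow_sum, Finsupp.degree_eq_sum]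

theorem eval_monomial_eq_multiPow (y : Fin d → ℂ) (α : Fin d →₀ ℕ) (c : ℂ) :
    MvPolynomial.eval y (MvPolynomial.monomial α c) = c * multiPow y α := by
  rw [MvPolynomial.eval_monomial, multiPow, Finsupp.prod_fintype _ _ fun i => pow_zero _]

end MultiPow

/-- Coefficient families of power series in `d` variables converging absolutely on the closed unit
polydisc. -/
abbrev UnitSeries (d : ℕ) : Type := EllOne (Fin d →₀ ℕ)

namespace UnitSeries

open EllOne

variable {d : ℕ}

/-- Evaluation at a point of the closed unit polydisc. -/
def ev (y : Fin d → ℂ) (hy : ∀ i, ‖y i‖ ≤ 1) : UnitSeries d →L[ℂ] ℂ :=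
  lift (multiPow y) 1 (norm_multiPow_le_one hy)

/-- The function defined by a power series. -/
def sumFun (a : UnitSeries d) (y : Fin d → ℂ) : ℂ := ∑' α, a α * multiPow y α

theorem ev_apply {y : Fin d → ℂ} (hy : ∀ i, ‖y i‖ ≤ 1) (a : UnitSeries d) :
    ev y hy a = a.sumFun y := rfl

theorem hasSum_sumFun {y : Fin d → ℂ} (hy : ∀ i, ‖y i‖ ≤ 1) (a : UnitSeries d) :
    HasSum (fun α => a α * multiPow y α) (a.sumFun y) :=
  hasSum_lift (multiPow y) 1 (norm_multiPow_le_one hy) a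

theorem ev_unit {y : Fin d → ℂ} (hy : ∀ i, ‖y i‖ ≤ 1) (α : Fin d →₀ ℕ) :
    ev y hy (unit α) = multiPow y α := lift_unit _ _ _ _

/-- Multiplication by the monomial of exponent `β`. -/
def shift (β : Fin d →₀ ℕ) : UnitSeries d →L[ℂ] UnitSeries d :=
  lift (fun γ => unit (β + γ)) 1 fun γ => (norm_unit (β + γ)).le

theorem shift_unit (β γ : Fin d →₀ ℕ) : shift β (unit γ) = unit (β + γ) := lift_unit _ _ _ _

theorem norm_shift_le (β : Fin d →₀ ℕ) : ‖shift β‖ ≤ 1 :=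
  opNorm_lift_le _ _ zero_le_one _

theorem norm_shift_apply_le (β : Fin d →₀ ℕ) (a : UnitSeries d) : ‖shift β a‖ ≤ ‖a‖ := by
  simpa using (shift β).le_of_opNorm_le (norm_shift_le β) a

/-- The product of power series. -/
def mulL : UnitSeries d →L[ℂ] UnitSeries d →L[ℂ] UnitSeries d := lift shift 1 norm_shift_le

theorem mulL_unit (β : Fin d →₀ ℕ) : mulL (unit β) = shift β := lift_unit _ _ _ _

theorem norm_mulL_le (a b : UnitSeries d) : ‖mulL a b‖ ≤ ‖a‖ * ‖b‖ := by
  refine (mulL a).le_of_opNorm_le ?_ b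
  simpa using mulL.le_of_opNorm_le (opNorm_lift_le _ _ zero_le_one _) a

theorem ev_shift {y : Fin d → ℂ} (hy : ∀ i, ‖y i‖ ≤ 1) (β : Fin d →₀ ℕ) (a : UnitSeries d) :
    ev y hy (shift β a) = multiPow y β * ev y hy a := by
  have : (ev y hy).comp (shift β) = multiPow y β • ev y hy := by
    refine ext_unit fun γ => ?_
    simp [shift_unit, ev_unit, multiPow_add]
  exact DFunLike.congr_fun this a

theorem ev_mulL {y : Fin d → ℂ} (hy : ∀ i, ‖y i‖ ≤ 1) (a b : UnitSeries d) :
    ev y hy (mulL a b) = ev y hy a * ev y hy b := by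
  have : (ev y hy).comp (mulL.flip b) = ev y hy b • ev y hy := by
    refine ext_unit fun γ => ?_
    simp [mulL_unit, ev_unit, ev_shift, mul_comm]
  simpa [mul_comm] using DFunLike.congr_fun this a

/-- Power series vanishing to order `k` at the origin. -/
def orderGE (d k : ℕ) : Submodule ℂ (UnitSeries d) := supportedOn {α | k ≤ α.degree}

theorem shift_mem_orderGE {k : ℕ} (β : Fin d →₀ ℕ) {a : UnitSeries d} (ha : a ∈ orderGE d k) :
    shift β a ∈ orderGE d (β.degree + k) := by
  refine lift_mem _ _ _ _ (isClosed_supportedOn _) fun γ hγ => unit_mem_supportedOn ?_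
  have : k ≤ γ.degree := by
    by_contra h
    exact hγ (ha γ h)
  simpa using this

theorem orderGE_mono {k l : ℕ} (h : k ≤ l) : orderGE d l ≤ orderGE d k :=
  fun _ ha α hα => ha α fun h' => hα (h.trans h')

theorem mulL_mem_orderGE {k l : ℕ} {a b : UnitSeries d} (ha : a ∈ orderGE d k)
    (hb : b ∈ orderGE d l) : mulL a b ∈ orderGE d (k + l) := by
  let W : Submodule ℂ (UnitSeries d →L[ℂ] UnitSeries d) :=
    (orderGE d (k + l)).comap (ContinuousLinearMap.apply ℂ (UnitSeries d) b).toLinearMap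
  have hW : IsClosed (W : Set (UnitSeries d →L[ℂ] UnitSeries d)) :=
    (isClosed_supportedOn _).preimage (ContinuousLinearMap.apply ℂ (UnitSeries d) b).continuous
  refine lift_mem (W := W) shift 1 norm_shift_le a hW fun β hβ => ?_
  have : k ≤ β.degree := by
    by_contra h
    exact hβ (ha β h)
  exact orderGE_mono (by omega) (shift_mem_orderGE β hb)

theorem sumFun_zero (a : UnitSeries d) : a.sumFun 0 = a 0 := by
  rw [sumFun, tsum_eq_single 0]
  · simp
  · intro α hα
    obtain ⟨i, hi⟩ := Finsupp.ne_iff.1 hα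
    have : multiPow (0 : Fin d → ℂ) α = 0 :=
      Finset.prod_eq_zero (Finset.mem_univ i) (by simpa using hi)
    simp [this]

/-- A word in the coordinates as a multilinear form. -/
def wordForm {n : ℕ} (s : Fin n → Fin d) :
    ContinuousMultilinearMap ℂ (fun _ : Fin n => Fin d → ℂ) ℂ :=
  (ContinuousMultilinearMap.mkPiAlgebra ℂ (Fin n) ℂ).compContinuousLinearMap
    fun i => ContinuousLinearMap.proj (s i)

theorem wordForm_apply {n : ℕ} (s : Fin n → Fin d) (m : Fin n → Fin d → ℂ) :
    wordForm s m = ∏ i, m i (s i) := by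
  simp [wordForm]

theorem norm_wordForm_le {n : ℕ} (s : Fin n → Fin d) : ‖wordForm s‖ ≤ 1 := by
  refine ContinuousMultilinearMap.opNorm_le_bound zero_le_one fun m => ?_
  rw [wordForm_apply, one_mul, norm_prod]
  exact Finset.prod_le_prod (fun _ _ => norm_nonneg _) fun i _ => norm_le_pi_norm _ _

theorem exists_word (n : ℕ) (α : Fin d →₀ ℕ) (h : α.degree = n) :
    ∃ s : Fin n → Fin d, ∀ y : Fin d → ℂ, ∏ i, y (s i) = multiPow y α := by
  subst h
  let l := (Finsupp.toMultiset α).toList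
  have hl : l.length = α.degree := by
    simp only [l, Multiset.length_toList, Finsupp.card_toMultiset, Finsupp.degree_eq_sum]
    exact Finsupp.sum_fintype _ _ fun _ => rfl
  refine ⟨fun i => l.get (i.cast hl.symm), fun y => ?_⟩
  have h1 : ∏ i : Fin α.degree, y (l.get (i.cast hl.symm)) = ∏ i : Fin l.length, y (l.get i) :=
    Fintype.prod_equiv (finCongr hl.symm) _ _ fun _ => rfl
  have h2 : (l.map y).prod = multiPow y α := by
    rw [← Multiset.prod_coe, ← Multiset.map_coe, Multiset.coe_toList, multiPow,
      Finsupp.toMultiset_map, Finsupp.prod_toMultiset]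
    rw [Finsupp.prod_mapDomain_index (fun _ => pow_zero _) (fun _ _ _ => pow_add _ _ _)]
    exact Finsupp.prod_fintype _ _ fun i => pow_zero _
  rw [h1, ← h2, ← List.prod_ofFn, ← Function.comp_def, ← List.map_ofFn, List.ofFn_get]

/-- Exponents of given degree. -/
def expsOfDegree (d n : ℕ) : Finset (Fin d →₀ ℕ) := Finset.univ.finsuppAntidiag n

theorem mem_expsOfDegree {n : ℕ} {α : Fin d →₀ ℕ} : α ∈ expsOfDegree d n ↔ α.degree = n := by
  simp [expsOfDegree, Finset.mem_finsuppAntidiag, Finsupp.degree_eq_sum]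

/-- Exponents sorted by degree. -/
def sigmaExps (d : ℕ) : (Σ n, expsOfDegree d n) ≃ (Fin d →₀ ℕ) where
  toFun x := x.2.1
  invFun α := ⟨α.degree, α, mem_expsOfDegree.2 rfl⟩
  left_inv := by
    rintro ⟨n, α, hα⟩
    obtain rfl := mem_expsOfDegree.1 hα
    rfl
  right_inv _ := rfl

/-- Grouped by degree, the monomials become multilinear word forms of norm at most 1; the
homogeneous parts are then bounded by ‖a‖ and the radius of convergence is at least 1. -/
theorem analyticAt_sumFun (a : UnitSeries d) : AnalyticAt ℂ a.sumFun 0 := by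
  have hw : ∀ n, ∀ α : expsOfDegree d n, ∃ s : Fin n → Fin d, ∀ y : Fin d → ℂ,
    ∏ i, y (s i) = multiPow y α.1 := fun n α => exists_word n α.1 (mem_expsOfDegree.1 α.2)
  choose w hw using hw
  let p : FormalMultilinearSeries ℂ (Fin d → ℂ) ℂ :=
    fun n => ∑ α : expsOfDegree d n, a α.1 • wordForm (w n α)
  have hp : ∀ n, ‖p n‖ ≤ ‖a‖ := fun n => by
    refine (norm_sum_le _ _).trans ?_
    calc ∑ α : expsOfDegree d n, ‖a α.1 • wordForm (w n α)‖
        ≤ ∑ α : expsOfDegree d n, ‖a α.1‖ := Finset.sum_le_sum fun α _ => by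
          rw [norm_smul]
          exact mul_le_of_le_one_right (norm_nonneg _) (norm_wordForm_le _)
      _ = ∑ α ∈ expsOfDegree d n, ‖a α‖ := Finset.sum_coe_sort _ fun α => ‖a α‖
      _ ≤ ‖a‖ := sum_le_hasSum _ (fun _ _ => norm_nonneg _) a.hasSum_norm
  refine ⟨p, 1, ?_, one_pos, ?_⟩
  · exact_mod_cast p.le_radius_of_bound (r := 1) ‖a‖ fun n => by simpa using hp n
  · intro y hy
    have hy1 : ∀ i, ‖y i‖ ≤ 1 := fun i => by
      refine (norm_le_pi_norm y i).trans ?_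
      rw [Metric.mem_eball, edist_zero_right, enorm_eq_nnnorm] at hy
      exact_mod_cast hy.le
    rw [zero_add]
    have h := (sigmaExps d).hasSum_iff.2 (hasSum_sumFun hy1 a)
    refine h.sigma fun n => ?_
    convert hasSum_fintype _ using 1
    simp only [p, sum_apply]
    refine Finset.sum_congr rfl fun α _ => ?_
    change a α.1 • wordForm (w n α) (fun _ => y) = a α.1 * multiPow y α.1
    rw [wordForm_apply, hw, smul_eq_mul]

/-- Expanding the n-th multilinear term over the standard basis gives one coefficient per word of
length n; on a small polydisc these are summable, and collecting words with the same letter counts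
gives the coefficient family. -/
theorem exists_sumFun_of_analyticAt {f : (Fin d → ℂ) → ℂ} (hf : AnalyticAt ℂ f 0) :
    ∃ t : ℝ, 0 < t ∧ ∃ a : UnitSeries d, ∀ y : Fin d → ℂ, (∀ i, ‖y i‖ ≤ 1) →
      f (fun i => t * y i) = a.sumFun y := by
  obtain ⟨p, r, hp⟩ := hf
  obtain ⟨r', hr'0, hr'⟩ := ENNReal.lt_iff_exists_nnreal_btwn.1 hp.r_pos
  have hr'1 : 0 < r' := by exact_mod_cast hr'0
  obtain ⟨C, hC, hpC⟩ := p.norm_mul_pow_le_of_lt_radius (hr'.trans_le hp.r_le)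
  -- There are d^n words of length n, so `t * d ≤ r' / 2` makes the word sums geometric; `d + 1`
  -- also covers d = 0.
  set t : ℝ := r' / (2 * (d + 1)) with ht
  have hr'2 : (0 : ℝ) < r' := hr'1
  have ht0 : 0 < t := by positivity
  have htr : t * d ≤ r' / 2 := by
    rw [ht, div_mul_eq_mul_div, div_le_div_iff₀ (by positivity) (by positivity)]
    nlinarith
  have htr' : t < r' := by
    rw [ht, div_lt_iff₀ (by positivity)]
    nlinarith [(Nat.cast_nonneg d : (0 : ℝ) ≤ d)]
  let c : (Σ n, Fin n → Fin d) → ℂ := fun j =>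
    p j.1 fun i => (Pi.single (j.2 i) (t : ℂ) : Fin d → ℂ)
  have hc : ∀ j, ‖c j‖ ≤ ‖p j.1‖ * t ^ j.1 := fun j => by
    refine ((p j.1).le_opNorm _).trans (le_of_eq ?_)
    simp [Pi.norm_single, abs_of_pos ht0]
  have hpn : ∀ n, (d : ℝ) ^ n * (‖p n‖ * t ^ n) ≤ C * (1 / 2) ^ n := fun n => by
    calc (d : ℝ) ^ n * (‖p n‖ * t ^ n) = ‖p n‖ * (t * d) ^ n := by rw [mul_pow]; ring
      _ ≤ ‖p n‖ * (r' / 2) ^ n := by gcongr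
      _ = (‖p n‖ * r' ^ n) * (1 / 2) ^ n := by rw [div_pow, div_pow, one_pow]; ring
      _ ≤ C * (1 / 2) ^ n := by gcongr; exact hpC n
  have hsum : Summable fun j => ‖c j‖ := by
    rw [summable_sigma_of_nonneg fun _ => norm_nonneg _]
    refine ⟨fun n => Summable.of_finite, Summable.of_nonneg_of_le
      (fun n => tsum_nonneg fun _ => norm_nonneg _) (fun n => ?_)
      ((summable_geometric_of_lt_one (r := 1 / 2) (by norm_num) (by norm_num)).mul_left C)⟩
    rw [tsum_fintype]
    refine le_trans ?_ (hpn n)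
    calc ∑ s : Fin n → Fin d, ‖c ⟨n, s⟩‖ ≤ ∑ s : Fin n → Fin d, ‖p n‖ * t ^ n :=
          Finset.sum_le_sum fun s _ => hc ⟨n, s⟩
      _ = _ := by simp
  obtain ⟨b, hb, -⟩ := exists_of_summable hsum
  let cnt : (Σ n, Fin n → Fin d) → (Fin d →₀ ℕ) := fun j => ∑ i, Finsupp.single (j.2 i) 1
  refine ⟨t, ht0, lift (fun j => unit (cnt j)) 1 (fun j => (norm_unit (cnt j)).le) b,
    fun y hy => ?_⟩
  rw [← ev_apply hy]
  have hcnt : ∀ j, multiPow y (cnt j) = ∏ i, y (j.2 i) := fun j => by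
    have : ∀ s : Finset (Fin j.1), multiPow y (∑ i ∈ s, Finsupp.single (j.2 i) 1) =
        ∏ i ∈ s, y (j.2 i) := fun s => by
      classical
      induction s using Finset.induction_on with
      | empty => simp
      | insert i s hi ih => rw [Finset.sum_insert hi, multiPow_add, ih, Finset.prod_insert hi,
          multiPow_single, pow_one]
    exact this _
  have h1 := (hasSum_lift (fun j => unit (cnt j)) 1 (fun j => (norm_unit (cnt j)).le) b).mapL
    (ev y hy)
  simp only [map_smul, ev_unit, hcnt, hb, smul_eq_mul] at h1
  have hty : (fun i => (t : ℂ) * y i) ∈ Metric.eball (0 : Fin d → ℂ) r := by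
    have : ‖fun i => (t : ℂ) * y i‖ ≤ t := by
      rw [pi_norm_le_iff_of_nonneg ht0.le]
      intro i
      rw [norm_mul, Complex.norm_real, Real.norm_of_nonneg ht0.le]
      exact mul_le_of_le_one_right ht0.le (hy i)
    rw [Metric.mem_eball, edist_zero_right]
    refine lt_of_le_of_lt ?_ hr'
    rw [enorm_eq_nnnorm]
    exact_mod_cast this.trans htr'.le
  have h2 := hp.hasSum hty
  rw [zero_add] at h2
  refine h2.unique ?_
  refine h1.sigma fun n => ?_
  convert hasSum_fintype _ using 1
  have hexp : (fun _ : Fin n => fun i => (t : ℂ) * y i) =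
      fun _ : Fin n => ∑ j : Fin d, y j • (Pi.single j (t : ℂ) : Fin d → ℂ) := by
    funext _ i
    simp [Finset.sum_apply, Pi.single_apply, mul_comm]
  rw [hexp, (p n).map_sum]
  refine Finset.sum_congr rfl fun s _ => ?_
  rw [(p n).map_smul_univ (fun i => y (s i)), smul_eq_mul, mul_comm]

end UnitSeries

end

/-! ### The local ring of germs, polydiscs of varying radii, and Taylor expansion. -/

section

namespace HolGerm

variable {d : ℕ}

/-- The germ of an analytic function. -/
def mk (f : (Fin d → ℂ) → ℂ) (hf : AnalyticAt ℂ f 0) : HolGerm d := ⟨Germ.ofFun f, f, hf, rfl⟩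

theorem mk_eq_mk {f g : (Fin d → ℂ) → ℂ} {hf : AnalyticAt ℂ f 0} {hg : AnalyticAt ℂ g 0} :
    mk f hf = mk g hg ↔ ∀ᶠ x in 𝓝 0, f x = g x := by
  refine Subtype.ext_iff.trans ?_
  exact Germ.coe_eq

theorem ext_of_eventually {φ ψ : HolGerm d} (f g : (Fin d → ℂ) → ℂ)
    (hφ : (φ : Germ (𝓝 (0 : Fin d → ℂ)) ℂ) = Germ.ofFun f)
    (hψ : (ψ : Germ (𝓝 (0 : Fin d → ℂ)) ℂ) = Germ.ofFun g) (h : ∀ᶠ x in 𝓝 0, f x = g x) :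
    φ = ψ := by
  apply Subtype.ext
  rw [hφ, hψ]
  exact Germ.coe_eq.2 h

theorem exists_mk (φ : HolGerm d) : ∃ f hf, mk f hf = φ := by
  obtain ⟨_, f, hf, rfl⟩ := φ
  exact ⟨f, hf, rfl⟩

theorem mk_add {f g : (Fin d → ℂ) → ℂ} (hf : AnalyticAt ℂ f 0) (hg : AnalyticAt ℂ g 0) :
    mk f hf + mk g hg = mk (f + g) (hf.add hg) := rfl

theorem mk_mul {f g : (Fin d → ℂ) → ℂ} (hf : AnalyticAt ℂ f 0) (hg : AnalyticAt ℂ g 0) :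
    mk f hf * mk g hg = mk (f * g) (hf.mul hg) := rfl

theorem polyGerm_eq_mk (P : MvPolynomial (Fin d) ℂ) :
    polyGerm P = mk (fun x => MvPolynomial.eval x P)
      (AnalyticOnNhd.eval_mvPolynomial P 0 (Set.mem_univ _)) := rfl

/-- Constants as germs. -/
def const : ℂ →+* HolGerm d where
  toFun c := mk (fun _ => c) analyticAt_const
  map_one' := rfl
  map_zero' := rfl
  map_mul' _ _ := rfl
  map_add' _ _ := rfl

instance : Algebra ℂ (HolGerm d) := const.toAlgebra

theorem smul_mk {f : (Fin d → ℂ) → ℂ} (c : ℂ) (hf : AnalyticAt ℂ f 0) :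
    c • mk f hf = mk (fun x => c * f x) (analyticAt_const.mul hf) := rfl

/-- Polynomials as germs. -/
def ofPoly : MvPolynomial (Fin d) ℂ →ₐ[ℂ] HolGerm d where
  toFun := polyGerm
  map_one' := by
    exact ext_of_eventually (fun x => MvPolynomial.eval x (1)) (fun x => 1) rfl rfl
      (Eventually.of_forall fun x => map_one _)
  map_zero' := by
    exact ext_of_eventually (fun x => MvPolynomial.eval x (0)) (fun x => 0) rfl rfl
      (Eventually.of_forall fun x => map_zero _)
  map_mul' P Q := by
    exact ext_of_eventually (fun x => MvPolynomial.eval x (P * Q))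
      (fun x => MvPolynomial.eval x P * MvPolynomial.eval x Q) rfl rfl
      (Eventually.of_forall fun x => map_mul _ _ _)
  map_add' P Q := by
    exact ext_of_eventually (fun x => MvPolynomial.eval x (P + Q))
      (fun x => MvPolynomial.eval x P + MvPolynomial.eval x Q) rfl rfl
      (Eventually.of_forall fun x => map_add _ _ _)
  commutes' c := by
    exact ext_of_eventually (fun x => MvPolynomial.eval x (MvPolynomial.C c)) (fun x => c) rfl rfl
      (Eventually.of_forall fun x => MvPolynomial.eval_C _)

theorem ofPoly_apply (P : MvPolynomial (Fin d) ℂ) : ofPoly P = polyGerm P := rfl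

/-- The value of a germ at the origin. -/
def value : HolGerm d →ₐ[ℂ] ℂ where
  __ := (Germ.valueRingHom (E := ℂ) (x := (0 : Fin d → ℂ))).comp (holGermSubring d).subtype
  commutes' _ := rfl

@[simp]
theorem value_mk {f : (Fin d → ℂ) → ℂ} (hf : AnalyticAt ℂ f 0) : value (mk f hf) = f 0 := rfl

theorem isUnit_of_value_ne_zero {φ : HolGerm d} (h : value φ ≠ 0) : IsUnit φ := by
  obtain ⟨f, hf, rfl⟩ := exists_mk φ
  rw [value_mk] at h
  refine IsUnit.of_mul_eq_one (mk f⁻¹ (hf.inv h)) ?_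
  refine ext_of_eventually (f * f⁻¹) (fun _ => 1) rfl rfl ?_
  filter_upwards [hf.continuousAt.eventually_ne h] with x hx
  exact mul_inv_cancel₀ hx

instance : Nontrivial (HolGerm d) := (value (d := d)).toRingHom.domain_nontrivial

instance : IsLocalRing (HolGerm d) := by
  refine IsLocalRing.of_isUnit_or_isUnit_one_sub_self fun φ => ?_
  by_cases h : value φ = 0
  · exact Or.inr (isUnit_of_value_ne_zero (by simp [h]))
  · exact Or.inl (isUnit_of_value_ne_zero h)

open IsLocalRing

theorem mem_maximalIdeal_iff {φ : HolGerm d} : φ ∈ maximalIdeal (HolGerm d) ↔ value φ = 0 := by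
  rw [mem_maximalIdeal, mem_nonunits_iff]
  refine ⟨fun h => ?_, fun h hu => ?_⟩
  · by_contra h'
    exact h (isUnit_of_value_ne_zero h')
  · exact (hu.map value).ne_zero h

open UnitSeries EllOne

theorem eventually_norm_div_le (ρ : Fin d → ℝ) :
    ∀ᶠ x : Fin d → ℂ in 𝓝 0, ∀ i, ‖x i / ρ i‖ ≤ 1 := by
  rw [eventually_all]
  intro i
  have : Tendsto (fun x : Fin d → ℂ => ‖x i / ρ i‖) (𝓝 0) (𝓝 0) := by
    have h : Continuous fun x : Fin d → ℂ => ‖x i / ρ i‖ := by fun_prop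
    simpa using h.tendsto 0
  exact (this.eventually_lt_const one_pos).mono fun _ => le_of_lt

/-- The germ `x ↦ ∑ a_α (x / ρ)^α`. -/
def ofSeries (ρ : Fin d → ℝ) : UnitSeries d →ₗ[ℂ] HolGerm d where
  toFun a := mk (fun x => a.sumFun fun i => x i / ρ i) <| by
    refine AnalyticAt.fun_comp (g := a.sumFun) ?_ ?_
    · have h0 : (fun i => (0 : Fin d → ℂ) i / (ρ i : ℂ)) = 0 := funext fun i => by simp
      rw [h0]
      exact analyticAt_sumFun a
    · refine AnalyticAt.pi fun i => ?_
      exact ((ContinuousLinearMap.proj (R := ℂ) (φ := fun _ : Fin d => ℂ) i).analyticAt 0).div_const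
  map_add' a b := by
    rw [mk_add]
    refine mk_eq_mk.2 ((eventually_norm_div_le ρ).mono fun x hx => ?_)
    simp only [Pi.add_apply, ← ev_apply hx, map_add]
  map_smul' c a := by
    rw [RingHom.id_apply, smul_mk]
    refine mk_eq_mk.2 ((eventually_norm_div_le ρ).mono fun x hx => ?_)
    simp only [← ev_apply hx, map_smul, smul_eq_mul]

theorem coe_ofSeries (ρ : Fin d → ℝ) (a : UnitSeries d) :
    (ofSeries ρ a : Germ (𝓝 (0 : Fin d → ℂ)) ℂ) =
      Germ.ofFun fun x => a.sumFun fun i => x i / ρ i := rfl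

theorem ofSeries_mulL (ρ : Fin d → ℝ) (a b : UnitSeries d) :
    ofSeries ρ (mulL a b) = ofSeries ρ a * ofSeries ρ b := by
  refine ext_of_eventually _ ((fun x => a.sumFun fun i => x i / ρ i) *
    fun x => b.sumFun fun i => x i / ρ i) (coe_ofSeries ρ _) rfl
    ((eventually_norm_div_le ρ).mono fun x hx => ?_)
  simp only [Pi.mul_apply, ← ev_apply hx, ev_mulL]

theorem ofSeries_unit {ρ : Fin d → ℝ} (hρ : ∀ i, 0 < ρ i) (α : Fin d →₀ ℕ) :
    ofSeries ρ (unit α) = polyGerm (MvPolynomial.monomial α (multiPow (fun i => (ρ i : ℂ)) α)⁻¹) := by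
  refine ext_of_eventually _ _ (coe_ofSeries ρ _) rfl
    ((eventually_norm_div_le ρ).mono fun x hx => ?_)
  simp only [← ev_apply hx, ev_unit, eval_monomial_eq_multiPow]
  have h0 : multiPow (fun i => (ρ i : ℂ)) α ≠ 0 :=
    multiPow_ne_zero (fun i => by exact_mod_cast (hρ i).ne') α
  rw [eq_inv_mul_iff_mul_eq₀ h0, ← multiPow_mul]
  congr 1
  funext i
  have : (ρ i : ℂ) ≠ 0 := by exact_mod_cast (hρ i).ne'
  field_simp

theorem value_ofSeries (ρ : Fin d → ℝ) (a : UnitSeries d) : value (ofSeries ρ a) = a 0 := by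
  change a.sumFun (fun i => (0 : Fin d → ℂ) i / ρ i) = a 0
  rw [← sumFun_zero]
  congr 1
  funext i
  simp

theorem exists_ofSeries_const (φ : HolGerm d) :
    ∃ t : ℝ, 0 < t ∧ ∃ a, ofSeries (fun _ => t) a = φ := by
  obtain ⟨f, hf, rfl⟩ := exists_mk φ
  obtain ⟨t, ht, a, ha⟩ := exists_sumFun_of_analyticAt hf
  refine ⟨t, ht, a, ext_of_eventually _ f (coe_ofSeries _ _) rfl ?_⟩
  filter_upwards [eventually_norm_div_le fun _ => t] with x hx
  rw [← ha _ hx]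
  congr 1
  funext i
  have : (t : ℂ) ≠ 0 := by exact_mod_cast ht.ne'
  field_simp

/-- Series are combined only on a common polydisc; shrinking radii damps the coefficient of exponent
α by (ρ'/ρ)^α, which is also the source of the smallness estimates further on. -/
theorem exists_rescale {ρ ρ' : Fin d → ℝ} (hρ' : ∀ i, 0 < ρ' i) (h : ∀ i, ρ' i ≤ ρ i)
    (a : UnitSeries d) : ∃ b : UnitSeries d,
      (∀ α, b α = a α * multiPow (fun i => ((ρ' i / ρ i : ℝ) : ℂ)) α) ∧
      ofSeries ρ' b = ofSeries ρ a := by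
  have hρ : ∀ i, 0 < ρ i := fun i => (hρ' i).trans_le (h i)
  have hle : ∀ i, ‖((ρ' i / ρ i : ℝ) : ℂ)‖ ≤ 1 := fun i => by
    rw [Complex.norm_real, Real.norm_of_nonneg (div_pos (hρ' i) (hρ i)).le]
    exact (div_le_one (hρ i)).2 (h i)
  have hs : Summable fun α => ‖a α * multiPow (fun i => ((ρ' i / ρ i : ℝ) : ℂ)) α‖ :=
    Summable.of_nonneg_of_le (fun _ => norm_nonneg _) (fun α => by
      rw [norm_mul]
      exact mul_le_of_le_one_right (norm_nonneg _) (norm_multiPow_le_one hle α))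
      a.hasSum_norm.summable
  obtain ⟨b, hb, -⟩ := exists_of_summable hs
  refine ⟨b, hb, ext_of_eventually _ _ (coe_ofSeries _ _) (coe_ofSeries _ _)
    (Eventually.of_forall fun x => ?_)⟩
  simp only [sumFun, hb, mul_assoc, ← multiPow_mul]
  refine tsum_congr fun α => ?_
  congr 2
  funext i
  have h1 : (ρ i : ℂ) ≠ 0 := by exact_mod_cast (hρ i).ne'
  have h2 : (ρ' i : ℂ) ≠ 0 := by exact_mod_cast (hρ' i).ne'
  push_cast
  field_simp

theorem rescale_mem_orderGE {a b : UnitSeries d} {c : (Fin d →₀ ℕ) → ℂ}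
    (hb : ∀ α, b α = a α * c α) {k : ℕ} (ha : a ∈ orderGE d k) : b ∈ orderGE d k :=
  fun α hα => by rw [hb, ha α hα, zero_mul]

theorem exists_lt_degree_eq (k : ℕ) (α : Fin d →₀ ℕ) (h : k ≤ α.degree) :
    ∃ β ≤ α, β.degree = k := by
  induction k with
  | zero => exact ⟨0, by simp, by simp⟩
  | succ k ih =>
    obtain ⟨β, hβ, hk⟩ := ih (by omega)
    have : ∃ i, β i < α i := by
      by_contra! hc
      have := le_antisymm hβ hc
      rw [this] at hk
      omega
    obtain ⟨i, hi⟩ := this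
    refine ⟨β + Finsupp.single i 1, fun j => ?_, by simp [hk]⟩
    by_cases hj : j = i
    · subst hj
      simpa using hi
    · simpa [Finsupp.single_eq_of_ne hj] using hβ j

theorem polyGerm_monomial_mem (α : Fin d →₀ ℕ) (c : ℂ) :
    polyGerm (MvPolynomial.monomial α c) ∈ maximalIdeal (HolGerm d) ^ α.degree := by
  rw [← ofPoly_apply, MvPolynomial.monomial_eq, map_mul]
  refine Ideal.mul_mem_left _ _ ?_
  rw [Finsupp.prod_fintype _ _ fun i => pow_zero _, map_prod, Finsupp.degree_eq_sum,
    ← Finset.prod_pow_eq_pow_sum]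
  refine Ideal.prod_mem_prod fun i _ => ?_
  rw [map_pow]
  refine Ideal.pow_mem_pow (mem_maximalIdeal_iff.2 ?_) _
  rw [ofPoly_apply, polyGerm_eq_mk, value_mk]
  simp

/-- Each exponent α of degree at least k is assigned one divisor `b α` of degree exactly k. Sorting
the terms by this divisor writes the series as a finite sum of degree-k monomials with convergent
cofactors. -/
theorem ofSeries_mem_pow {ρ : Fin d → ℝ} (hρ : ∀ i, 0 < ρ i) {k : ℕ} {a : UnitSeries d}
    (ha : a ∈ orderGE d k) : ofSeries ρ a ∈ maximalIdeal (HolGerm d) ^ k := by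
  classical
  have hb : ∀ α : Fin d →₀ ℕ, ∃ β, k ≤ α.degree → β ≤ α ∧ β.degree = k := fun α => by
    by_cases h : k ≤ α.degree
    · obtain ⟨β, h1, h2⟩ := exists_lt_degree_eq k α h
      exact ⟨β, fun _ => ⟨h1, h2⟩⟩
    · exact ⟨0, fun h' => absurd h' h⟩
  choose b hb using hb
  let v : (Fin d →₀ ℕ) → (Fin d →₀ ℕ) → UnitSeries d :=
    fun β α => if b α = β then unit (α - β) else 0
  have hv : ∀ β α, ‖v β α‖ ≤ 1 := fun β α => by
    simp only [v]
    split_ifs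
    · exact (norm_unit _).le
    · simp
  let P : UnitSeries d →L[ℂ] UnitSeries d :=
    ∑ β ∈ expsOfDegree d k, (mulL (unit β)).comp (lift (v β) 1 (hv β))
  have hP : P a = a := by
    have h1 := a.hasSum_unit.mapL P
    refine h1.unique ?_
    convert a.hasSum_unit using 2 with α
    rw [map_smul]
    by_cases h0 : a α = 0
    · simp [h0]
    congr 1
    have hk : k ≤ α.degree := by
      by_contra h
      exact h0 (ha α h)
    simp only [P, sum_apply, ContinuousLinearMap.comp_apply, lift_unit]
    rw [Finset.sum_eq_single (b α)]
    · simp only [v, if_true, mulL_unit, shift_unit]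
      rw [add_tsub_cancel_of_le (hb α hk).1]
    · intro β _ hβ
      simp [v, Ne.symm hβ]
    · intro h
      exact absurd (mem_expsOfDegree.2 (hb α hk).2) h
  rw [← hP]
  simp only [P, sum_apply, ContinuousLinearMap.comp_apply, map_sum, ofSeries_mulL]
  refine Ideal.sum_mem _ fun β hβ => Ideal.mul_mem_right _ _ ?_
  rw [ofSeries_unit hρ, ← mem_expsOfDegree.1 hβ]
  exact polyGerm_monomial_mem _ _

/-- Orders of vanishing add under products, and both products and sums are formed after passing to
the smaller of two radii. -/
theorem exists_ofSeries_of_mem_pow (k : ℕ) {φ : HolGerm d}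
    (hφ : φ ∈ maximalIdeal (HolGerm d) ^ k) :
    ∃ t : ℝ, 0 < t ∧ ∃ a ∈ orderGE d k, ofSeries (fun _ => t) a = φ := by
  induction k generalizing φ with
  | zero =>
    obtain ⟨t, ht, a, ha⟩ := exists_ofSeries_const φ
    exact ⟨t, ht, a, fun α h => absurd (Nat.zero_le _) h, ha⟩
  | succ k ih =>
    rw [pow_succ] at hφ
    refine Submodule.mul_induction_on hφ (fun x hx y hy => ?_) fun x y hx hy => ?_
    · obtain ⟨t, ht, a, ha, rfl⟩ := ih hx
      obtain ⟨s, hs, b, rfl⟩ := exists_ofSeries_const y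
      have hb : b ∈ orderGE d 1 := fun α hα => by
        have : α = 0 := by
          rw [← Finsupp.degree_eq_zero_iff]
          simp only [Set.mem_ofPred_eq] at hα
          omega
        rw [this, ← value_ofSeries, mem_maximalIdeal_iff.1 hy]
      obtain ⟨a', ha', ea⟩ := exists_rescale (ρ' := fun _ => min t s) (ρ := fun _ => t)
        (fun _ => lt_min ht hs) (fun _ => min_le_left _ _) a
      obtain ⟨b', hb', eb⟩ := exists_rescale (ρ' := fun _ => min t s) (ρ := fun _ => s)
        (fun _ => lt_min ht hs) (fun _ => min_le_right _ _) b
      refine ⟨min t s, lt_min ht hs, mulL a' b', mulL_mem_orderGE (rescale_mem_orderGE ha' ha)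
        (rescale_mem_orderGE hb' hb), ?_⟩
      rw [ofSeries_mulL, ea, eb]
    · obtain ⟨t, ht, a, ha, rfl⟩ := hx
      obtain ⟨s, hs, b, hb, rfl⟩ := hy
      obtain ⟨a', ha', ea⟩ := exists_rescale (ρ' := fun _ => min t s) (ρ := fun _ => t)
        (fun _ => lt_min ht hs) (fun _ => min_le_left _ _) a
      obtain ⟨b', hb', eb⟩ := exists_rescale (ρ' := fun _ => min t s) (ρ := fun _ => s)
        (fun _ => lt_min ht hs) (fun _ => min_le_right _ _) b
      refine ⟨min t s, lt_min ht hs, a' + b', add_mem (rescale_mem_orderGE ha' ha)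
        (rescale_mem_orderGE hb' hb), ?_⟩
      rw [map_add, ea, eb]

/-- Taylor expansion modulo powers of the maximal ideal. -/
theorem exists_taylor (φ : HolGerm d) : ∃ c : (Fin d →₀ ℕ) → ℂ, ∀ (k : ℕ)
    (S : Finset (Fin d →₀ ℕ)), (∀ α, α.degree < k → α ∈ S) →
      φ - polyGerm (∑ α ∈ S, MvPolynomial.monomial α (c α)) ∈ maximalIdeal (HolGerm d) ^ k := by
  classical
  obtain ⟨t, ht, a, rfl⟩ := exists_ofSeries_const φ
  refine ⟨fun α => a α * (multiPow (fun i => (t : ℂ)) α)⁻¹, fun k S hS => ?_⟩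
  have h1 : polyGerm (∑ α ∈ S, MvPolynomial.monomial α (a α * (multiPow (fun i => (t : ℂ)) α)⁻¹)) =
      ofSeries (fun _ => t) (∑ α ∈ S, a α • unit α) := by
    rw [← ofPoly_apply, map_sum, map_sum]
    refine Finset.sum_congr rfl fun α _ => ?_
    rw [map_smul, ofSeries_unit fun _ => ht, ← ofPoly_apply, ← map_smul, MvPolynomial.smul_monomial,
      smul_eq_mul]
  rw [h1, ← map_sub]
  refine ofSeries_mem_pow (fun _ => ht) fun α hα => ?_
  have hαS : α ∈ S := hS α (by simpa using hα)
  have h2 : (∑ β ∈ S, a β • unit β : UnitSeries d) α = a α := by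
    rw [lp.coeFn_sum, Finset.sum_apply, Finset.sum_eq_single α]
    · rw [EllOne.coe_smul_apply, unit_apply_self, mul_one]
    · intro β _ hβ
      rw [EllOne.coe_smul_apply, unit_apply_ne hβ.symm, mul_zero]
    · exact fun h => absurd hαS h
  rw [lp.coeFn_sub, Pi.sub_apply, h2, sub_self]

end HolGerm

end

/-! ### Grauert division, Noetherianity and closedness of ideals. -/

section

/-- The injective monoid homomorphism `α ↦ ∏ p_i ^ α_i` from exponents to positive integers, where
`p_i` is the `i`-th prime. -/
def primeCode {d : ℕ} (α : Fin d →₀ ℕ) : ℕ := ∏ i : Fin d, Nat.nth Nat.Prime i ^ α i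

namespace primeCode

variable {d : ℕ}

theorem pos (α : Fin d →₀ ℕ) : 0 < primeCode α :=
  Finset.prod_pos fun i _ => pow_pos (Nat.prime_nth_prime i).pos _

/-- Unique factorization recovers the exponents from the product of prime powers. -/
theorem injective : Function.Injective (primeCode (d := d)) := by
  have hinj : Function.Injective fun i : Fin d => Nat.nth Nat.Prime i :=
    (Nat.nth_injective Nat.infinite_setOfPred_prime).comp Fin.val_injective
  have h : ∀ α : Fin d →₀ ℕ, primeCode α =
      (α.mapDomain fun i : Fin d => Nat.nth Nat.Prime i).prod (· ^ ·) := fun α => by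
    rw [Finsupp.prod_mapDomain_index (fun _ => pow_zero _) (fun _ _ _ => pow_add _ _ _),
      Finsupp.prod_fintype _ _ fun i => pow_zero _]
    rfl
  intro α β hαβ
  refine Finsupp.mapDomain_injective hinj ?_
  rw [h, h] at hαβ
  have hp : ∀ γ : Fin d →₀ ℕ, ∀ p ∈ (γ.mapDomain fun i : Fin d => Nat.nth Nat.Prime i).support,
      p.Prime := fun γ p hp => by
    obtain ⟨i, -, rfl⟩ := Finset.mem_image.1 (Finsupp.mapDomain_support hp)
    exact Nat.prime_nth_prime i
  rw [← Nat.prod_pow_factorization_eq_self (hp α), ← Nat.prod_pow_factorization_eq_self (hp β),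
    hαβ]

end primeCode

namespace HolGerm

open IsLocalRing UnitSeries EllOne

variable {d : ℕ}

/-- Power series on the polydisc of radii `p_i⁻ˢ`. -/
def primeSeries (d s : ℕ) : UnitSeries d →ₗ[ℂ] HolGerm d :=
  ofSeries fun i => ((Nat.nth Nat.Prime i : ℝ) ^ s)⁻¹

theorem primeRadius_pos (s i : ℕ) : 0 < ((Nat.nth Nat.Prime i : ℝ) ^ s)⁻¹ := by
  have : (0 : ℝ) < Nat.nth Nat.Prime i := by exact_mod_cast (Nat.prime_nth_prime i).pos
  positivity

/-- With radii p_i⁻ˢ the damping factor of a monomial is a power of its integer code. Codes are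
distinct, so as the polydisc shrinks the term of least code wins over all others. -/
theorem primeSeries_rescale (s n : ℕ) (a : UnitSeries d) : ∃ b : UnitSeries d,
    (∀ α, b α = a α * ((primeCode α : ℂ) ^ n)⁻¹) ∧ primeSeries d (s + n) b = primeSeries d s a := by
  have hp : ∀ i : ℕ, (1 : ℝ) ≤ Nat.nth Nat.Prime i := fun i => by
    exact_mod_cast (Nat.prime_nth_prime i).one_lt.le
  obtain ⟨b, hb, h⟩ := exists_rescale (ρ := fun i : Fin d => ((Nat.nth Nat.Prime i : ℝ) ^ s)⁻¹)
    (ρ' := fun i : Fin d => ((Nat.nth Nat.Prime i : ℝ) ^ (s + n))⁻¹)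
    (fun i => primeRadius_pos _ _) (fun i => by
      have := hp i
      gcongr
      · exact Nat.le_add_right s n) a
  refine ⟨b, fun α => ?_, h⟩
  rw [hb, primeCode]
  congr 1
  push_cast
  rw [multiPow, ← Finset.prod_pow, ← Finset.prod_inv_distrib]
  refine Finset.prod_congr rfl fun i _ => ?_
  have : (Nat.nth Nat.Prime i : ℂ) ≠ 0 := by exact_mod_cast (Nat.prime_nth_prime i).ne_zero
  rw [pow_add, ← pow_mul, mul_comm (α i), pow_mul, ← inv_pow (_ ^ n) (α i)]
  congr 1
  field_simp

theorem exists_primeSeries (φ : HolGerm d) : ∃ s a, primeSeries d s a = φ := by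
  obtain ⟨t, ht, a, rfl⟩ := exists_ofSeries_const φ
  obtain ⟨s, hs⟩ := exists_pow_lt_of_lt_one ht (show (1 / 2 : ℝ) < 1 by norm_num)
  obtain ⟨b, -, h⟩ := exists_rescale (ρ := fun _ => t)
    (ρ' := fun i : Fin d => ((Nat.nth Nat.Prime i : ℝ) ^ s)⁻¹) (fun i => primeRadius_pos _ _)
    (fun i => by
      refine le_trans ?_ hs.le
      rw [one_div, inv_pow]
      have : (2 : ℝ) ≤ Nat.nth Nat.Prime i := by exact_mod_cast (Nat.prime_nth_prime i).two_le
      gcongr) a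
  exact ⟨s, b, h⟩

/-- `β` is the exponent of the leading term of `a`. -/
def IsLeading (a : UnitSeries d) (β : Fin d →₀ ℕ) : Prop :=
  a β ≠ 0 ∧ ∀ γ, a γ ≠ 0 → primeCode β ≤ primeCode γ

theorem exists_isLeading {a : UnitSeries d} (ha : a ≠ 0) : ∃ β, IsLeading a β := by
  have h : {β | a β ≠ 0}.Nonempty := by
    by_contra h
    refine ha ?_
    ext β
    by_contra hβ
    exact h ⟨β, hβ⟩
  obtain ⟨β, hβ, hmin⟩ := exists_minimalFor_of_wellFoundedLT (· ∈ {β | a β ≠ 0}) primeCode h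
  exact ⟨β, hβ, fun γ hγ => (le_total _ _).elim id fun h' => hmin hγ h'⟩

/-- On small polydiscs the leading term dominates. -/
theorem IsLeading.exists_perturbation {s : ℕ} {a : UnitSeries d} {β : Fin d →₀ ℕ}
    (h : IsLeading a β) : ∃ N, ∀ n, N ≤ n → ∃ (e : UnitSeries d) (c : ℂ), ‖e‖ ≤ 1 / 2 ∧
      primeSeries d n (unit β + e) = c • primeSeries d s a := by
  -- Codes are integers, so every other exponent has code at least `primeCode β + 1`, and q bounds
  -- all the relative damping ratios.
  set q : ℝ := primeCode β / (primeCode β + 1) with hq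
  have hβ0 : (0 : ℝ) < primeCode β := by exact_mod_cast primeCode.pos β
  have hq0 : 0 ≤ q := by positivity
  have hq1 : q < 1 := by
    rw [hq, div_lt_one (by positivity)]
    linarith
  have ha0 : 0 < ‖a β‖ := norm_pos_iff.2 h.1
  have hlim : Tendsto (fun n : ℕ => ‖a‖ / ‖a β‖ * q ^ n) atTop (𝓝 0) := by
    simpa using (tendsto_pow_atTop_nhds_zero_of_lt_one hq0 hq1).const_mul (‖a‖ / ‖a β‖)
  obtain ⟨N, hN⟩ := eventually_atTop.1 (hlim.eventually_le_const (show (0 : ℝ) < 1 / 2 by norm_num))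
  refine ⟨s + N, fun m hm => ?_⟩
  obtain ⟨n, rfl⟩ : ∃ n, m = s + n := ⟨m - s, by omega⟩
  have hn : ‖a‖ / ‖a β‖ * q ^ n ≤ 1 / 2 := hN n (by omega)
  obtain ⟨b, hb, hsb⟩ := primeSeries_rescale s n a
  have hβc : (primeCode β : ℂ) ≠ 0 := by exact_mod_cast (primeCode.pos β).ne'
  -- This scalar makes the leading coefficient 1 after rescaling.
  set c : ℂ := primeCode β ^ n / a β with hc
  refine ⟨c • b - unit β, c, ?_, by rw [add_sub_cancel, map_smul, hsb]⟩
  have hle : ∀ γ, ‖(c • b - unit β : UnitSeries d) γ‖ ≤ ‖a γ‖ / ‖a β‖ * q ^ n := fun γ => by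
    rw [lp.coeFn_sub, Pi.sub_apply, EllOne.coe_smul_apply, hb]
    by_cases hγ : γ = β
    · subst hγ
      rw [unit_apply_self, hc, show (primeCode γ : ℂ) ^ n / a γ *
        (a γ * ((primeCode γ : ℂ) ^ n)⁻¹) - 1 = 0 by have := h.1; field_simp; ring]
      rw [norm_zero]
      positivity
    · rw [unit_apply_ne hγ, sub_zero]
      by_cases hγ0 : a γ = 0
      · simp [hγ0]
      have hlt : primeCode β + 1 ≤ primeCode γ :=
        lt_of_le_of_ne (h.2 γ hγ0) fun e => hγ (primeCode.injective e.symm)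
      have hlt' : (primeCode β : ℝ) + 1 ≤ primeCode γ := by exact_mod_cast hlt
      rw [hc]
      simp only [norm_mul, norm_div, norm_pow, norm_inv, Complex.norm_natCast]
      rw [show (primeCode β : ℝ) ^ n / ‖a β‖ * (‖a γ‖ * ((primeCode γ : ℝ) ^ n)⁻¹) =
        ‖a γ‖ / ‖a β‖ * (primeCode β / primeCode γ) ^ n by rw [div_pow]; ring, hq]
      gcongr
  have h1 := (c • b - unit β : UnitSeries d).hasSum_norm
  have h2 := (a.hasSum_norm.div_const ‖a β‖).mul_right (q ^ n)
  exact (hasSum_le hle h1 h2).trans hn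

/-- Exponents of leading terms of elements of an ideal. -/
def leadingExps (I : Ideal (HolGerm d)) : Set (Fin d →₀ ℕ) :=
  {β | ∃ s a, primeSeries d s a ∈ I ∧ IsLeading a β}

/-- Grauert division by elements with dominating leading terms. -/
theorem exists_division (Λ : Finset (Fin d →₀ ℕ)) (e : (Fin d →₀ ℕ) → UnitSeries d)
    (he : ∀ β ∈ Λ, ‖e β‖ ≤ 1 / 2) (a : UnitSeries d) :
    ∃ (Q : (Fin d →₀ ℕ) → UnitSeries d) (R : UnitSeries d),
      (∀ α, R α ≠ 0 → ∀ β ∈ Λ, ¬ β ≤ α) ∧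
      a = R + ∑ β ∈ Λ, mulL (Q β) (unit β + e β) := by
  classical
  have hj : ∀ α, ∃ β, (∃ β ∈ Λ, β ≤ α) → β ∈ Λ ∧ β ≤ α := fun α => by
    by_cases h : ∃ β ∈ Λ, β ≤ α
    · exact ⟨h.choose, fun _ => h.choose_spec⟩
    · exact ⟨0, fun h' => absurd h' h⟩
  choose j hj using hj
  let up : (Fin d →₀ ℕ) → Prop := fun α => ∃ β ∈ Λ, β ≤ α
  let v : (Fin d →₀ ℕ) → UnitSeries d := fun α => if up α then shift (α - j α) (e (j α)) else 0
  have hv : ∀ α, ‖v α‖ ≤ 1 / 2 := fun α => by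
    simp only [v]
    split_ifs with h
    · exact (norm_shift_apply_le _ _).trans (he _ (hj α h).1)
    · simp
  let r : (Fin d →₀ ℕ) → UnitSeries d := fun α => if up α then 0 else unit α
  have hr : ∀ α, ‖r α‖ ≤ 1 := fun α => by
    simp only [r]
    split_ifs
    · simp
    · exact (norm_unit α).le
  let q : (Fin d →₀ ℕ) → (Fin d →₀ ℕ) → UnitSeries d :=
    fun β α => if up α ∧ j α = β then unit (α - β) else 0
  have hq : ∀ β α, ‖q β α‖ ≤ 1 := fun β α => by
    simp only [q]
    split_ifs
    · exact (norm_unit _).le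
    · simp
  -- The operator on the left fixes x^α if no exponent of Λ divides it, and otherwise sends it to
  -- x^(α-β)(x^β + e_β) with β = j α. Being within 1/2 of the identity it is invertible; applied to
  -- the preimage H of a, the two sides give the division formula.
  have hsplit : (1 : UnitSeries d →L[ℂ] UnitSeries d) + lift v (1 / 2) hv = lift r 1 hr +
      ∑ β ∈ Λ, (mulL.flip (unit β + e β)).comp (lift (q β) 1 (hq β)) := by
    refine ext_unit fun α => ?_
    simp only [add_apply, sum_apply, ContinuousLinearMap.comp_apply, lift_unit,
      one_apply_eq_self, ContinuousLinearMap.flip_apply]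
    by_cases h : up α
    · rw [Finset.sum_eq_single (j α)]
      · simp only [v, r, q, h, if_true, true_and, mulL_unit, map_add, shift_unit, zero_add]
        rw [tsub_add_cancel_of_le (hj α h).2]
      · intro β _ hβ
        simp [q, Ne.symm hβ]
      · intro h'
        exact absurd (hj α h).1 h'
    · simp [v, r, q, h]
  have hunit : IsUnit (1 - (-lift v (1 / 2) hv) : UnitSeries d →L[ℂ] UnitSeries d) := by
    refine isUnit_one_sub_of_norm_lt_one ?_
    rw [norm_neg]
    exact (opNorm_lift_le v (1 / 2) (by norm_num) hv).trans_lt (by norm_num)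
  obtain ⟨u, hu⟩ := hunit
  have hH : a = (1 + lift v (1 / 2) hv : UnitSeries d →L[ℂ] UnitSeries d)
      ((↑u⁻¹ : UnitSeries d →L[ℂ] UnitSeries d) a) := by
    rw [← sub_neg_eq_add, ← hu, ← mul_apply_eq_comp, Units.mul_inv,
      one_apply_eq_self]
  set H := (↑u⁻¹ : UnitSeries d →L[ℂ] UnitSeries d) a
  refine ⟨fun β => lift (q β) 1 (hq β) H, lift r 1 hr H, fun α hα => ?_, ?_⟩
  · have hmem : lift r 1 hr H ∈ supportedOn {α | ¬ up α} :=
      lift_mem r 1 hr H (isClosed_supportedOn _) fun γ _ => by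
        simp only [r]
        split_ifs with h
        · exact zero_mem _
        · exact unit_mem_supportedOn h
    by_contra! hc
    exact hα (hmem α fun h => h hc)
  · rw [hsplit] at hH
    simpa only [add_apply, sum_apply, ContinuousLinearMap.comp_apply,
      ContinuousLinearMap.flip_apply] using hH

/-- By Dickson's lemma finitely many leading exponents of I divide all others; elements of I
realizing them generate I, because the remainder of a division by them would, if nonzero, have a
leading exponent that none of them divides. -/
instance : IsNoetherianRing (HolGerm d) := by
  classical
  rw [isNoetherianRing_iff_ideal_fg]
  intro I
  have hfin : {β | Minimal (· ∈ leadingExps I) β}.Finite :=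
    WellQuasiOrderedLE.finite_of_isAntichain (setOfPred_minimal_antichain _)
  obtain ⟨Λ, hΛ⟩ := hfin.exists_finset_coe
  have hmin : ∀ β ∈ leadingExps I, ∃ γ ∈ Λ, γ ≤ β := fun β hβ => by
    obtain ⟨γ, hγ, hm⟩ := exists_minimal_le_of_wellFoundedLT (· ∈ leadingExps I) β hβ
    exact ⟨γ, by rw [← Finset.mem_coe, hΛ]; exact hm, hγ⟩
  have hlead : ∀ β, ∃ (g : HolGerm d) (N : ℕ), β ∈ Λ → g ∈ I ∧ ∀ n, N ≤ n →
      ∃ (e : UnitSeries d) (c : ℂ), ‖e‖ ≤ 1 / 2 ∧ primeSeries d n (unit β + e) = c • g := fun β => by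
    by_cases hβ : β ∈ Λ
    · rw [← Finset.mem_coe, hΛ] at hβ
      obtain ⟨s, a, ha, hl⟩ := hβ.prop
      obtain ⟨N, hN⟩ := hl.exists_perturbation (s := s)
      exact ⟨_, N, fun _ => ⟨ha, hN⟩⟩
    · exact ⟨0, 0, fun h => absurd h hβ⟩
  choose g N hg using hlead
  refine ⟨Λ.image g, le_antisymm ?_ ?_⟩
  · rw [Ideal.span_le]
    intro x hx
    obtain ⟨β, hβ, rfl⟩ := Finset.mem_image.1 (Finset.mem_coe.1 hx)
    exact (hg β hβ).1
  intro φ hφ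
  obtain ⟨s, a₀, rfl⟩ := exists_primeSeries φ
  obtain ⟨a, -, ha⟩ := primeSeries_rescale s (Λ.sup N) a₀
  rw [← ha] at hφ ⊢
  -- A polydisc on which φ converges and all chosen generators have dominating leading terms at
  -- once.
  set n := s + Λ.sup N with hn
  have hpert : ∀ β, ∃ (e : UnitSeries d) (c : ℂ), β ∈ Λ → ‖e‖ ≤ 1 / 2 ∧
      primeSeries d n (unit β + e) = c • g β := fun β => by
    by_cases hβ : β ∈ Λ
    · obtain ⟨e, c, h⟩ := (hg β hβ).2 n ((Finset.le_sup hβ).trans (Nat.le_add_left _ _))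
      exact ⟨e, c, fun _ => h⟩
    · exact ⟨0, 0, fun h => absurd h hβ⟩
  choose e c he using hpert
  obtain ⟨Q, R, hR, hQ⟩ := exists_division Λ e (fun β hβ => (he β hβ).1) a
  have hsum : ∀ J : Ideal (HolGerm d), (∀ β ∈ Λ, g β ∈ J) →
      primeSeries d n (∑ β ∈ Λ, mulL (Q β) (unit β + e β)) ∈ J := fun J hJ => by
    rw [map_sum]
    refine J.sum_mem fun β hβ => ?_
    rw [primeSeries, ofSeries_mulL]
    refine J.mul_mem_left _ ?_
    rw [← primeSeries, (he β hβ).2, Algebra.smul_def]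
    exact J.mul_mem_left _ (hJ β hβ)
  have hR0 : R = 0 := by
    by_contra hne
    obtain ⟨β, hβ⟩ := exists_isLeading hne
    have hRI : primeSeries d n R ∈ I := by
      have : R = a - ∑ β ∈ Λ, mulL (Q β) (unit β + e β) := by rw [hQ]; abel
      rw [this, map_sub]
      exact I.sub_mem hφ (hsum I fun β hβ => (hg β hβ).1)
    obtain ⟨γ, hγ, hle⟩ := hmin β ⟨n, R, hRI, hβ⟩
    exact hR β hβ.1 γ hγ hle
  rw [hQ, hR0, zero_add]
  exact hsum _ fun β hβ => Ideal.subset_span (Finset.mem_coe.2 (Finset.mem_image_of_mem g hβ))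

/-- Ideals are closed in the Krull topology. -/
theorem mem_of_forall_mem_sup_pow {I : Ideal (HolGerm d)} {φ : HolGerm d}
    (h : ∀ k, φ ∈ I ⊔ maximalIdeal (HolGerm d) ^ k) : φ ∈ I := by
  -- Krull's intersection theorem for the finite module 𝒪/I.
  have hb := Ideal.iInf_pow_smul_eq_bot_of_isLocalRing (M := HolGerm d ⧸ I)
    (maximalIdeal (HolGerm d)) (Ideal.IsPrime.ne_top')
  rw [← Ideal.Quotient.eq_zero_iff_mem, ← Submodule.mem_bot (R := HolGerm d), ← hb,
    Submodule.mem_iInf]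
  intro k
  obtain ⟨x, hx, y, hy, rfl⟩ := Submodule.mem_sup.1 (h k)
  rw [map_add, Ideal.Quotient.eq_zero_iff_mem.2 hx, zero_add]
  have : Ideal.Quotient.mk I y = y • (1 : HolGerm d ⧸ I) := by
    rw [Algebra.smul_def, mul_one]
    rfl
  rw [this]
  exact Submodule.smul_mem_smul hy trivial

end HolGerm

end

/-! ### Generalized eigenspaces, lifting of generalized eigenvectors, and integer weights. -/

section

namespace Module.End

variable {K V W : Type*} [Field K] [AddCommGroup V] [Module K V] [AddCommGroup W] [Module K W]

/-- From T(xy) - ab·xy = (Tx - ax)·Ty + a·x·(Ty - by), by induction on the sum of the two nilpotency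
orders; Ty is killed by the same power of T - b as y. -/
theorem mul_mem_maxGenEigenspace {A : Type*} [CommRing A] [Algebra K A] (T : A →ₐ[K] A)
    {a b : K} {x y : A} (hx : x ∈ maxGenEigenspace T.toLinearMap a)
    (hy : y ∈ maxGenEigenspace T.toLinearMap b) :
    x * y ∈ maxGenEigenspace T.toLinearMap (a * b) := by
  obtain ⟨n, hn⟩ := (mem_maxGenEigenspace _ _ _).1 hx
  obtain ⟨m, hm⟩ := (mem_maxGenEigenspace _ _ _).1 hy
  clear hx hy
  obtain ⟨N, hN⟩ : ∃ N, n + m ≤ N := ⟨_, le_rfl⟩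
  induction N generalizing n m x y with
  | zero =>
    obtain rfl : n = 0 := by omega
    obtain rfl : x = 0 := by simpa using hn
    simp
  | succ N ih =>
    rcases n with _ | n
    · obtain rfl : x = 0 := by simpa using hn
      simp
    rcases m with _ | m
    · obtain rfl : y = 0 := by simpa using hm
      simp
    have hcomm : Commute T.toLinearMap ((T.toLinearMap - b • (1 : End K A)) ^ (m + 1)) :=
      ((Commute.refl _).sub_right ((Commute.one_right _).smul_right b)).pow_right _
    have hTy : ((T.toLinearMap - b • (1 : End K A)) ^ (m + 1)) (T y) = 0 := by
      have := DFunLike.congr_fun hcomm.eq y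
      simp only [Module.End.mul_apply, hm, map_zero] at this
      exact this.symm
    have h1 := ih (x := (T.toLinearMap - a • (1 : End K A)) x) (y := T y) n
      (by rw [pow_succ, Module.End.mul_apply] at hn; exact hn) (m + 1) hTy (by omega)
    have h2 := ih (x := x) (y := (T.toLinearMap - b • (1 : End K A)) y) (n + 1) hn m
      (by rw [pow_succ, Module.End.mul_apply] at hm; exact hm) (by omega)
    have h3 : (T.toLinearMap - (a * b) • (1 : End K A)) (x * y) =
        (T.toLinearMap - a • (1 : End K A)) x * T y +
          a • (x * (T.toLinearMap - b • (1 : End K A)) y) := by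
      simp only [LinearMap.sub_apply, AlgHom.toLinearMap_apply, LinearMap.smul_apply,
        Module.End.one_apply]
      simp only [map_mul, Algebra.smul_def]
      ring
    have h4 := add_mem h1 (Submodule.smul_mem _ a h2)
    rw [← h3] at h4
    obtain ⟨k, hk⟩ := (mem_maxGenEigenspace _ _ _).1 h4
    exact (mem_maxGenEigenspace _ _ _).2 ⟨k + 1, by rw [pow_succ, Module.End.mul_apply, hk]⟩

theorem map_sub_smul_pow (f : V →ₗ[K] W) {T : End K V} {T' : End K W}
    (h : ∀ x, f (T x) = T' (f x)) (c : K) (k : ℕ) (x : V) :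
    f (((T - c • (1 : End K V)) ^ k) x) = ((T' - c • (1 : End K W)) ^ k) (f x) := by
  induction k generalizing x with
  | zero => simp
  | succ k ih =>
    rw [pow_succ, pow_succ, Module.End.mul_apply, Module.End.mul_apply, ih]
    congr 1
    simp [h]

theorem map_mem_maxGenEigenspace (f : V →ₗ[K] W) {T : End K V} {T' : End K W}
    (h : ∀ x, f (T x) = T' (f x)) {c : K} {x : V} (hx : x ∈ maxGenEigenspace T c) :
    f x ∈ maxGenEigenspace T' c := by
  obtain ⟨k, hk⟩ := (mem_maxGenEigenspace _ _ _).1 hx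
  exact (mem_maxGenEigenspace _ _ _).2 ⟨k, by rw [← map_sub_smul_pow f h, hk, map_zero]⟩

/-- An invariant subspace containing a sum of generalized eigenvectors for distinct eigenvalues
contains every summand. -/
theorem mem_of_sum_mem {T : End K V} {M : Submodule K V} (hM : ∀ x ∈ M, T x ∈ M) (s : Finset K)
    (v : K → V) (hv : ∀ c ∈ s, v c ∈ maxGenEigenspace T c) (hsum : ∑ c ∈ s, v c ∈ M) :
    ∀ c ∈ s, v c ∈ M := by
  classical
  intro c hc
  have hq : ∀ x, M.mkQ (T x) = M.mapQ M T hM (M.mkQ x) := fun x => rfl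
  have hq' : ∀ c ∈ s, M.mkQ (v c) ∈ maxGenEigenspace (M.mapQ M T hM) c := fun c hc =>
    map_mem_maxGenEigenspace M.mkQ hq (hv c hc)
  have hd := independent_maxGenEigenspace (M.mapQ M T hM) c
  rw [Submodule.disjoint_def] at hd
  rw [← M.ker_mkQ, LinearMap.mem_ker] at hsum ⊢
  refine hd _ (hq' c hc) ?_
  rw [← Finset.add_sum_erase s v hc, map_add, map_sum] at hsum
  rw [eq_neg_of_add_eq_zero_left hsum]
  refine neg_mem (Submodule.sum_mem _ fun c' hc' => ?_)
  obtain ⟨h1, h2⟩ := Finset.mem_erase.1 hc'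
  exact Submodule.mem_iSup_of_mem c' (Submodule.mem_iSup_of_mem h1 (hq' c' h2))

theorem aeval_X_sub_C_end (T : End K V) (c : K) :
    Polynomial.aeval T (Polynomial.X - Polynomial.C c) = T - c • (1 : End K V) := by
  rw [map_sub, Polynomial.aeval_X, Polynomial.aeval_C, Algebra.algebraMap_eq_smul_one]

/-- Generalized eigenvectors lift along an equivariant map whose kernel contains an invariant
subspace of finite codimension on which `T - c` is surjective. -/
theorem exists_lift_maxGenEigenspace {T : End K V} {T' : End K W} {f : V →ₗ[K] W}
    (h : ∀ x, f (T x) = T' (f x)) {N : Submodule K V} (hN : ∀ x ∈ N, T x ∈ N)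
    (hker : ∀ x ∈ N, f x = 0) [FiniteDimensional K (V ⧸ N)] {c : K}
    (hsurj : ∀ g ∈ N, ∃ u ∈ N, T u - c • u = g) {x : V} (hx : f x ∈ maxGenEigenspace T' c) :
    ∃ u ∈ maxGenEigenspace T c, f u = f x := by
  have hpoly : ∀ (p : Polynomial K) (y : V), f (Polynomial.aeval T p y) =
      Polynomial.aeval T' p (f y) := fun p y => by
    induction p using Polynomial.induction_on' generalizing y with
    | add p q hp hq => simp [hp, hq]
    | monomial n a =>
      have : ∀ y, f ((T ^ n) y) = (T' ^ n) (f y) := fun y => by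
        simpa using map_sub_smul_pow f h 0 n y
      simp [Polynomial.aeval_monomial, this]
  have hpolyq : ∀ (p : Polynomial K) (y : V), N.mkQ (Polynomial.aeval T p y) =
      Polynomial.aeval (N.mapQ N T hN) p (N.mkQ y) := fun p y => by
    induction p using Polynomial.induction_on' generalizing y with
    | add p q hp hq => simp only [map_add, LinearMap.add_apply, hp, hq]
    | monomial n a =>
      have : ∀ y, N.mkQ ((T ^ n) y) = ((N.mapQ N T hN) ^ n) (N.mkQ y) := fun y => by
        have := map_sub_smul_pow (T' := N.mapQ N T hN) N.mkQ (fun _ => rfl) 0 n y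
        simpa only [zero_smul, sub_zero] using this
      simp only [Polynomial.aeval_monomial, Module.End.mul_apply, this,
        Module.algebraMap_end_apply, map_smul]
  -- q(T) maps everything into N. Splitting off the factor (X - c)^n leaves q' coprime to X - c.
  set q := minpoly K (N.mapQ N T hN) with hqdef
  have hq0 : q ≠ 0 := minpoly.ne_zero (Algebra.IsIntegral.isIntegral _)
  have hqN : ∀ y, Polynomial.aeval T q y ∈ N := fun y => by
    rw [← N.ker_mkQ, LinearMap.mem_ker, hpolyq, minpoly.aeval, LinearMap.zero_apply]
  obtain ⟨q', hq', hndvd⟩ := Polynomial.exists_eq_pow_rootMultiplicity_mul_and_not_dvd q hq0 c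
  set n := q.rootMultiplicity c
  obtain ⟨m, hm⟩ := (mem_maxGenEigenspace _ _ _).1 hx
  have hcop : IsCoprime ((Polynomial.X - Polynomial.C c) ^ m) q' :=
    IsCoprime.pow_left ((Polynomial.irreducible_X_sub_C c).coprime_iff_not_dvd.2 hndvd)
  obtain ⟨s, a, hsa⟩ := hcop
  -- By the Bézout relation, a·q' is 1 modulo (X - c)^m, so u has the same image as x, while (T -
  -- c)^n u = (q·a)(T) x lies in N.
  set u := Polynomial.aeval T (a * q') x with hu
  have hfu : f u = f x := by
    rw [hu, hpoly, show a * q' = 1 - s * (Polynomial.X - Polynomial.C c) ^ m by rw [← hsa]; ring]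
    rw [map_sub, map_mul, map_pow, aeval_X_sub_C_end, map_one, LinearMap.sub_apply,
      Module.End.mul_apply, hm]
    simp
  have hun : ((T - c • (1 : End K V)) ^ n) u ∈ N := by
    rw [hu, ← aeval_X_sub_C_end, ← map_pow, ← Module.End.mul_apply, ← map_mul,
      show (Polynomial.X - Polynomial.C c) ^ n * (a * q') = q * a by
        rw [hq']; ring, map_mul, Module.End.mul_apply]
    exact hqN _
  have hsurjn : ∀ k, ∀ g ∈ N, ∃ u ∈ N, ((T - c • (1 : End K V)) ^ k) u = g := fun k => by
    induction k with
    | zero => exact fun g hg => ⟨g, hg, by simp⟩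
    | succ k ih =>
      intro g hg
      obtain ⟨u, hu, rfl⟩ := ih g hg
      obtain ⟨w, hw, rfl⟩ := hsurj u hu
      exact ⟨w, hw, by rw [pow_succ, Module.End.mul_apply]; rfl⟩
  -- Subtracting w ∈ N removes the defect of u without changing its image under f.
  obtain ⟨w, hw, hwu⟩ := hsurjn n _ hun
  refine ⟨u - w, (mem_maxGenEigenspace _ _ _).2 ⟨n, by rw [map_sub, hwu, sub_self]⟩, ?_⟩
  rw [map_sub, hfu, hker w hw, sub_zero]

end Module.End

/-- Positive real weights can be replaced by positive integer weights satisfying the same linear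
relations with integer coefficients. -/
theorem exists_nat_weights {d : ℕ} (v : Fin d → ℝ) (hv : ∀ i, 0 < v i) :
    ∃ w : Fin d → ℕ, (∀ i, 0 < w i) ∧ ∀ α β : Fin d →₀ ℕ,
      ∑ i, α i * v i = ∑ i, β i * v i → ∑ i, α i * w i = ∑ i, β i * w i := by
  -- Rational relations among the weights survive under any ℚ-linear functional on S. The functional
  -- φ below has rational values close enough to the inclusion S → ℝ to stay positive on the
  -- weights; clearing denominators gives integers.
  let S : Submodule ℚ ℝ := Submodule.span ℚ (Set.range v)
  have : FiniteDimensional ℚ S := FiniteDimensional.span_of_finite ℚ (Set.finite_range v)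
  let b := Module.finBasis ℚ S
  let v' : Fin d → S := fun i => ⟨v i, Submodule.subset_span ⟨i, rfl⟩⟩
  let Θ : (Fin (Module.finrank ℚ S) → ℝ) → Fin d → ℝ := fun x i => ∑ j, (b.repr (v' i) j : ℝ) * x j
  have hΘ : Continuous Θ := by fun_prop
  have hΘb : Θ (fun j => (b j : ℝ)) = v := by
    funext i
    have h1 : ∑ j, b.repr (v' i) j • b j = v' i := b.sum_repr (v' i)
    have h2 := congrArg S.subtype h1
    rw [map_sum] at h2
    simp only [map_smul, Rat.smul_def] at h2
    exact h2
  have hopen : IsOpen {x | ∀ i, 0 < Θ x i} := by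
    rw [Set.ofPred_forall]
    exact isOpen_iInter_of_finite fun i =>
      isOpen_lt continuous_const ((continuous_apply i).comp hΘ)
  have hdense : DenseRange fun (r : Fin (Module.finrank ℚ S) → ℚ) j => (r j : ℝ) :=
    DenseRange.piMap fun _ => Rat.denseRange_cast
  obtain ⟨r, hr⟩ := hdense.exists_mem_open hopen ⟨fun j => (b j : ℝ), fun i => by rw [hΘb]; exact hv i⟩
  let φ : S →ₗ[ℚ] ℚ := b.constr ℚ r
  have hφ : ∀ i, 0 < φ (v' i) := fun i => by
    have h1 : φ (v' i) = ∑ j, b.repr (v' i) j * r j := by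
      simp [φ, Module.Basis.constr_apply_fintype]
    have h2 := hr i
    simp only [Θ] at h2
    rw [h1]
    exact_mod_cast h2
  let D : ℕ := ∏ i, (φ (v' i)).den
  have hD : 0 < D := Finset.prod_pos fun i _ => (φ (v' i)).den_pos
  have hw : ∀ i, ∃ n : ℕ, (n : ℚ) = φ (v' i) * D := fun i => by
    obtain ⟨e, he⟩ : (φ (v' i)).den ∣ D := Finset.dvd_prod_of_mem _ (Finset.mem_univ i)
    have hnum : ((φ (v' i)).num.toNat : ℚ) = (φ (v' i)).num := by
      have : (((φ (v' i)).num.toNat : ℤ) : ℚ) = (φ (v' i)).num := by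
        rw [Int.toNat_of_nonneg (Rat.num_pos.2 (hφ i)).le]
      exact_mod_cast this
    refine ⟨(φ (v' i)).num.toNat * e, ?_⟩
    rw [he]
    push_cast
    rw [hnum, ← mul_assoc, Rat.mul_den_eq_num]
  choose w hw using hw
  refine ⟨w, fun i => ?_, fun α β h => ?_⟩
  · have : (0 : ℚ) < w i := by
      rw [hw]
      exact mul_pos (hφ i) (by exact_mod_cast hD)
    exact_mod_cast this
  · have hS : ∑ i, (α i : ℚ) • v' i = ∑ i, (β i : ℚ) • v' i := by
      apply Subtype.ext
      simpa [v', Rat.smul_def] using h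
    have h2 := congrArg φ hS
    simp only [map_sum, map_smul, smul_eq_mul] at h2
    have h3 : ∀ γ : Fin d →₀ ℕ, ((∑ i, γ i * w i : ℕ) : ℚ) = (∑ i, (γ i : ℚ) * φ (v' i)) * D :=
      fun γ => by
        push_cast
        rw [Finset.sum_mul]
        exact Finset.sum_congr rfl fun i _ => by rw [hw, mul_assoc]
    have h4 : ((∑ i, α i * w i : ℕ) : ℚ) = (∑ i, β i * w i : ℕ) := by rw [h3, h3, h2]
    exact_mod_cast h4

end

/-! ### Pullback of germs and decomposition into isotypic polynomials. -/

section

open HolGerm IsLocalRing Module.End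

namespace BiholGerm

variable {d : ℕ}

/-- The action of a biholomorphic germ on germs of functions, as an algebra homomorphism. -/
def pullbackAlg (F : BiholGerm d) : HolGerm d →ₐ[ℂ] HolGerm d where
  __ := F.pullback
  commutes' _ := rfl

/-- The action of a biholomorphic germ on germs of functions, as a linear map. -/
abbrev pullbackEnd (F : BiholGerm d) : Module.End ℂ (HolGerm d) := F.pullbackAlg.toLinearMap

theorem analyticAt_comp (F : BiholGerm d) {f : (Fin d → ℂ) → ℂ} (hf : AnalyticAt ℂ f 0) :
    AnalyticAt ℂ (f ∘ F) 0 :=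
  AnalyticAt.comp (by rwa [F.map_zero]) F.analyticAt_toFun

theorem pullback_mk (F : BiholGerm d) {f : (Fin d → ℂ) → ℂ} (hf : AnalyticAt ℂ f 0) :
    F.pullback (HolGerm.mk f hf) = HolGerm.mk (f ∘ F) (F.analyticAt_comp hf) := rfl

theorem pullback_pullback_of_semiconj {F G Φ : BiholGerm d}
    (h : ∀ᶠ x in 𝓝 (0 : Fin d → ℂ), G (Φ x) = Φ (F x)) (ψ : HolGerm d) :
    Φ.pullback (G.pullback ψ) = F.pullback (Φ.pullback ψ) := by
  obtain ⟨f, hf, rfl⟩ := exists_mk ψ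
  exact ext_of_eventually ((f ∘ G) ∘ Φ) ((f ∘ Φ) ∘ F) rfl rfl
    (h.mono fun x hx => by simp only [Function.comp_apply, hx])

/-- The inverse germ. -/
def symm (F : BiholGerm d) : BiholGerm d where
  toFun := F.invFun
  invFun := F.toFun
  map_zero := F.inv_map_zero
  inv_map_zero := F.map_zero
  analyticAt_toFun := F.analyticAt_invFun
  analyticAt_invFun := F.analyticAt_toFun
  left_inv := F.right_inv
  right_inv := F.left_inv

theorem pullback_symm_pullback (F : BiholGerm d) (ψ : HolGerm d) :
    F.pullback (F.symm.pullback ψ) = ψ := by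
  obtain ⟨f, hf, rfl⟩ := exists_mk ψ
  exact ext_of_eventually ((f ∘ F.symm) ∘ F) f rfl rfl
    (F.left_inv.mono fun x hx => congrArg f hx)

theorem pullback_surjective (F : BiholGerm d) : Function.Surjective F.pullback :=
  fun ψ => ⟨_, F.pullback_symm_pullback ψ⟩

theorem value_pullback (F : BiholGerm d) (φ : HolGerm d) : value (F.pullback φ) = value φ := by
  obtain ⟨f, hf, rfl⟩ := exists_mk φ
  rw [pullback_mk, value_mk, value_mk, Function.comp_apply, F.map_zero]

theorem pullback_mem_pow (F : BiholGerm d) {k : ℕ} {φ : HolGerm d}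
    (h : φ ∈ maximalIdeal (HolGerm d) ^ k) : F.pullback φ ∈ maximalIdeal (HolGerm d) ^ k := by
  have h1 : (maximalIdeal (HolGerm d)).map F.pullback ≤ maximalIdeal (HolGerm d) := by
    rw [Ideal.map_le_iff_le_comap]
    intro φ hφ
    rw [Ideal.mem_comap, mem_maximalIdeal_iff, value_pullback]
    exact mem_maximalIdeal_iff.1 hφ
  have h2 := Ideal.mem_map_of_mem F.pullback h
  rw [Ideal.map_pow] at h2
  exact Ideal.pow_right_mono h1 k h2

theorem leavesInvariant_span {F : BiholGerm d} {s : Set (HolGerm d)}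
    (h : ∀ φ ∈ s, F.pullback φ ∈ Ideal.span s) : F.LeavesInvariant (Ideal.span s) := by
  have : Ideal.span s ≤ (Ideal.span s).comap F.pullback := Ideal.span_le.2 h
  exact this

end BiholGerm

/-- All monomials `x^α` of `P` satisfy `λ^α = c`. -/
def IsLambdaIsotypic {d : ℕ} (lam : Fin d → ℂ) (c : ℂ) (P : MvPolynomial (Fin d) ℂ) : Prop :=
  ∀ α ∈ P.support, multiPow lam α = c

namespace IsLambdaIsotypic

variable {d : ℕ} {lam : Fin d → ℂ} {c c' : ℂ} {P Q : MvPolynomial (Fin d) ℂ}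

theorem isLambdaHomogeneous (h : IsLambdaIsotypic lam c P) : IsLambdaHomogeneous lam P := by
  by_cases hP : ∃ γ, γ ∈ P.support
  · obtain ⟨γ, hγ⟩ := hP
    exact ⟨γ, fun α hα => by rw [h α hα, h γ hγ]⟩
  · exact ⟨0, fun α hα => absurd ⟨α, hα⟩ hP⟩

theorem zero : IsLambdaIsotypic lam c 0 := by simp [IsLambdaIsotypic]

theorem add (hP : IsLambdaIsotypic lam c P) (hQ : IsLambdaIsotypic lam c Q) :
    IsLambdaIsotypic lam c (P + Q) := by
  classical
  intro α hα
  exact (Finset.mem_union.1 (MvPolynomial.support_add hα)).elim (hP α) (hQ α)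

theorem sum {ι : Type*} {s : Finset ι} {P : ι → MvPolynomial (Fin d) ℂ}
    (h : ∀ i ∈ s, IsLambdaIsotypic lam c (P i)) : IsLambdaIsotypic lam c (∑ i ∈ s, P i) :=
  Finset.sum_induction _ (IsLambdaIsotypic lam c) (fun _ _ => add) zero h

theorem mul (hP : IsLambdaIsotypic lam c P) (hQ : IsLambdaIsotypic lam c' Q) :
    IsLambdaIsotypic lam (c * c') (P * Q) := by
  classical
  intro α hα
  obtain ⟨β, hβ, γ, hγ, rfl⟩ := Finset.mem_add.1 (MvPolynomial.support_mul _ _ hα)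
  rw [multiPow_add, hP β hβ, hQ γ hγ]

theorem monomial (α : Fin d →₀ ℕ) (a : ℂ) :
    IsLambdaIsotypic lam (multiPow lam α) (MvPolynomial.monomial α a) := by
  intro β hβ
  rw [Finset.mem_singleton.1 (MvPolynomial.support_monomial_subset hβ)]

theorem smul (hP : IsLambdaIsotypic lam c P) (a : ℂ) : IsLambdaIsotypic lam c (a • P) :=
  fun α hα => hP α (MvPolynomial.support_smul hα)

theorem pow (hP : IsLambdaIsotypic lam c P) (n : ℕ) : IsLambdaIsotypic lam (c ^ n) (P ^ n) := by
  induction n with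
  | zero => simpa using (IsLambdaIsotypic.monomial (lam := lam) 0 1)
  | succ n ih =>
    rw [pow_succ, pow_succ]
    exact ih.mul hP

theorem prod {ι : Type*} {s : Finset ι} {a : ι → ℂ} {P : ι → MvPolynomial (Fin d) ℂ}
    (h : ∀ i ∈ s, IsLambdaIsotypic lam (a i) (P i)) :
    IsLambdaIsotypic lam (∏ i ∈ s, a i) (∏ i ∈ s, P i) := by
  classical
  induction s using Finset.induction_on with
  | empty => simpa using (IsLambdaIsotypic.monomial (lam := lam) 0 1)
  | insert i s hi ih =>
    rw [Finset.prod_insert hi, Finset.prod_insert hi]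
    exact (h i (Finset.mem_insert_self _ _)).mul (ih fun j hj => h j (Finset.mem_insert_of_mem hj))

theorem aeval {Q : Fin d → MvPolynomial (Fin d) ℂ} (hQ : ∀ i, IsLambdaIsotypic lam (lam i) (Q i))
    (hP : IsLambdaIsotypic lam c P) : IsLambdaIsotypic lam c (MvPolynomial.aeval Q P) := by
  rw [P.as_sum, map_sum]
  refine sum fun α hα => ?_
  rw [MvPolynomial.aeval_monomial, Finsupp.prod_fintype _ _ fun i => pow_zero _,
    ← Algebra.smul_def, ← hP α hα]
  exact (prod fun i _ => (hQ i).pow (α i)).smul _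

end IsLambdaIsotypic

section Isotypic

variable {d : ℕ} {lam : Fin d → ℂ}

/-- With q = max |λ_i| < 1 one has |λ^α| ≤ q^|α|, so a nonzero value of λ^α bounds the degree. -/
theorem finite_multiPow_eq (h : ∀ i, ‖lam i‖ < 1) {c : ℂ} (hc : c ≠ 0) :
    {α : Fin d →₀ ℕ | multiPow lam α = c}.Finite := by
  obtain ⟨q, hq0, hq1, hq⟩ : ∃ q : ℝ, 0 ≤ q ∧ q < 1 ∧ ∀ i, ‖lam i‖ ≤ q := by
    refine ⟨‖lam‖, norm_nonneg _, ?_, norm_le_pi_norm lam⟩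
    exact (pi_norm_lt_iff one_pos).2 h
  obtain ⟨n, hn⟩ := exists_pow_lt_of_lt_one (norm_pos_iff.2 hc) hq1
  refine ((Finset.range n).biUnion fun k => UnitSeries.expsOfDegree d k).finite_toSet.subset ?_
  intro α hα
  rw [Finset.mem_coe, Finset.mem_biUnion]
  refine ⟨α.degree, Finset.mem_range.2 ?_, UnitSeries.mem_expsOfDegree.2 rfl⟩
  by_contra! hle
  have h1 : ‖c‖ ≤ q ^ α.degree := by
    rw [← show multiPow lam α = c from hα, norm_multiPow, Finsupp.degree_eq_sum,
      ← Finset.prod_pow_eq_pow_sum]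
    exact Finset.prod_le_prod (fun _ _ => by positivity) fun i _ => by gcongr; exact hq i
  exact absurd (h1.trans (pow_le_pow_of_le_one hq0 hq1.le hle)) (not_le.2 hn)

/-- The decomposition of a germ into isotypic polynomials. -/
theorem exists_isotypic_parts (h : ∀ i, ‖lam i‖ < 1 ∧ 0 < ‖lam i‖) (φ : HolGerm d) :
    ∃ p : ℂ → MvPolynomial (Fin d) ℂ, (∀ c, IsLambdaIsotypic lam c (p c)) ∧
      ∀ (k : ℕ) (s₀ : Finset ℂ), ∃ s, s₀ ⊆ s ∧
        φ - ∑ c ∈ s, polyGerm (p c) ∈ maximalIdeal (HolGerm d) ^ k := by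
  classical
  obtain ⟨a, ha⟩ := exists_taylor φ
  have hne : ∀ α, multiPow lam α ≠ 0 := multiPow_ne_zero fun i => norm_pos_iff.1 (h i).2
  have hfin : ∀ c : ℂ, {α : Fin d →₀ ℕ | multiPow lam α = c}.Finite := fun c => by
    by_cases hc : c = 0
    · refine Set.finite_empty.subset fun α hα => hne α ?_
      rw [← hc]
      exact hα
    · exact finite_multiPow_eq (fun i => (h i).1) hc
  refine ⟨fun c => ∑ α ∈ (hfin c).toFinset, MvPolynomial.monomial α (a α), fun c => ?_,
    fun k s₀ => ?_⟩
  · refine IsLambdaIsotypic.sum fun α hα => ?_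
    rw [← show multiPow lam α = c by simpa using hα]
    exact IsLambdaIsotypic.monomial α _
  · let s := s₀ ∪ ((Finset.range k).biUnion fun k => UnitSeries.expsOfDegree d k).image (multiPow lam)
    refine ⟨s, Finset.subset_union_left, ?_⟩
    have h1 : ∑ c ∈ s, polyGerm (∑ α ∈ (hfin c).toFinset, MvPolynomial.monomial α (a α)) =
        polyGerm (∑ α ∈ s.biUnion fun c => (hfin c).toFinset, MvPolynomial.monomial α (a α)) := by
      rw [Finset.sum_biUnion]
      · simp only [← ofPoly_apply, map_sum]
      · intro c _ c' _ hcc'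
        refine Finset.disjoint_left.2 fun α hα hα' => hcc' ?_
        rw [Set.Finite.mem_toFinset] at hα hα'
        exact hα.symm.trans hα'
    rw [h1]
    refine ha k _ fun α hα => ?_
    refine Finset.mem_biUnion.2 ⟨multiPow lam α, ?_, by simp⟩
    refine Finset.mem_union_right _ (Finset.mem_image_of_mem _ (Finset.mem_biUnion.2
      ⟨α.degree, Finset.mem_range.2 hα, UnitSeries.mem_expsOfDegree.2 rfl⟩))

variable {F : BiholGerm d}

/-- Eigenvalues multiply along monomials. The hypothesis covers only variables occurring in P, so
that the lemma can serve in an induction over the coordinates. -/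
theorem polyGerm_mem_maxGenEigenspace_of_support {c : ℂ} {P : MvPolynomial (Fin d) ℂ}
    (hx : ∀ α ∈ P.support, ∀ i, α i ≠ 0 →
      polyGerm (MvPolynomial.X i) ∈ maxGenEigenspace F.pullbackEnd (lam i))
    (hP : IsLambdaIsotypic lam c P) : polyGerm P ∈ maxGenEigenspace F.pullbackEnd c := by
  have hone : (1 : HolGerm d) ∈ maxGenEigenspace F.pullbackEnd 1 :=
    (mem_maxGenEigenspace _ _ _).2 ⟨1, by simp⟩
  have hpow : ∀ i n, (n ≠ 0 →
      polyGerm (MvPolynomial.X i) ∈ maxGenEigenspace F.pullbackEnd (lam i)) →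
      polyGerm (MvPolynomial.X i) ^ n ∈ maxGenEigenspace F.pullbackEnd (lam i ^ n) :=
    fun i n hn => by
      induction n with
      | zero => simpa using hone
      | succ n ih =>
        rw [pow_succ, pow_succ]
        exact mul_mem_maxGenEigenspace F.pullbackAlg (ih fun _ => hn n.succ_ne_zero)
          (hn n.succ_ne_zero)
  have hprod : ∀ α ∈ P.support, ∀ s : Finset (Fin d),
      ∏ i ∈ s, polyGerm (MvPolynomial.X i) ^ α i ∈
        maxGenEigenspace F.pullbackEnd (∏ i ∈ s, lam i ^ α i) := fun α hα s => by
    classical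
    induction s using Finset.induction_on with
    | empty => simpa using hone
    | insert i s hi ih =>
      rw [Finset.prod_insert hi, Finset.prod_insert hi]
      exact mul_mem_maxGenEigenspace F.pullbackAlg (hpow i _ (hx α hα i)) ih
  rw [← ofPoly_apply, P.as_sum, map_sum]
  refine Submodule.sum_mem _ fun α hα => ?_
  rw [← hP α hα, MvPolynomial.monomial_eq, Finsupp.prod_fintype _ _ fun i => pow_zero _,
    MvPolynomial.C_mul', map_smul, map_prod]
  refine Submodule.smul_mem _ _ ?_
  simp only [map_pow, ofPoly_apply]
  exact hprod α hα Finset.univ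

theorem polyGerm_mem_maxGenEigenspace
    (hx : ∀ i, polyGerm (MvPolynomial.X i) ∈ maxGenEigenspace F.pullbackEnd (lam i))
    {c : ℂ} {P : MvPolynomial (Fin d) ℂ} (hP : IsLambdaIsotypic lam c P) :
    polyGerm P ∈ maxGenEigenspace F.pullbackEnd c :=
  polyGerm_mem_maxGenEigenspace_of_support (fun _ _ i _ => hx i) hP

/-- The isotypic parts of an element of an invariant ideal lie in the ideal. -/
theorem isotypic_part_mem
    (hx : ∀ i, polyGerm (MvPolynomial.X i) ∈ maxGenEigenspace F.pullbackEnd (lam i))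
    {I : Ideal (HolGerm d)} (hI : F.LeavesInvariant I) {φ : HolGerm d} (hφ : φ ∈ I)
    {p : ℂ → MvPolynomial (Fin d) ℂ} (hp : ∀ c, IsLambdaIsotypic lam c (p c))
    (hsum : ∀ (k : ℕ) (s₀ : Finset ℂ), ∃ s, s₀ ⊆ s ∧
        φ - ∑ c ∈ s, polyGerm (p c) ∈ maximalIdeal (HolGerm d) ^ k) (c : ℂ) :
    polyGerm (p c) ∈ I := by
  refine mem_of_forall_mem_sup_pow fun k => ?_
  obtain ⟨s, hs, h⟩ := hsum k {c}
  -- M is invariant and contains a finite sum of isotypic parts of φ, hence each of these parts.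
  let M : Ideal (HolGerm d) := I ⊔ maximalIdeal (HolGerm d) ^ k
  have hM : ∀ x ∈ M.restrictScalars ℂ, F.pullbackEnd x ∈ M.restrictScalars ℂ := fun x hx => by
    obtain ⟨y, hy, z, hz, rfl⟩ := Submodule.mem_sup.1 hx
    rw [map_add]
    exact M.add_mem (Ideal.mem_sup_left (hI y hy)) (Ideal.mem_sup_right (F.pullback_mem_pow hz))
  refine mem_of_sum_mem hM s (fun c => polyGerm (p c))
    (fun c _ => polyGerm_mem_maxGenEigenspace hx (hp c)) ?_ c (hs (Finset.mem_singleton_self c))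
  have : ∑ c ∈ s, polyGerm (p c) = φ - (φ - ∑ c ∈ s, polyGerm (p c)) := by abel
  rw [this]
  exact M.sub_mem (Ideal.mem_sup_left hφ) (Ideal.mem_sup_right h)

/-- A generalized eigenvector is an isotypic polynomial. -/
theorem eq_isotypic_part
    (hx : ∀ i, polyGerm (MvPolynomial.X i) ∈ maxGenEigenspace F.pullbackEnd (lam i))
    {c : ℂ} {φ : HolGerm d} (hφ : φ ∈ maxGenEigenspace F.pullbackEnd c)
    {p : ℂ → MvPolynomial (Fin d) ℂ} (hp : ∀ c, IsLambdaIsotypic lam c (p c))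
    (hsum : ∀ (k : ℕ) (s₀ : Finset ℂ), ∃ s, s₀ ⊆ s ∧
        φ - ∑ c ∈ s, polyGerm (p c) ∈ maximalIdeal (HolGerm d) ^ k) :
    φ = polyGerm (p c) := by
  rw [← sub_eq_zero, ← Ideal.mem_bot]
  refine mem_of_forall_mem_sup_pow fun k => Ideal.mem_sup_right ?_
  obtain ⟨s, hs, h⟩ := hsum k {c}
  have hcs := hs (Finset.mem_singleton_self c)
  have hE := fun c => polyGerm_mem_maxGenEigenspace hx (hp c)
  let M : Ideal (HolGerm d) := maximalIdeal (HolGerm d) ^ k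
  -- The eigencomponents of the Taylor remainder: φ itself has only a component at c. As the sum
  -- lies in 𝔪^k, so does φ - p(c).
  let v : ℂ → HolGerm d := fun c' => (if c' = c then φ else 0) - polyGerm (p c')
  have hv : ∀ c' ∈ s, v c' ∈ maxGenEigenspace F.pullbackEnd c' := fun c' _ => by
    simp only [v]
    split_ifs with e
    · subst e
      exact sub_mem hφ (hE _)
    · exact sub_mem (zero_mem _) (hE _)
  have hM : ∀ x ∈ M.restrictScalars ℂ, F.pullbackEnd x ∈ M.restrictScalars ℂ :=
    fun x hx => F.pullback_mem_pow hx
  have := mem_of_sum_mem hM s v hv ?_ c hcs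
  · simpa [v] using this
  · simp only [v, Finset.sum_sub_distrib, Finset.sum_ite_eq', hcs, if_true]
    exact h

/-- An element of I is, modulo every 𝔪^k, a finite sum of its isotypic parts; these lie in I, and
the ideal they span is closed. -/
theorem eq_span_isotypic (h : ∀ i, ‖lam i‖ < 1 ∧ 0 < ‖lam i‖)
    (hx : ∀ i, polyGerm (MvPolynomial.X i) ∈ maxGenEigenspace F.pullbackEnd (lam i))
    {I : Ideal (HolGerm d)} (hI : F.LeavesInvariant I) :
    Ideal.span (polyGerm '' {P | (∃ c, IsLambdaIsotypic lam c P) ∧ polyGerm P ∈ I}) = I := by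
  refine le_antisymm (Ideal.span_le.2 ?_) fun φ hφ => ?_
  · rintro _ ⟨P, ⟨-, hP⟩, rfl⟩
    exact hP
  · obtain ⟨p, hp, hsum⟩ := exists_isotypic_parts h φ
    refine mem_of_forall_mem_sup_pow fun k => ?_
    obtain ⟨s, -, hs⟩ := hsum k ∅
    rw [← add_sub_cancel (∑ c ∈ s, polyGerm (p c)) φ]
    refine add_mem (Ideal.mem_sup_left (Ideal.sum_mem _ fun c _ => Ideal.subset_span ?_))
      (Ideal.mem_sup_right hs)
    exact ⟨p c, ⟨⟨c, hp c⟩, isotypic_part_mem hx hI hφ hp hsum c⟩, rfl⟩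

end Isotypic

end

/-! ### Normal forms, invariant flags of generators and weights. -/

section

open HolGerm IsLocalRing Module.End

section NormalForm

variable {d : ℕ} {lam : Fin d → ℂ}

theorem norm_multiPow_lt_of_two_le (h : ∀ i, ‖lam i‖ < 1 ∧ 0 < ‖lam i‖) {α : Fin d →₀ ℕ}
    (hα : 2 ≤ α.degree) {j : Fin d} (hj : α j ≠ 0) : ‖multiPow lam α‖ < ‖lam j‖ := by
  have hle : Finsupp.single j 1 ≤ α := by
    rw [Finsupp.single_le_iff]
    omega
  obtain ⟨β, rfl⟩ := exists_add_of_le hle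
  rw [multiPow_add, norm_mul, multiPow_single, pow_one]
  have hβ : β ≠ 0 := by
    rintro rfl
    simp at hα
  obtain ⟨i, hi⟩ := Finsupp.ne_iff.1 hβ
  refine mul_lt_of_lt_one_right (h j).2 ?_
  rw [norm_multiPow, ← Finset.mul_prod_erase _ _ (Finset.mem_univ i)]
  refine mul_lt_one_of_nonneg_of_lt_one_left (by positivity)
    (pow_lt_one₀ (norm_nonneg _) (h i).1 hi) ?_
  exact Finset.prod_le_one (fun _ _ => by positivity)
    fun k _ => pow_le_one₀ (norm_nonneg _) (h k).1.le

variable {G : BiholGerm d}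

theorem pullback_X_eq_of_eventually {i : Fin d} {c : ℂ} {N : MvPolynomial (Fin d) ℂ}
    (h : ∀ᶠ x in 𝓝 (0 : Fin d → ℂ), G x i = MvPolynomial.eval x (c • MvPolynomial.X i + N)) :
    G.pullback (polyGerm (MvPolynomial.X i)) = c • polyGerm (MvPolynomial.X i) + polyGerm N := by
  rw [← ofPoly_apply, ← ofPoly_apply, ← map_smul, ← map_add, ofPoly_apply, ofPoly_apply]
  refine ext_of_eventually (fun x => MvPolynomial.eval (G x) (MvPolynomial.X i))
    (fun x => MvPolynomial.eval x (c • MvPolynomial.X i + N)) rfl rfl (h.mono fun x hx => ?_)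
  rw [MvPolynomial.eval_X, hx]

/-- Triangularity: if x_j divides a resonant monomial x^α of degree at least 2, then |λ_i| = |λ^α| <
|λ_j|, so j < i by the ordering of the spectrum. The remaining linear terms involve x_{i-1} only. -/
theorem IsPoincareDulac.exists_polynomials (hG : IsPoincareDulac G lam) :
    ∃ N : Fin d → MvPolynomial (Fin d) ℂ,
      (∀ i, IsLambdaIsotypic lam (lam i) (N i)) ∧
      (∀ i, ∀ α ∈ (N i).support, ∀ j, α j ≠ 0 → j < i) ∧
      ∀ i, G.pullback (polyGerm (MvPolynomial.X i)) =
        lam i • polyGerm (MvPolynomial.X i) + polyGerm (N i) := by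
  classical
  obtain ⟨hJ, hdiag, hord, N, hN, heq⟩ := hG
  set A := LinearMap.toMatrix' (fderiv ℂ G 0).toLinearMap with hA
  let L : Fin d → MvPolynomial (Fin d) ℂ := fun i =>
    ∑ j ∈ Finset.univ.erase i, MvPolynomial.monomial (Finsupp.single j 1) (A i j)
  have hL : ∀ i, ∀ α ∈ (L i).support, ∃ j : Fin d, (j : ℕ) + 1 = i ∧ lam j = lam i ∧
      α = Finsupp.single j 1 := fun i α hα => by
    obtain ⟨j, hj, hαj⟩ := Finset.mem_biUnion.1 (MvPolynomial.support_sum hα)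
    have hne : A i j ≠ 0 := by
      intro h0
      simp [h0] at hαj
    obtain ⟨h1, -, h2⟩ := hJ i j (Finset.ne_of_mem_erase hj).symm hne
    rw [hdiag, hdiag] at h2
    exact ⟨j, h1, h2.symm, Finset.mem_singleton.1 (MvPolynomial.support_monomial_subset hαj)⟩
  refine ⟨fun i => L i + N i, fun i => ?_, fun i α hα j hj => ?_, fun i => ?_⟩
  · refine IsLambdaIsotypic.add (fun α hα => ?_) fun α hα => (hN i α hα).2
    obtain ⟨j, -, h, rfl⟩ := hL i α hα
    simpa using h
  · have hsingle : ∀ k : Fin d, (k : ℕ) + 1 = i → α = Finsupp.single k 1 → j < i := by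
      rintro k hk rfl
      have : j = k := by
        by_contra hjk
        exact hj (Finsupp.single_eq_of_ne hjk)
      subst this
      exact Fin.lt_def.2 (by omega)
    rcases Finset.mem_union.1 (MvPolynomial.support_add hα) with hα | hα
    · obtain ⟨k, hk, -, rfl⟩ := hL i α hα
      exact hsingle k hk rfl
    · obtain ⟨h2 | ⟨k, hk, rfl⟩, hres⟩ := hN i α hα
      · by_contra! hij
        rw [← Finsupp.degree_eq_sum] at h2
        have := norm_multiPow_lt_of_two_le hord.1 h2 hj
        rw [hres] at this
        exact absurd (hord.2 i j hij) (not_le.2 this)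
      · exact hsingle k hk rfl
  · refine pullback_X_eq_of_eventually ?_
    filter_upwards [heq] with x hx
    have h1 : fderiv ℂ G 0 x i = ∑ j, A i j * x j := by
      have h2 : A.mulVec x = fderiv ℂ G 0 x := LinearMap.toMatrix'_mulVec _ _
      rw [← h2]
      rfl
    rw [← sub_add_cancel (G x i) (fderiv ℂ G 0 x i), hx i, h1,
      ← Finset.add_sum_erase _ _ (Finset.mem_univ i), hdiag]
    simp only [map_add, L, MvPolynomial.smul_eval, MvPolynomial.eval_X, map_sum,
      eval_monomial_eq_multiPow, multiPow_single, pow_one]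
    ring

/-- By induction on i: G^* - λ_i sends x_i to N_i, an isotypic polynomial in earlier coordinates and
so already a generalized eigenvector for λ_i. -/
theorem IsPoincareDulac.X_mem_maxGenEigenspace (hG : IsPoincareDulac G lam) (i : Fin d) :
    polyGerm (MvPolynomial.X i) ∈ maxGenEigenspace G.pullbackEnd (lam i) := by
  classical
  obtain ⟨N, hN, hlt, hX⟩ := hG.exists_polynomials
  induction i using WellFoundedLT.induction with
  | _ i ih =>
    have h := polyGerm_mem_maxGenEigenspace_of_support (F := G)
      (fun α hα j hj => ih j (hlt i α hα j hj)) (hN i)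
    obtain ⟨k, hk⟩ := (mem_maxGenEigenspace _ _ _).1 h
    refine (mem_maxGenEigenspace _ _ _).2 ⟨k + 1, ?_⟩
    rw [pow_succ, Module.End.mul_apply, ← hk]
    congr 1
    change G.pullback _ - lam i • polyGerm (MvPolynomial.X i) = _
    rw [hX, add_sub_cancel_left]

/-- G^* substitutes for each x_i a polynomial isotypic for λ_i, which preserves the type c. -/
theorem IsPoincareDulac.exists_pullback_eq (hG : IsPoincareDulac G lam) {c : ℂ}
    {P : MvPolynomial (Fin d) ℂ} (hP : IsLambdaIsotypic lam c P) :
    ∃ Q, IsLambdaIsotypic lam c Q ∧ G.pullback (polyGerm P) = polyGerm Q := by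
  obtain ⟨N, hN, -, hX⟩ := hG.exists_polynomials
  let Q : Fin d → MvPolynomial (Fin d) ℂ := fun i => lam i • MvPolynomial.X i + N i
  have hQ : ∀ i, IsLambdaIsotypic lam (lam i) (Q i) := fun i => by
    refine IsLambdaIsotypic.add ?_ (hN i)
    have := (IsLambdaIsotypic.monomial (lam := lam) (Finsupp.single i 1) 1).smul (lam i)
    rwa [multiPow_single, pow_one] at this
  refine ⟨MvPolynomial.aeval Q P, hP.aeval hQ, ?_⟩
  have : G.pullbackAlg.comp ofPoly = ofPoly.comp (MvPolynomial.aeval Q) := by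
    refine MvPolynomial.algHom_ext fun i => ?_
    simp only [AlgHom.comp_apply, MvPolynomial.aeval_X, Q, map_add, map_smul]
    exact hX i
  exact DFunLike.congr_fun this P

/-- Ideals generated by finitely many isotypic polynomials, all of whose initial segments generate
invariant ideals. -/
def IsFlagGenerated (G : BiholGerm d) (lam : Fin d → ℂ) (K : Ideal (HolGerm d)) : Prop :=
  ∃ (r : ℕ) (P : Fin r → MvPolynomial (Fin d) ℂ),
    (∀ i, ∃ c, IsLambdaIsotypic lam c (P i)) ∧
    K = Ideal.span (Set.range fun i => polyGerm (P i)) ∧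
    ∀ i : Fin r, G.LeavesInvariant (Ideal.span ((fun j => polyGerm (P j)) '' {j | j ≤ i}))

theorem IsFlagGenerated.bot : IsFlagGenerated G lam ⊥ :=
  ⟨0, fun i => i.elim0, fun i => i.elim0, by simp, fun i => i.elim0⟩

theorem IsFlagGenerated.leavesInvariant {K : Ideal (HolGerm d)} (hK : IsFlagGenerated G lam K) :
    G.LeavesInvariant K := by
  obtain ⟨r, P, -, rfl, h⟩ := hK
  rcases r with _ | r
  · intro φ hφ
    have : φ = 0 := by simpa using hφ
    simp [this]
  · convert h (Fin.last r) using 2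
    rw [← Set.image_univ]
    congr 1
    ext j
    simp [Fin.le_last]

theorem IsFlagGenerated.sup_span_singleton {K : Ideal (HolGerm d)} (hK : IsFlagGenerated G lam K)
    {c : ℂ} {Q : MvPolynomial (Fin d) ℂ} (hQ : IsLambdaIsotypic lam c Q)
    (h : G.pullback (polyGerm Q) ∈ K ⊔ Ideal.span {polyGerm Q}) :
    IsFlagGenerated G lam (K ⊔ Ideal.span {polyGerm Q}) := by
  have hKinv := hK.leavesInvariant
  obtain ⟨r, P, hP, rfl, hinv⟩ := hK
  have hrange : (Set.range fun i => polyGerm ((Fin.snoc P Q : Fin (r + 1) → _) i)) =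
      (Set.range fun i => polyGerm (P i)) ∪ {polyGerm Q} := by
    ext x
    constructor
    · rintro ⟨i, rfl⟩
      induction i using Fin.lastCases with
      | last => simp
      | cast i => exact Or.inl ⟨i, by simp⟩
    · rintro (⟨i, rfl⟩ | rfl)
      · exact ⟨i.castSucc, by simp⟩
      · exact ⟨Fin.last r, by simp⟩
  have hspan : Ideal.span (Set.range fun i => polyGerm (P i)) ⊔ Ideal.span {polyGerm Q} =
      Ideal.span (Set.range fun i => polyGerm ((Fin.snoc P Q : Fin (r + 1) → _) i)) := by
    rw [hrange, Ideal.span_union]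
  refine ⟨r + 1, Fin.snoc P Q, fun i => ?_, hspan, fun i => ?_⟩
  · induction i using Fin.lastCases with
    | last => exact ⟨c, by simpa using hQ⟩
    | cast i => simpa using hP i
  · induction i using Fin.lastCases with
    | last =>
      have : (fun j => polyGerm ((Fin.snoc P Q : Fin (r + 1) → _) j)) '' {j | j ≤ Fin.last r} =
          Set.range fun i => polyGerm ((Fin.snoc P Q : Fin (r + 1) → _) i) := by
        rw [← Set.image_univ]
        congr 1
        ext j
        simp [Fin.le_last]
      rw [this, ← hspan]
      intro φ hφ
      obtain ⟨y, hy, z, hz, rfl⟩ := Submodule.mem_sup.1 hφ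
      obtain ⟨u, rfl⟩ := Ideal.mem_span_singleton'.1 hz
      rw [map_add, map_mul]
      exact add_mem (Ideal.mem_sup_left (hKinv y hy)) (Ideal.mul_mem_left _ _ h)
    | cast i =>
      convert hinv i using 2
      ext x
      constructor
      · rintro ⟨j, hj, rfl⟩
        induction j using Fin.lastCases with
        | last => exact absurd (Fin.castSucc_lt_last i) (not_lt.2 hj)
        | cast j => exact ⟨j, by simpa using hj, by simp⟩
      · rintro ⟨j, hj, rfl⟩
        exact ⟨j.castSucc, by simpa using hj, by simp⟩

/-- Induction on the nilpotency order of G^* - c on P: the isotypic polynomial (G^* - c)P ∈ I is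
inserted first; then G^*P = (G^* - c)P + cP lies in the ideal enlarged by P, so P may be appended.
-/
theorem IsFlagGenerated.exists_insert (hG : IsPoincareDulac G lam) {I : Ideal (HolGerm d)}
    (hI : G.LeavesInvariant I) {c : ℂ} (n : ℕ) {P : MvPolynomial (Fin d) ℂ}
    (hP : IsLambdaIsotypic lam c P) (hPI : polyGerm P ∈ I)
    (hn : ((G.pullbackEnd - c • (1 : Module.End ℂ (HolGerm d))) ^ n) (polyGerm P) = 0)
    {K : Ideal (HolGerm d)} (hK : IsFlagGenerated G lam K) (hKI : K ≤ I) :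
    ∃ K', IsFlagGenerated G lam K' ∧ K ≤ K' ∧ K' ≤ I ∧ polyGerm P ∈ K' := by
  induction n generalizing P with
  | zero =>
    have h0 : polyGerm P = 0 := by simpa using hn
    exact ⟨K, hK, le_rfl, hKI, h0 ▸ zero_mem _⟩
  | succ n ih =>
    obtain ⟨Q, hQ, hPQ⟩ := hG.exists_pullback_eq hP
    have hsub : polyGerm (Q + (-c) • P) = G.pullback (polyGerm P) - c • polyGerm P := by
      rw [hPQ, ← ofPoly_apply, ← ofPoly_apply, ← ofPoly_apply, map_add, map_smul, neg_smul,
        sub_eq_add_neg]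
    have hcP : c • polyGerm P ∈ I := by
      rw [Algebra.smul_def]
      exact I.mul_mem_left _ hPI
    obtain ⟨K', hK', hKK', hK'I, hmem⟩ := ih (P := Q + (-c) • P) (hQ.add (hP.smul _))
      (by rw [hsub]; exact I.sub_mem (hI _ hPI) hcP)
      (by rw [pow_succ, Module.End.mul_apply] at hn; rw [hsub]; exact hn)
    refine ⟨K' ⊔ Ideal.span {polyGerm P}, hK'.sup_span_singleton hP ?_, hKK'.trans le_sup_left,
      sup_le hK'I ((Ideal.span_singleton_le_iff_mem _).2 hPI),
      Ideal.mem_sup_right (Ideal.mem_span_singleton_self _)⟩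
    rw [← sub_add_cancel (G.pullback (polyGerm P)) (c • polyGerm P), ← hsub]
    refine add_mem (Ideal.mem_sup_left hmem) (Ideal.mem_sup_right ?_)
    rw [Algebra.smul_def]
    exact Ideal.mul_mem_left _ _ (Ideal.mem_span_singleton_self _)

/-- Noetherianity selects finitely many isotypic generators of I, which are inserted one after
another starting from the zero ideal. -/
theorem IsPoincareDulac.isFlagGenerated (hG : IsPoincareDulac G lam) {I : Ideal (HolGerm d)}
    (hI : G.LeavesInvariant I) : IsFlagGenerated G lam I := by
  classical
  have hspan := eq_span_isotypic hG.2.2.1.1 hG.X_mem_maxGenEigenspace hI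
  have hfg : (Submodule.span (HolGerm d)
      (polyGerm '' {P | (∃ c, IsLambdaIsotypic lam c P) ∧ polyGerm P ∈ I})).FG :=
    IsNoetherian.noetherian _
  obtain ⟨t, ht, hspant⟩ := (Submodule.fg_span_iff_fg_span_finset_subset _).1 hfg
  have key : ∀ u : Finset (HolGerm d), u ⊆ t → ∃ K, IsFlagGenerated G lam K ∧ K ≤ I ∧
      ∀ x ∈ u, x ∈ K := fun u => by
    induction u using Finset.induction_on with
    | empty => exact fun _ => ⟨⊥, IsFlagGenerated.bot, bot_le, by simp⟩
    | insert x u hx ih =>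
      intro hu
      obtain ⟨K, hK, hKI, hmem⟩ := ih ((Finset.subset_insert _ _).trans hu)
      obtain ⟨P, ⟨⟨c, hP⟩, hPI⟩, rfl⟩ := ht (hu (Finset.mem_insert_self _ _))
      obtain ⟨n, hn⟩ := (mem_maxGenEigenspace _ _ _).1
        (polyGerm_mem_maxGenEigenspace hG.X_mem_maxGenEigenspace hP)
      obtain ⟨K', hK', hKK', hK'I, hPK'⟩ := hK.exists_insert hG hI n hP hPI hn hKI
      refine ⟨K', hK', hK'I, fun y hy => ?_⟩
      rcases Finset.mem_insert.1 hy with rfl | hy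
      · exact hPK'
      · exact hKK' (hmem y hy)
  obtain ⟨K, hK, hKI, hmem⟩ := key t subset_rfl
  have : I ≤ K := by
    rw [← hspan, Ideal.span, hspant]
    exact Submodule.span_le.2 hmem
  rwa [← le_antisymm hKI this]

/-- Taking log |·| turns λ^α = λ^γ into equality of the degrees of α and γ for the positive real
weights -log|λ_i|; these are then replaced by integers. -/
theorem exists_weights (hlam : ∀ i, ‖lam i‖ < 1 ∧ 0 < ‖lam i‖) : ∃ w : Fin d → ℕ, (∀ k, 0 < w k) ∧
    ∀ c (P : MvPolynomial (Fin d) ℂ), IsLambdaIsotypic lam c P →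
      ∃ n, MvPolynomial.IsWeightedHomogeneous w P n := by
  obtain ⟨w, hw, h⟩ := exists_nat_weights (fun i => -Real.log ‖lam i‖)
    fun i => neg_pos.2 (Real.log_neg (hlam i).2 (hlam i).1)
  have hlog : ∀ α : Fin d →₀ ℕ, Real.log ‖multiPow lam α‖ = ∑ i, α i * Real.log ‖lam i‖ :=
    fun α => by
      rw [norm_multiPow, Real.log_prod fun i _ => pow_ne_zero _ (hlam i).2.ne']
      exact Finset.sum_congr rfl fun i _ => by rw [Real.log_pow]
  have hweight : ∀ α : Fin d →₀ ℕ, Finsupp.weight w α = ∑ i, α i * w i := fun α => by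
    rw [Finsupp.weight_apply, Finsupp.sum_fintype _ _ fun i => by simp]
    simp
  refine ⟨w, hw, fun c P hP => ?_⟩
  by_cases hex : ∃ γ, γ ∈ P.support
  · obtain ⟨γ, hγ⟩ := hex
    refine ⟨Finsupp.weight w γ, fun α hα => ?_⟩
    rw [hweight, hweight]
    refine h α γ ?_
    simp only [mul_neg, Finset.sum_neg_distrib, ← hlog]
    rw [hP α (MvPolynomial.mem_support_iff.2 hα), hP γ hγ]
  · exact ⟨0, fun α hα => absurd ⟨α, MvPolynomial.mem_support_iff.2 hα⟩ hex⟩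

/-- Φ^* intertwines G^* and F^*, so the preimage of I under Φ^* is G-invariant; its flag of
generators is transported back, Φ^* being surjective. -/
theorem exists_generators_of_isPoincareDulacCoord {F Φ : BiholGerm d} {I : Ideal (HolGerm d)}
    (hI : F.LeavesInvariant I) (h : IsPoincareDulacCoord F Φ lam) :
    ∃ w : Fin d → ℕ, (∀ k, 0 < w k) ∧
      ∃ (r : ℕ) (P : Fin r → MvPolynomial (Fin d) ℂ),
        (∀ i, IsLambdaHomogeneous lam (P i) ∧
          ∃ n : ℕ, MvPolynomial.IsWeightedHomogeneous w (P i) n) ∧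
        I = Ideal.span (Set.range fun i => Φ.pullback (polyGerm (P i))) ∧
        ∀ i : Fin r, F.LeavesInvariant
          (Ideal.span ((fun j => Φ.pullback (polyGerm (P j))) '' {j | j ≤ i})) := by
  obtain ⟨G, hconj, hG⟩ := h
  have hpull := BiholGerm.pullback_pullback_of_semiconj hconj
  obtain ⟨w, hw, hweight⟩ := exists_weights hG.2.2.1.1
  have hI' : G.LeavesInvariant (I.comap Φ.pullback) := fun φ hφ => by
    rw [Ideal.mem_comap, hpull]
    exact hI _ hφ
  obtain ⟨r, P, hP, hspan, hinv⟩ := hG.isFlagGenerated hI'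
  refine ⟨w, hw, r, P, fun i => ?_, ?_, fun i => ?_⟩
  · obtain ⟨c, hc⟩ := hP i
    exact ⟨hc.isLambdaHomogeneous, hweight c _ hc⟩
  · rw [← Ideal.map_comap_of_surjective Φ.pullback Φ.pullback_surjective I, hspan, Ideal.map_span,
      ← Set.range_comp]
    rfl
  · refine BiholGerm.leavesInvariant_span ?_
    rintro _ ⟨j, hj, rfl⟩
    have h1 := Ideal.mem_map_of_mem Φ.pullback
      (hinv i (polyGerm (P j)) (Ideal.subset_span ⟨j, hj, rfl⟩))
    rw [Ideal.map_span, ← Set.image_comp, hpull] at h1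
    exact h1

end NormalForm

end

/-! ### The linear part of a contracting germ and the differential of a function germ. -/

section

open HolGerm IsLocalRing Module.End

namespace BiholGerm

variable {d : ℕ}

theorem differentiableAt (F : BiholGerm d) : DifferentiableAt ℂ F 0 :=
  F.analyticAt_toFun.differentiableAt

/-- The powers of the linear part of a contracting germ tend to zero. -/
theorem IsContracting.tendsto_norm_pow {F : BiholGerm d} (hF : F.IsContracting) :
    Tendsto (fun n : ℕ => ‖fderiv ℂ F 0 ^ n‖) atTop (𝓝 0) := by
  obtain ⟨W, hW, hWo, hW0⟩ := eventually_nhds_iff.1 F.analyticAt_toFun.eventually_analyticAt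
  obtain ⟨U, hUo, hU0, hUW, hK, hKU, -⟩ := hF (W ∩ Metric.ball 0 1)
    (hWo.inter Metric.isOpen_ball) ⟨hW0, Metric.mem_ball_self one_pos⟩
  have hU1 : ∀ x ∈ U, ‖x‖ ≤ 1 := fun x hx => (mem_ball_zero_iff.1 (hUW hx).2).le
  -- Relative compactness leaves a margin δ: as U lies in the unit ball, (1 + t)F with t = δ/2 still
  -- maps U into itself.
  obtain ⟨δ, hδ, hthick⟩ := hK.exists_thickening_subset_open hUo hKU
  set t : ℝ := δ / 2 with ht
  have ht0 : 0 < t := by positivity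
  set Ft : (Fin d → ℂ) → (Fin d → ℂ) := fun x => ((1 + t : ℝ) : ℂ) • F x with hFt
  have hmaps : Set.MapsTo Ft U U := fun x hx => by
    have hxK : F x ∈ closure (F '' U) := subset_closure ⟨x, hx, rfl⟩
    refine hthick (Metric.mem_thickening_iff.2 ⟨F x, hxK, ?_⟩)
    rw [dist_eq_norm, hFt]
    have : ((1 + t : ℝ) : ℂ) • F x - F x = (t : ℂ) • F x := by
      push_cast
      rw [add_smul, one_smul, add_sub_cancel_left]
    simp only [this, norm_smul, Complex.norm_real, Real.norm_of_nonneg ht0.le]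
    have h1 := hU1 _ (hKU hxK)
    nlinarith
  have hdiff : DifferentiableOn ℂ Ft U := fun x hx =>
    ((hW x (hUW hx).1).differentiableAt.fun_const_smul _).differentiableWithinAt
  have hder : HasFDerivAt Ft (((1 + t : ℝ) : ℂ) • fderiv ℂ F 0) 0 :=
    F.differentiableAt.hasFDerivAt.fun_const_smul _
  have hFt0 : Ft 0 = 0 := by simp [hFt, F.map_zero]
  obtain ⟨r, hr, hball⟩ := Metric.nhds_basis_closedBall.mem_iff.1 (hUo.mem_nhds hU0)
  -- Cauchy's estimate on complex lines through 0: the iterates of (1 + t)F are bounded by 1 on a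
  -- ball of radius r. Dividing by (1 + t)^n then gives the geometric decay of D₀F^n.
  have hbound : ∀ n : ℕ, ‖(((1 + t : ℝ) : ℂ) • fderiv ℂ F 0) ^ n‖ ≤ 1 / r := fun n => by
    refine ContinuousLinearMap.opNorm_le_bound _ (by positivity) fun v => ?_
    by_cases hv : v = 0
    · rw [hv, ContinuousLinearMap.map_zero, norm_zero, mul_zero]
    have hv0 : 0 < ‖v‖ := norm_pos_iff.2 hv
    have hR : 0 < r / ‖v‖ := by positivity
    have hmem : ∀ z ∈ Metric.closedBall (0 : ℂ) (r / ‖v‖), z • v ∈ U := fun z hz => by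
      refine hball (mem_closedBall_zero_iff.2 ?_)
      rw [norm_smul]
      exact (le_div_iff₀ hv0).1 (mem_closedBall_zero_iff.1 hz)
    have hg : DifferentiableOn ℂ (fun z : ℂ => Ft^[n] (z • v))
        (Metric.closedBall (0 : ℂ) (r / ‖v‖)) := by
      refine (hdiff.iterate hmaps n).comp ?_ hmem
      exact (differentiable_id.smul_const v).differentiableOn
    have hline : HasDerivAt (fun z : ℂ => z • v) v 0 := by
      simpa using (hasDerivAt_id (0 : ℂ)).smul_const v
    have hit := hder.iterate hFt0 n
    have hit : HasFDerivAt Ft^[n] ((((1 + t : ℝ) : ℂ) • fderiv ℂ F 0) ^ n) ((0 : ℂ) • v) := by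
      rwa [zero_smul]
    have hderiv : HasDerivAt (fun z : ℂ => Ft^[n] (z • v))
        (((((1 + t : ℝ) : ℂ) • fderiv ℂ F 0) ^ n) v) 0 := hit.comp_hasDerivAt 0 hline
    rw [← hderiv.deriv]
    refine (Complex.norm_deriv_le_of_forall_mem_sphere_norm_le hR
      (hg.diffContOnCl_ball subset_rfl) (C := 1) fun z hz => ?_).trans (le_of_eq ?_)
    · exact hU1 _ ((hmaps.iterate n) (hmem z (Metric.sphere_subset_closedBall hz)))
    · field_simp
  have h1t : 0 < 1 + t := by linarith
  refine squeeze_zero (fun n => norm_nonneg _) (g := fun n => 1 / r * (1 / (1 + t)) ^ n)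
    (fun n => ?_) ?_
  · have := hbound n
    have hpow : (((1 + t : ℝ) : ℂ) • fderiv ℂ F 0) ^ n =
        (((1 + t : ℝ) : ℂ) ^ n) • (fderiv ℂ F 0 ^ n) := by
      refine ContinuousLinearMap.ext fun v => ?_
      change _ = (((1 + t : ℝ) : ℂ) ^ n) • (fderiv ℂ F 0 ^ n) v
      induction n generalizing v with
      | zero => simp
      | succ n ih =>
        rw [pow_succ, mul_apply_eq_comp, ih (hbound n)]
        change _ • (fderiv ℂ F 0 ^ n) (((1 + t : ℝ) : ℂ) • fderiv ℂ F 0 v) = _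
        rw [ContinuousLinearMap.map_smul, smul_smul, pow_succ (fderiv ℂ F 0), mul_apply_eq_comp,
          pow_succ]
    rw [hpow, norm_smul, norm_pow, Complex.norm_real, Real.norm_of_nonneg h1t.le] at this
    rw [div_pow, one_pow, mul_one_div, le_div_iff₀ (by positivity), mul_comm]
    exact this
  · have hlt : 1 / (1 + t) < 1 := (div_lt_one h1t).2 (by linarith)
    simpa using (tendsto_pow_atTop_nhds_zero_of_lt_one (by positivity) hlt).const_mul (1 / r)

end BiholGerm

namespace HolGerm

variable {d : ℕ}

/-- The differential of a germ at the origin. -/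
def diff : HolGerm d →ₗ[ℂ] Module.Dual ℂ (Fin d → ℂ) :=
  have key : ∀ {f : (Fin d → ℂ) → ℂ} (hf : AnalyticAt ℂ f 0),
      fderiv ℂ (exists_mk (mk f hf)).choose 0 = fderiv ℂ f 0 := fun {f} hf => by
    obtain ⟨hg, h⟩ := (exists_mk (mk f hf)).choose_spec
    exact EventuallyEq.fderiv_eq (mk_eq_mk.1 h)
  { toFun := fun φ => (fderiv ℂ (exists_mk φ).choose 0).toLinearMap
    map_add' := fun φ ψ => by
      obtain ⟨f, hf, rfl⟩ := exists_mk φ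
      obtain ⟨g, hg, rfl⟩ := exists_mk ψ
      rw [mk_add, key, key, key, fderiv_add hf.differentiableAt hg.differentiableAt]
      rfl
    map_smul' := fun c φ => by
      obtain ⟨f, hf, rfl⟩ := exists_mk φ
      rw [smul_mk, key, key, RingHom.id_apply, fderiv_const_mul hf.differentiableAt c]
      rfl }

theorem diff_mk {f : (Fin d → ℂ) → ℂ} (hf : AnalyticAt ℂ f 0) :
    diff (mk f hf) = (fderiv ℂ f 0).toLinearMap := by
  obtain ⟨hg, h⟩ := (exists_mk (mk f hf)).choose_spec
  exact congrArg ContinuousLinearMap.toLinearMap (EventuallyEq.fderiv_eq (mk_eq_mk.1 h))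

theorem diff_mul (φ ψ : HolGerm d) :
    diff (φ * ψ) = value φ • diff ψ + value ψ • diff φ := by
  obtain ⟨f, hf, rfl⟩ := exists_mk φ
  obtain ⟨g, hg, rfl⟩ := exists_mk ψ
  rw [mk_mul, diff_mk, diff_mk, diff_mk, fderiv_mul hf.differentiableAt hg.differentiableAt]
  rfl

theorem diff_X (i : Fin d) : diff (polyGerm (MvPolynomial.X i)) = LinearMap.proj i := by
  rw [polyGerm_eq_mk, diff_mk]
  have : (fun x : Fin d → ℂ => MvPolynomial.eval x (MvPolynomial.X i)) = fun x => x i :=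
    funext fun x => MvPolynomial.eval_X i
  have h : fderiv ℂ (fun x : Fin d → ℂ => x i) 0 = ContinuousLinearMap.proj i :=
    (ContinuousLinearMap.proj (R := ℂ) (φ := fun _ : Fin d => ℂ) i).fderiv
  rw [this, h]
  rfl

theorem diff_pullback (F : BiholGerm d) (φ : HolGerm d) :
    diff (F.pullback φ) = (diff φ).comp (fderiv ℂ F 0).toLinearMap := by
  obtain ⟨f, hf, rfl⟩ := exists_mk φ
  rw [BiholGerm.pullback_mk, diff_mk, diff_mk]
  have hf' : DifferentiableAt ℂ f (F 0) := by
    rw [F.map_zero]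
    exact hf.differentiableAt
  rw [fderiv_comp 0 hf' F.differentiableAt, F.map_zero]
  rfl

theorem diff_eq_zero_of_mem_sq {φ : HolGerm d} (h : φ ∈ maximalIdeal (HolGerm d) ^ 2) :
    diff φ = 0 := by
  rw [pow_two] at h
  refine Submodule.mul_induction_on h (fun x hx y hy => ?_) fun x y hx hy => ?_
  · rw [diff_mul, mem_maximalIdeal_iff.1 hx, mem_maximalIdeal_iff.1 hy, zero_smul, zero_smul,
      add_zero]
  · rw [map_add, hx, hy, add_zero]

theorem diff_one : diff (1 : HolGerm d) = 0 := by
  have := diff_mul (1 : HolGerm d) 1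
  simpa using this

theorem value_X (i : Fin d) : value (polyGerm (MvPolynomial.X i)) = 0 := by
  rw [polyGerm_eq_mk, value_mk]
  simp

/-- The coefficients of the first-order Taylor polynomial are identified by applying `value` and
`diff`, which both vanish on 𝔪². -/
theorem sub_linear_part_mem_sq (φ : HolGerm d) :
    φ - value φ • 1 - ∑ i, diff φ (Pi.single i 1) • polyGerm (MvPolynomial.X i) ∈
      maximalIdeal (HolGerm d) ^ 2 := by
  classical
  obtain ⟨a, ha⟩ := exists_taylor φ
  have hinj : Function.Injective fun i : Fin d => Finsupp.single i 1 :=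
    Finsupp.single_left_injective one_ne_zero
  have h0 : (0 : Fin d →₀ ℕ) ∉ Finset.univ.image fun i : Fin d => Finsupp.single i 1 := by
    simp
  have h := ha 2 (insert 0 (Finset.univ.image fun i : Fin d => Finsupp.single i 1)) fun α hα => by
    by_cases hα0 : α = 0
    · simp [hα0]
    · obtain ⟨i, hi⟩ := Finsupp.ne_iff.1 hα0
      have hle : Finsupp.single i 1 ≤ α := by
        rw [Finsupp.single_le_iff]
        have : α i ≠ 0 := hi
        omega
      obtain ⟨β, rfl⟩ := exists_add_of_le hle
      have : β = 0 := by
        rw [← Finsupp.degree_eq_zero_iff]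
        simp only [map_add, Finsupp.degree_single] at hα
        omega
      simp [this]
  rw [Finset.sum_insert h0, Finset.sum_image fun _ _ _ _ e => hinj e] at h
  have hlin : polyGerm (MvPolynomial.monomial 0 (a 0) +
      ∑ i : Fin d, MvPolynomial.monomial (Finsupp.single i 1) (a (Finsupp.single i 1))) =
      a 0 • 1 + ∑ i : Fin d, a (Finsupp.single i 1) • polyGerm (MvPolynomial.X i) := by
    simp only [← ofPoly_apply, map_add, map_sum, MvPolynomial.X, ← map_smul,
      smul_eq_mul, mul_one]
    rw [← map_one ofPoly, ← map_smul, ← MvPolynomial.C_1, MvPolynomial.C_apply,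
      MvPolynomial.smul_monomial, smul_eq_mul, mul_one]
  rw [hlin] at h
  have hv := mem_maximalIdeal_iff.1 (Ideal.pow_le_self two_ne_zero h)
  have hd := diff_eq_zero_of_mem_sq h
  simp only [map_sub, map_add, map_sum, map_smul, map_one, value_X, diff_one, diff_X, smul_eq_mul,
    mul_zero, Finset.sum_const_zero, mul_one, add_zero] at hv hd
  rw [smul_zero, zero_add] at hd
  rw [sub_eq_zero] at hv hd
  convert h using 1
  rw [hv, sub_sub]
  congr 2
  refine Finset.sum_congr rfl fun i _ => ?_
  rw [hd]
  simp [Pi.single_apply]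

/-- Monomials of degree below k span the quotient. This is the finite codimension required for
lifting generalized eigenvectors. -/
instance finiteDimensional_quotient (k : ℕ) :
    FiniteDimensional ℂ (HolGerm d ⧸ (maximalIdeal (HolGerm d) ^ k).restrictScalars ℂ) := by
  classical
  set N := (maximalIdeal (HolGerm d) ^ k).restrictScalars ℂ with hN
  let S := (Finset.range k).biUnion fun k => UnitSeries.expsOfDegree d k
  refine Module.finite_def.2 ⟨S.image fun α => N.mkQ (polyGerm (MvPolynomial.monomial α 1)), ?_⟩
  rw [eq_top_iff]
  intro x _
  obtain ⟨φ, rfl⟩ := N.mkQ_surjective x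
  obtain ⟨a, ha⟩ := exists_taylor φ
  have h := ha k S fun α hα => Finset.mem_biUnion.2 ⟨α.degree, Finset.mem_range.2 hα,
    UnitSeries.mem_expsOfDegree.2 rfl⟩
  have h' : N.mkQ φ = N.mkQ (polyGerm (∑ α ∈ S, MvPolynomial.monomial α (a α))) := by
    rw [← sub_eq_zero, ← map_sub, ← LinearMap.mem_ker, Submodule.ker_mkQ]
    exact h
  rw [h', ← ofPoly_apply, map_sum, map_sum]
  refine Submodule.sum_mem _ fun α hα => ?_
  have : MvPolynomial.monomial α (a α) = a α • MvPolynomial.monomial α (1 : ℂ) := by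
    rw [MvPolynomial.smul_monomial, smul_eq_mul, mul_one]
  rw [this, map_smul, map_smul]
  exact Submodule.smul_mem _ _ (Submodule.subset_span
    (Finset.mem_coe.2 (Finset.mem_image_of_mem _ hα)))

end HolGerm

end

/-! ### Solving u ∘ F - c·u = g to high order. -/

section

open HolGerm IsLocalRing Module.End UnitSeries EllOne

namespace UnitSeries

variable {d : ℕ}

/-- Monomials in power series without constant term and of norm at most `1 / 2`. -/
theorem exists_multiPow_series {b : Fin d → UnitSeries d} (hb : ∀ i, b i ∈ orderGE d 1)
    (hnorm : ∀ i, ‖b i‖ ≤ 1 / 2) (α : Fin d →₀ ℕ) :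
    ∃ v ∈ orderGE d α.degree, ‖v‖ ≤ (1 / 2) ^ α.degree ∧
      ∀ (y : Fin d → ℂ) (hy : ∀ i, ‖y i‖ ≤ 1),
        ev y hy v = multiPow (fun i => ev y hy (b i)) α := by
  have hone : ∃ v ∈ orderGE d (0 : Fin d →₀ ℕ).degree, ‖v‖ ≤ (1 / 2) ^ (0 : Fin d →₀ ℕ).degree ∧
      ∀ (y : Fin d → ℂ) (hy : ∀ i, ‖y i‖ ≤ 1),
        ev y hy v = multiPow (fun i => ev y hy (b i)) 0 :=
    ⟨unit 0, unit_mem_supportedOn (by simp), by simp [norm_unit], fun y hy => by simp [ev_unit]⟩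
  have hmul : ∀ α β : Fin d →₀ ℕ,
      (∃ v ∈ orderGE d α.degree, ‖v‖ ≤ (1 / 2) ^ α.degree ∧
        ∀ (y : Fin d → ℂ) (hy : ∀ i, ‖y i‖ ≤ 1),
          ev y hy v = multiPow (fun i => ev y hy (b i)) α) →
      (∃ v ∈ orderGE d β.degree, ‖v‖ ≤ (1 / 2) ^ β.degree ∧
        ∀ (y : Fin d → ℂ) (hy : ∀ i, ‖y i‖ ≤ 1),
          ev y hy v = multiPow (fun i => ev y hy (b i)) β) →
      ∃ v ∈ orderGE d (α + β).degree, ‖v‖ ≤ (1 / 2) ^ (α + β).degree ∧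
        ∀ (y : Fin d → ℂ) (hy : ∀ i, ‖y i‖ ≤ 1),
          ev y hy v = multiPow (fun i => ev y hy (b i)) (α + β) := by
    rintro α β ⟨v, hv, hvn, hve⟩ ⟨w, hw, hwn, hwe⟩
    refine ⟨mulL v w, ?_, ?_, fun y hy => by rw [ev_mulL, hve, hwe, multiPow_add]⟩
    · rw [map_add]
      exact mulL_mem_orderGE hv hw
    · rw [map_add, pow_add]
      exact (norm_mulL_le v w).trans (mul_le_mul hvn hwn (norm_nonneg _) (by positivity))
  induction α using Finsupp.induction_linear with
  | zero => exact hone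
  | add α β hα hβ => exact hmul α β hα hβ
  | single i n =>
    induction n with
    | zero => simpa using hone
    | succ n ih =>
      rw [Finsupp.single_add]
      refine hmul _ _ ih ⟨b i, ?_, ?_, fun y hy => by simp⟩
      · simpa using hb i
      · simpa using hnorm i

/-- Solving `S u - c u = a` in power series of high order, where `S` is the composition with a
strong contraction. -/
theorem exists_solution {b : Fin d → UnitSeries d} (hb : ∀ i, b i ∈ orderGE d 1)
    (hnorm : ∀ i, ‖b i‖ ≤ 1 / 2) {c : ℂ} {k : ℕ} (hk : (1 / 2) ^ k < ‖c‖) {a : UnitSeries d}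
    (ha : a ∈ orderGE d k) : ∃ u ∈ orderGE d k, ∀ (y : Fin d → ℂ) (_ : ∀ i, ‖y i‖ ≤ 1),
      u.sumFun (fun i => (b i).sumFun y) - c * u.sumFun y = a.sumFun y := by
  choose v hv hvn hve using exists_multiPow_series hb hnorm
  have hv1 : ∀ α, ‖v α‖ ≤ 1 := fun α =>
    (hvn α).trans (pow_le_one₀ (by norm_num) (by norm_num))
  let S := lift v 1 hv1
  have hdeg : ∀ x ∈ orderGE d k, ∀ α, x α ≠ 0 → k ≤ α.degree := fun x hx α hα => by
    by_contra h
    exact hα (hx α h)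
  have hSe : ∀ (x : UnitSeries d) (y : Fin d → ℂ) (hy : ∀ i, ‖y i‖ ≤ 1),
      (S x).sumFun y = x.sumFun fun i => (b i).sumFun y := fun x y hy => by
    have hby : ∀ i, ‖(b i).sumFun y‖ ≤ 1 := fun i => by
      rw [← ev_apply hy]
      refine ((ev y hy).le_of_opNorm_le (opNorm_lift_le _ _ zero_le_one _) (b i)).trans ?_
      linarith [hnorm i]
    have : (ev y hy).comp S = ev _ hby := ext_unit fun α => by
      rw [ContinuousLinearMap.comp_apply, lift_unit, hve, ev_unit]
      rfl
    exact DFunLike.congr_fun this x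
  have hc : 0 < ‖c‖ := lt_of_le_of_lt (by positivity) hk
  have hc0 : c ≠ 0 := norm_pos_iff.1 hc
  have hv2 : ∀ α, ‖if k ≤ α.degree then v α else 0‖ ≤ (1 / 2 : ℝ) ^ k := fun α => by
    split_ifs with h
    · exact (hvn α).trans (pow_le_pow_of_le_one (by norm_num) (by norm_num) h)
    · simp
  -- The truncation of S to degrees at least k has norm at most (1/2)^k < |c|, so 1 - c⁻¹S' is
  -- invertible. It agrees with S on series of order k, and its image consists of such series, so
  -- the solution has order k too.
  let S' := lift (fun α => if k ≤ α.degree then v α else 0) ((1 / 2) ^ k) hv2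
  have hS' : ∀ x : UnitSeries d, S' x ∈ orderGE d k := fun x =>
    lift_mem _ _ hv2 x (isClosed_supportedOn _) fun α _ => by
      split_ifs with h
      · exact orderGE_mono h (hv α)
      · exact Submodule.zero_mem _
  have hSS' : ∀ x ∈ orderGE d k, S' x = S x := fun x hx => by
    refine (hasSum_lift _ _ hv2 x).unique ?_
    convert hasSum_lift v 1 hv1 x using 2 with α
    by_cases hα : x α = 0
    · simp [hα]
    · rw [if_pos (hdeg x hx α hα)]
  have hX : ‖c⁻¹ • S'‖ < 1 := by
    refine (norm_smul_le c⁻¹ S').trans_lt ?_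
    rw [norm_inv, inv_mul_eq_div, div_lt_one hc]
    exact (opNorm_lift_le _ _ (by positivity) hv2).trans_lt hk
  obtain ⟨U, hU⟩ := isUnit_one_sub_of_norm_lt_one hX
  set u := (↑U⁻¹ : UnitSeries d →L[ℂ] UnitSeries d) ((-c⁻¹) • a) with hu
  have h1 : u - c⁻¹ • S' u = (-c⁻¹) • a := by
    have : (U : UnitSeries d →L[ℂ] UnitSeries d) u = (-c⁻¹) • a := by
      rw [hu, ← mul_apply_eq_comp, Units.mul_inv, one_apply_eq_self]
    rw [hU] at this
    exact this
  have huk : u ∈ orderGE d k := by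
    rw [sub_eq_iff_eq_add.1 h1]
    exact Submodule.add_mem _ (Submodule.smul_mem _ _ ha) (Submodule.smul_mem _ _ (hS' u))
  have h2 : u - c⁻¹ • S u = (-c⁻¹) • a := by rw [← hSS' u huk, h1]
  have h3 : S u - c • u = a := by
    have h4 := congrArg (fun z => (-c) • z) h2
    simp only [smul_sub, smul_smul, mul_inv_cancel₀ hc0, one_smul, neg_mul,
      neg_smul, smul_neg, neg_neg] at h4
    rw [← h4]
    abel
  refine ⟨u, huk, fun y hy => ?_⟩
  rw [← hSe _ y hy]
  simp only [← ev_apply hy]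
  rw [← h3, map_sub, map_smul, smul_eq_mul]

end UnitSeries

namespace BiholGerm

variable {d : ℕ}

/-- Coordinates of a strong contraction as power series on small polydiscs. -/
theorem exists_series_of_norm_fderiv_le {H : BiholGerm d}
    (hH : ∀ i, ∑ j, ‖diff (H.pullback (polyGerm (MvPolynomial.X i))) (Pi.single j 1)‖ ≤ 1 / 4) :
    ∃ t₀ : ℝ, 0 < t₀ ∧ ∀ t : ℝ, 0 < t → t ≤ t₀ → ∃ b : Fin d → UnitSeries d,
      (∀ i, b i ∈ orderGE d 1) ∧ (∀ i, ‖b i‖ ≤ 1 / 2) ∧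
      ∀ i, ofSeries (fun _ => t) ((t : ℂ) • b i) = H.pullback (polyGerm (MvPolynomial.X i)) := by
  have hq : ∀ i, ∃ s : ℝ, 0 < s ∧ ∀ t : ℝ, 0 < t → t ≤ s → ∃ b ∈ orderGE d 1, ‖b‖ ≤ 1 / 2 ∧
      ofSeries (fun _ => t) ((t : ℂ) • b) = H.pullback (polyGerm (MvPolynomial.X i)) := fun i => by
    set φ := H.pullback (polyGerm (MvPolynomial.X i)) with hφ
    have hφ0 : value φ = 0 := by rw [hφ, H.value_pullback, value_X]
    obtain ⟨s, hs, a, ha, hsa⟩ := exists_ofSeries_of_mem_pow 2 (sub_linear_part_mem_sq φ)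
    -- The part of order two has norm at most ‖a‖(t/s)² ≤ t/4. After division by t it adds at most
    -- 1/4 to the linear part, itself at most 1/4.
    refine ⟨min s (s ^ 2 / (4 * (‖a‖ + 1))), by positivity, fun t ht hts => ?_⟩
    obtain ⟨e, he, hte⟩ := exists_rescale (ρ' := fun _ => t) (ρ := fun _ => s)
      (fun _ => ht) (fun _ => hts.trans (min_le_left _ _)) a
    have ht' : (t : ℂ) ≠ 0 := by exact_mod_cast ht.ne'
    have hen : ‖e‖ ≤ t * (1 / 4) := by
      have hle : ∀ α, ‖e α‖ ≤ ‖a α‖ * (t / s) ^ 2 := fun α => by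
        by_cases hα : a α = 0
        · rw [he, hα]
          simp
        have hdeg : 2 ≤ α.degree := by
          by_contra h
          exact hα (ha α h)
        rw [he, norm_mul, multiPow_const, norm_pow, Complex.norm_real,
          Real.norm_of_nonneg (by positivity)]
        refine mul_le_mul_of_nonneg_left (pow_le_pow_of_le_one (by positivity) ?_ hdeg)
          (norm_nonneg _)
        exact (div_le_one hs).2 (hts.trans (min_le_left _ _))
      have h1 : ‖e‖ ≤ ‖a‖ * (t / s) ^ 2 := hasSum_le hle e.hasSum_norm (a.hasSum_norm.mul_right _)
      refine h1.trans ?_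
      have h2 := hts.trans (min_le_right _ _)
      rw [le_div_iff₀ (by positivity)] at h2
      rw [div_pow, ← mul_div_assoc, div_le_iff₀ (by positivity)]
      nlinarith [norm_nonneg a]
    let l : UnitSeries d := ∑ j, diff φ (Pi.single j 1) • unit (Finsupp.single j 1)
    have hln : ‖l‖ ≤ 1 / 4 := by
      refine (norm_sum_le _ _).trans (le_trans (le_of_eq ?_) (hH i))
      exact Finset.sum_congr rfl fun j _ => by rw [norm_smul, norm_unit, mul_one]
    refine ⟨l + (t : ℂ)⁻¹ • e, ?_, ?_, ?_⟩
    · refine add_mem (Submodule.sum_mem _ fun j _ => Submodule.smul_mem _ _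
        (unit_mem_supportedOn (by simp))) (Submodule.smul_mem _ _ ?_)
      exact orderGE_mono one_le_two (rescale_mem_orderGE he ha)
    · refine (norm_add_le _ _).trans ?_
      rw [norm_smul, norm_inv, Complex.norm_real, Real.norm_of_nonneg ht.le, inv_mul_eq_div]
      have : ‖e‖ / t ≤ 1 / 4 := by
        rw [div_le_iff₀ ht]
        linarith
      linarith
    · rw [smul_add, smul_smul, mul_inv_cancel₀ ht', one_smul, map_add, hte, hsa, map_smul]
      simp only [l, map_sum, map_smul]
      have hX : ∀ j : Fin d, (t : ℂ) • ofSeries (fun _ => t) (unit (Finsupp.single j 1)) =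
          polyGerm (MvPolynomial.X j) := fun j => by
        rw [ofSeries_unit fun _ => ht, ← ofPoly_apply, ← map_smul, MvPolynomial.smul_monomial,
          multiPow_single, pow_one, smul_eq_mul, mul_inv_cancel₀ ht']
        rfl
      rw [Finset.smul_sum]
      simp only [smul_comm (t : ℂ) _ _, hX]
      rw [hφ0]
      simp
  choose s hs h using hq
  obtain ⟨t₀, ht₀, hle⟩ : ∃ t₀ : ℝ, 0 < t₀ ∧ ∀ i, t₀ ≤ s i := by
    by_cases hd : Nonempty (Fin d)
    · exact ⟨Finset.univ.inf' Finset.univ_nonempty s, by simpa [Finset.lt_inf'_iff] using hs,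
        fun i => Finset.inf'_le _ (Finset.mem_univ i)⟩
    · exact ⟨1, one_pos, fun i => absurd ⟨i⟩ hd⟩
  refine ⟨t₀, ht₀, fun t ht htt => ?_⟩
  choose b hb using fun i => h i t ht (htt.trans (hle i))
  exact ⟨b, fun i => (hb i).1, fun i => (hb i).2.1, fun i => (hb i).2.2⟩

/-- In the coordinate y = x/t with t small, H is given by series of norm at most 1/2 without
constant term, to which `exists_solution` applies. -/
theorem exists_pullback_sub_smul_eq_of_norm_le {H : BiholGerm d}
    (hH : ∀ i, ∑ j, ‖diff (H.pullback (polyGerm (MvPolynomial.X i))) (Pi.single j 1)‖ ≤ 1 / 4)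
    {c : ℂ} {k : ℕ} (hk : (1 / 2) ^ k < ‖c‖) {g : HolGerm d}
    (hg : g ∈ maximalIdeal (HolGerm d) ^ k) :
    ∃ u ∈ maximalIdeal (HolGerm d) ^ k, H.pullback u - c • u = g := by
  obtain ⟨t₀, ht₀, h⟩ := exists_series_of_norm_fderiv_le hH
  obtain ⟨s, hs, a₀, ha₀, rfl⟩ := exists_ofSeries_of_mem_pow k hg
  set t := min s t₀ with htdef
  have ht : 0 < t := lt_min hs ht₀
  obtain ⟨b, hb, hbn, hbX⟩ := h t ht (min_le_right _ _)
  obtain ⟨a, ha, hta⟩ := exists_rescale (ρ' := fun _ => t) (ρ := fun _ => s) (fun _ => ht)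
    (fun _ => min_le_left _ _) a₀
  obtain ⟨u, hu, hsol⟩ := exists_solution hb hbn hk (rescale_mem_orderGE ha ha₀)
  refine ⟨ofSeries (fun _ => t) u, ofSeries_mem_pow (fun _ => ht) hu, ?_⟩
  rw [← hta]
  have ht' : (t : ℂ) ≠ 0 := by exact_mod_cast ht.ne'
  have hcoord : ∀ᶠ x : Fin d → ℂ in 𝓝 0, ∀ i, H x i / t = (b i).sumFun fun j => x j / t := by
    rw [eventually_all]
    intro i
    have h1 : H.pullback (polyGerm (MvPolynomial.X i)) = HolGerm.mk (fun x => H x i)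
        ((analyticAt_pi_iff.1 H.analyticAt_toFun) i) := by
      refine ext_of_eventually (fun x => MvPolynomial.eval (H x) (MvPolynomial.X i)) _ rfl rfl ?_
      exact Eventually.of_forall fun x => MvPolynomial.eval_X i
    have h2 := (hbX i).trans h1
    have h3 : ∀ᶠ x : Fin d → ℂ in 𝓝 0, ((t : ℂ) • b i).sumFun (fun j => x j / (t : ℝ)) = H x i :=
      Germ.coe_eq.1 ((coe_ofSeries _ _).symm.trans (congrArg Subtype.val h2))
    filter_upwards [h3, eventually_norm_div_le fun _ => t] with x hx hy
    rw [← hx, ← ev_apply hy, map_smul, smul_eq_mul, mul_div_cancel_left₀ _ ht', ev_apply]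
  refine ext_of_eventually (fun x => u.sumFun (fun i => H x i / t) - c * u.sumFun fun i => x i / t)
    _ rfl (coe_ofSeries _ _) ?_
  filter_upwards [hcoord, eventually_norm_div_le fun _ => t] with x hx hy
  rw [← hsol _ hy]
  simp only [hx]

/-- The composition of biholomorphic germs. -/
def comp (G F : BiholGerm d) : BiholGerm d where
  toFun := G ∘ F
  invFun := F.invFun ∘ G.invFun
  map_zero := by simp only [Function.comp_apply, map_zero]
  inv_map_zero := by simp only [Function.comp_apply, inv_map_zero]
  analyticAt_toFun := AnalyticAt.comp (by rw [F.map_zero]; exact G.analyticAt_toFun)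
    F.analyticAt_toFun
  analyticAt_invFun := AnalyticAt.comp (by rw [G.inv_map_zero]; exact F.analyticAt_invFun)
    G.analyticAt_invFun
  left_inv := by
    filter_upwards [F.left_inv, F.tendsto_zero.eventually G.left_inv] with x h1 h2
    simp only [Function.comp_apply, h2, h1]
  right_inv := by
    filter_upwards [G.right_inv, G.symm.tendsto_zero.eventually F.right_inv] with x h1 h2
    have h3 : F (F.invFun (G.invFun x)) = G.invFun x := h2
    simp only [Function.comp_apply, h3, h1]

theorem pullback_comp (G F : BiholGerm d) (φ : HolGerm d) :
    (G.comp F).pullback φ = F.pullback (G.pullback φ) := by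
  obtain ⟨f, hf, rfl⟩ := exists_mk φ
  rfl

/-- Iterates of a biholomorphic germ. -/
def iterate (F : BiholGerm d) : ℕ → BiholGerm d
  | 0 => ⟨id, id, rfl, rfl, analyticAt_id, analyticAt_id, Eventually.of_forall fun _ => rfl,
      Eventually.of_forall fun _ => rfl⟩
  | n + 1 => (F.iterate n).comp F

theorem pullback_iterate (F : BiholGerm d) (n : ℕ) (φ : HolGerm d) :
    (F.iterate n).pullback φ = (F.pullbackEnd ^ n) φ := by
  induction n generalizing φ with
  | zero =>
    obtain ⟨f, hf, rfl⟩ := exists_mk φ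
    rfl
  | succ n ih =>
    rw [pow_succ', Module.End.mul_apply, ← ih]
    exact pullback_comp _ _ _

theorem diff_pullbackEnd_pow (F : BiholGerm d) (n : ℕ) (φ : HolGerm d) (v : Fin d → ℂ) :
    diff ((F.pullbackEnd ^ n) φ) v = diff φ ((fderiv ℂ F 0 ^ n) v) := by
  induction n generalizing φ v with
  | zero => rfl
  | succ n ih =>
    rw [pow_succ, Module.End.mul_apply, ih]
    change diff (F.pullback φ) _ = _
    rw [diff_pullback, pow_succ']
    rfl

/-- Some iterate F^n has a linear part small enough for the previous result with c^n. The
factorization T^n - c^n = (T - c) Σ T^i c^(n-1-i) for T = F^* turns its solution into one for T - c.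
-/
theorem exists_pullback_sub_smul_eq {F : BiholGerm d}
    (hF : Tendsto (fun n : ℕ => ‖fderiv ℂ F 0 ^ n‖) atTop (𝓝 0)) {c : ℂ} (hc : c ≠ 0) :
    ∃ k₀, ∀ k, k₀ ≤ k → ∀ g ∈ maximalIdeal (HolGerm d) ^ k,
      ∃ u ∈ maximalIdeal (HolGerm d) ^ k, F.pullback u - c • u = g := by
  obtain ⟨n, hn⟩ := (hF.eventually_le_const
    (show (0 : ℝ) < 1 / (4 * (d + 1)) by positivity)).exists
  have hH : ∀ i, ∑ j, ‖diff ((F.iterate n).pullback (polyGerm (MvPolynomial.X i)))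
      (Pi.single j 1)‖ ≤ 1 / 4 := fun i => by
    have h1 : ∀ j, ‖diff ((F.iterate n).pullback (polyGerm (MvPolynomial.X i)))
        (Pi.single j 1)‖ ≤ 1 / (4 * (d + 1)) := fun j => by
      rw [pullback_iterate, diff_pullbackEnd_pow, diff_X]
      refine (norm_le_pi_norm _ i).trans (((fderiv ℂ F 0 ^ n).le_opNorm _).trans ?_)
      simpa [Pi.norm_single] using hn
    refine (Finset.sum_le_sum fun j _ => h1 j).trans ?_
    rw [Finset.sum_const, Finset.card_univ, Fintype.card_fin, nsmul_eq_mul, mul_one_div,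
      div_le_div_iff₀ (by positivity) (by norm_num)]
    linarith
  obtain ⟨k₀, hk₀⟩ := exists_pow_lt_of_lt_one (norm_pos_iff.2 (pow_ne_zero n hc))
    (show (1 / 2 : ℝ) < 1 by norm_num)
  refine ⟨k₀, fun k hk g hg => ?_⟩
  have hk' : (1 / 2 : ℝ) ^ k < ‖c ^ n‖ :=
    (pow_le_pow_of_le_one (by norm_num) (by norm_num) hk).trans_lt hk₀
  obtain ⟨u, hu, hug⟩ := exists_pullback_sub_smul_eq_of_norm_le hH hk' hg
  have hcomm : Commute F.pullbackEnd (c • (1 : Module.End ℂ (HolGerm d))) :=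
    (Commute.one_right _).smul_right c
  have hgeom := hcomm.mul_geom_sum₂ n
  have hmem : ∀ i, ∀ w ∈ maximalIdeal (HolGerm d) ^ k,
      (F.pullbackEnd ^ i) w ∈ maximalIdeal (HolGerm d) ^ k := fun i w hw => by
    rw [← pullback_iterate]
    exact (F.iterate i).pullback_mem_pow hw
  have hcpow : ∀ m : ℕ, (c • (1 : Module.End ℂ (HolGerm d))) ^ m = c ^ m • 1 := fun m => by
    rw [smul_pow, one_pow]
  refine ⟨(∑ i ∈ Finset.range n, F.pullbackEnd ^ i *
    (c • (1 : Module.End ℂ (HolGerm d))) ^ (n - 1 - i)) u, ?_, ?_⟩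
  · rw [LinearMap.sum_apply]
    refine Ideal.sum_mem _ fun i _ => ?_
    rw [hcpow, Module.End.mul_apply]
    refine hmem i _ ?_
    change c ^ (n - 1 - i) • u ∈ _
    rw [Algebra.smul_def]
    exact Ideal.mul_mem_left _ _ hu
  · have h1 := DFunLike.congr_fun hgeom u
    rw [hcpow] at h1
    rw [← hug, pullback_iterate]
    exact h1

end BiholGerm

end

/-! ### Jordan normal form with eigenvalues ordered by modulus. -/

section

open Polynomial Module

namespace Module.End

variable {K V : Type*} [Field K] [AddCommGroup V] [Module K V]

/-- The basis of `K[X] / (X - μ)ᵉ` in which multiplication by `X` is a Jordan block. -/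
theorem exists_basis_quotient_span_pow (μ : K) (e : ℕ) {J : Submodule K[X] K[X]}
    (hJ : J = Submodule.span K[X] {(X - C μ) ^ e}) :
    ∃ b : Basis (Fin e) K (K[X] ⧸ J), ∀ k, (X : K[X]) • b k = μ • b k +
      if h : (k : ℕ) = 0 then 0 else b ⟨k - 1, by omega⟩ := by
  -- The powers are listed downwards, so that X - μ lowers the index k by one and kills the vector
  -- of index 0.
  let v : Fin e → K[X] ⧸ J := fun k => J.mkQ ((X - C μ) ^ (e - 1 - k))
  have hmonic : ((X - C μ) ^ e).Monic := (monic_X_sub_C μ).pow e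
  have hdeg : ((X - C μ) ^ e).natDegree = e := by
    rw [(monic_X_sub_C μ).natDegree_pow, natDegree_X_sub_C, mul_one]
  have hli : LinearIndependent K v := by
    rw [Fintype.linearIndependent_iff]
    intro g hg
    set p : K[X] := ∑ k, C (g k) * (X - C μ) ^ (e - 1 - (k : ℕ)) with hp
    have hpJ : p ∈ J := by
      rw [← Submodule.ker_mkQ J, LinearMap.mem_ker, hp, map_sum, ← hg]
      refine Finset.sum_congr rfl fun k _ => ?_
      rw [← smul_eq_C_mul]
      rfl
    have hp0 : p = 0 := by
      rw [hJ, Submodule.mem_span_singleton] at hpJ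
      obtain ⟨a, ha⟩ := hpJ
      refine eq_zero_of_dvd_of_degree_lt ⟨a, by rw [← ha, smul_eq_mul, mul_comm]⟩ ?_
      rw [degree_eq_natDegree hmonic.ne_zero, hdeg]
      refine (degree_sum_le _ _).trans_lt ((Finset.sup_lt_iff (WithBot.bot_lt_coe e)).2 fun k _ => ?_)
      rw [← smul_eq_C_mul]
      refine (degree_smul_le _ _).trans_lt ?_
      rw [degree_eq_natDegree ((monic_X_sub_C μ).pow _).ne_zero, (monic_X_sub_C μ).natDegree_pow,
        natDegree_X_sub_C, mul_one]
      exact WithBot.coe_lt_coe.2 (by omega : e - 1 - (k : ℕ) < e)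
    -- Translation by μ turns powers of X - μ into powers of X, whose coefficients can be compared.
    have ht : ∑ k, C (g k) * X ^ (e - 1 - (k : ℕ)) = 0 := by
      have := congrArg (taylor μ) hp0
      simpa [hp, taylor_mul, taylor_pow] using this
    intro k
    have hc := congrArg (fun q => coeff q (e - 1 - k)) ht
    simp only [finsetSum_coeff, coeff_C_mul, coeff_X_pow, coeff_zero] at hc
    rw [Finset.sum_eq_single k] at hc
    · simpa using hc
    · intro j _ hj
      rw [if_neg, mul_zero]
      have := Fin.val_ne_of_ne hj
      omega
    · simp
  have hfin : finrank K (K[X] ⧸ J) = e := by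
    subst hJ
    exact (finrank_quotient_span_eq_natDegree (f := (X - C μ) ^ e)).trans hdeg
  have : FiniteDimensional K (K[X] ⧸ J) := by
    subst hJ
    exact hmonic.finite_quotient
  have hspan : ⊤ ≤ Submodule.span K (Set.range v) :=
    (hli.span_eq_top_of_card_eq_finrank' (by simp [hfin])).ge
  refine ⟨Basis.mk hli hspan, fun k => ?_⟩
  have he : 1 ≤ e := by have := k.2; omega
  simp only [Basis.mk_apply, v]
  have h1 : (X : K[X]) • J.mkQ ((X - C μ) ^ (e - 1 - (k : ℕ))) = μ • J.mkQ ((X - C μ) ^ (e - 1 - (k : ℕ))) +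
      J.mkQ ((X - C μ) ^ (e - 1 - (k : ℕ) + 1)) := by
    have : (X : K[X]) • (X - C μ) ^ (e - 1 - (k : ℕ)) = μ • (X - C μ) ^ (e - 1 - (k : ℕ)) +
        (X - C μ) ^ (e - 1 - (k : ℕ) + 1) := by
      rw [smul_eq_C_mul, smul_eq_mul]
      ring
    rw [← map_smul, this, map_add]
    rfl
  rw [h1]
  congr 1
  split_ifs with h
  · rw [h, Nat.sub_zero, Nat.sub_add_cancel he, ← LinearMap.mem_ker, Submodule.ker_mkQ, hJ]
    exact Submodule.mem_span_singleton_self _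
  · congr 2
    have := k.2
    omega

variable [FiniteDimensional K V] [IsAlgClosed K]

/-- Jordan normal form. -/
theorem exists_jordan_basis_sigma (B : Module.End K V) :
    ∃ (r : ℕ) (e : Fin r → ℕ) (μ : Fin r → K) (b : Basis (Σ i, Fin (e i)) K V),
      ∀ i k, B (b ⟨i, k⟩) = μ i • b ⟨i, k⟩ +
        if h : (k : ℕ) = 0 then 0 else b ⟨i, k - 1, by omega⟩ := by
  classical
  -- The structure theorem for V as a torsion K[X]-module with X acting as B; over an algebraically
  -- closed field the irreducible factors are linear.
  obtain ⟨ι, hι, p, hp, e, ⟨f⟩⟩ := equiv_directSum_of_isTorsion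
    (AEval.isTorsion_of_finiteDimensional K V B)
  have hμ : ∀ i, ∃ μ : K, Submodule.span K[X] {p i ^ e i} =
      Submodule.span K[X] {(X - C μ) ^ e i} := fun i => by
    obtain ⟨μ, hμ⟩ := exists_root_of_degree_eq_one (IsAlgClosed.degree_eq_one_of_irreducible K (hp i))
    refine ⟨μ, Ideal.span_singleton_eq_span_singleton.2 (Associated.pow_pow ?_)⟩
    exact ((irreducible_X_sub_C μ).associated_of_dvd (hp i) (dvd_iff_isRoot.2 hμ)).symm
  choose μ hμ using hμ
  choose b hb using fun i => exists_basis_quotient_span_pow (μ i) (e i) (hμ i)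
  let σ := (Fintype.equivFin ι).symm
  let b' : Basis (Σ i, Fin (e i)) K V :=
    ((DFinsupp.basis b).map (f.restrictScalars K).symm).map (AEval'.of B).symm
  have hb'e : ∀ i k, b' ⟨i, k⟩ = (AEval'.of B).symm (f.symm (DirectSum.lof K[X] ι _ i (b i k))) := by
    intro i k
    have h : DFinsupp.basis b ⟨i, k⟩ = DFinsupp.single i (b i k) := by
      rw [Basis.apply_eq_iff]
      change (sigmaFinsuppLequivDFinsupp K).symm (DFinsupp.mapRange (fun i => (b i).repr)
        (fun i => map_zero (b i).repr) _) = _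
      rw [LinearEquiv.symm_apply_eq, DFinsupp.mapRange_single]
      exact (congrArg _ ((b i).repr_self k)).trans 
        (sigmaFinsuppEquivDFinsupp_single (η := fun i => Fin (e i)) ⟨i, k⟩ (1 : K)).symm
    rw [Basis.map_apply, Basis.map_apply]
    exact congrArg (fun x => (AEval'.of B).symm (f.symm x)) h
  have hb' : ∀ i k, B (b' ⟨i, k⟩) = μ i • b' ⟨i, k⟩ +
        if h : (k : ℕ) = 0 then 0 else b' ⟨i, k - 1, by omega⟩ := fun i k => by
    have h1 : ∀ m, B ((AEval'.of B).symm m) = (AEval'.of B).symm ((X : K[X]) • m) := fun m =>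
      (AEval.of_symm_X_smul B m).symm
    rw [hb'e, h1, ← map_smul, ← map_smul, hb, map_add, map_add, map_add]
    congr 1
    · have h2 : ∀ m, (AEval'.of B).symm ((C (μ i) : K[X]) • m) = μ i • (AEval'.of B).symm m :=
        fun m => by rw [AEval.C_smul, map_smul]
      have h3 : μ i • b i k = (C (μ i) : K[X]) • b i k := by
        rw [← algebraMap_eq, algebraMap_smul]
      rw [h3, map_smul, map_smul, h2]
    · split_ifs with h
      · simp
      · rw [hb'e]
  refine ⟨_, e ∘ σ, μ ∘ σ, b'.reindex (Equiv.sigmaCongrLeft (β := fun i => Fin (e i)) σ).symm,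
    fun i k => ?_⟩
  have h := hb' (σ i) k
  simp only [Basis.reindex_apply, Equiv.symm_symm]
  exact h

/-- Jordan normal form with ordered eigenvalues. -/
theorem exists_ordered_jordan_basis {V : Type*} [AddCommGroup V] [Module ℂ V]
    [FiniteDimensional ℂ V] {n : ℕ} (hn : finrank ℂ V = n) (B : Module.End ℂ V) :
    ∃ (b : Basis (Fin n) ℂ V) (lam : Fin n → ℂ), (∀ i j, i ≤ j → ‖lam j‖ ≤ ‖lam i‖) ∧
      ∀ i, B (b i) = lam i • b i ∨
        ∃ j : Fin n, (j : ℕ) + 1 = i ∧ lam j = lam i ∧ B (b i) = lam i • b i + b j := by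
  obtain ⟨r, e₀, μ₀, b₀, h₀⟩ := exists_jordan_basis_sigma B
  -- Whole blocks are sorted by decreasing modulus and then concatenated, so chains stay at
  -- consecutive indices.
  let σ := Tuple.sort fun i => -‖μ₀ i‖
  have hσ : ∀ i j, i ≤ j → ‖μ₀ (σ j)‖ ≤ ‖μ₀ (σ i)‖ := fun i j hij =>
    neg_le_neg_iff.1 (Tuple.monotone_sort (fun i => -‖μ₀ i‖) hij)
  let e := e₀ ∘ σ
  let b₁ : Basis (Σ i, Fin (e i)) ℂ V :=
    b₀.reindex (Equiv.sigmaCongrLeft (β := fun i => Fin (e₀ i)) σ).symm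
  have h₁ : ∀ i k, B (b₁ ⟨i, k⟩) = μ₀ (σ i) • b₁ ⟨i, k⟩ +
      if h : (k : ℕ) = 0 then 0 else b₁ ⟨i, k - 1, by omega⟩ := fun i k => by
    have h := h₀ (σ i) k
    simp only [b₁, Basis.reindex_apply, Equiv.symm_symm]
    exact h
  have hsum : ∑ i, e i = n := by
    rw [← hn, finrank_eq_card_basis b₁]
    simp
  subst hsum
  have hflat : ∀ x y : Σ i, Fin (e i), finSigmaFinEquiv x ≤ finSigmaFinEquiv y → x.1 ≤ y.1 := by
    intro x y hxy
    by_contra! hlt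
    rw [Fin.le_def, finSigmaFinEquiv_apply, finSigmaFinEquiv_apply] at hxy
    let g : ℕ → ℕ := fun i => if h : i < r then e ⟨i, h⟩ else 0
    have hg : ∀ m (hm : m ≤ r), ∑ i : Fin m, e (Fin.castLE hm i) = ∑ i ∈ Finset.range m, g i :=
      fun m hm => by
        rw [Finset.sum_range]
        exact Finset.sum_congr rfl fun i _ =>
          (show g i = e (Fin.castLE hm i) from dif_pos (i.2.trans_le hm)).symm
    rw [hg _ x.1.2.le, hg _ y.1.2.le] at hxy
    have h1 : ∑ i ∈ Finset.range (y.1 + 1), g i ≤ ∑ i ∈ Finset.range x.1, g i :=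
      Finset.sum_le_sum_of_subset (Finset.range_subset_range.2 hlt)
    rw [Finset.sum_range_succ, show g y.1 = e y.1 from dif_pos y.1.2] at h1
    have := y.2.2
    omega
  refine ⟨b₁.reindex finSigmaFinEquiv, fun i => μ₀ (σ (finSigmaFinEquiv.symm i).1),
    fun i j hij => hσ _ _ (hflat _ _ (by simpa using hij)), fun i => ?_⟩
  obtain ⟨⟨i, k⟩, rfl⟩ := finSigmaFinEquiv.surjective i
  simp only [Basis.reindex_apply, Equiv.symm_apply_apply]
  rw [h₁]
  by_cases hk : (k : ℕ) = 0
  · exact Or.inl (by rw [dif_pos hk, add_zero])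
  · refine Or.inr ⟨finSigmaFinEquiv ⟨i, k - 1, by omega⟩, ?_, ?_⟩
    · rw [finSigmaFinEquiv_apply, finSigmaFinEquiv_apply]
      simp only
      omega
    · rw [dif_neg hk, Equiv.symm_apply_apply]
      exact ⟨rfl, rfl⟩

end Module.End

end

/-! ### Existence of Poincaré–Dulac coordinates. -/

section

open HolGerm IsLocalRing Module Module.End

namespace HolGerm

variable {d : ℕ}

theorem exists_diff_eq (l : Dual ℂ (Fin d → ℂ)) :
    ∃ φ : HolGerm d, diff φ = l := by
  refine ⟨∑ i, l (Pi.single i 1) • polyGerm (MvPolynomial.X i), ?_⟩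
  rw [map_sum]
  refine LinearMap.pi_ext' fun i => LinearMap.ext_ring ?_
  simp only [map_smul, diff_X]
  simp [Pi.single_apply]

theorem value_polyGerm (P : MvPolynomial (Fin d) ℂ) : value (polyGerm P) = P.coeff 0 := by
  rw [polyGerm_eq_mk, value_mk]
  exact MvPolynomial.eval₂Hom_zero_apply (RingHom.id ℂ) P

theorem diff_polyGerm (P : MvPolynomial (Fin d) ℂ) (j : Fin d) :
    diff (polyGerm P) (Pi.single j 1) = P.coeff (Finsupp.single j 1) := by
  classical
  induction P using MvPolynomial.induction_on with
  | C a =>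
    have : polyGerm (MvPolynomial.C a : MvPolynomial (Fin d) ℂ) = a • 1 := by
      rw [← ofPoly_apply, ← map_one ofPoly, ← map_smul, MvPolynomial.smul_eq_C_mul, mul_one]
    rw [this, map_smul, diff_one, smul_zero, LinearMap.zero_apply, MvPolynomial.coeff_C,
      if_neg (Finsupp.single_ne_zero.2 one_ne_zero).symm]
  | add p q hp hq =>
    rw [← ofPoly_apply, map_add, map_add, LinearMap.add_apply, ofPoly_apply, ofPoly_apply, hp, hq,
      MvPolynomial.coeff_add]
  | mul_X p i hp =>
    rw [← ofPoly_apply, map_mul, ofPoly_apply, ofPoly_apply, diff_mul, value_X, diff_X,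
      value_polyGerm, MvPolynomial.coeff_mul_X']
    by_cases hij : i = j
    · subst hij
      simp
    · simp [hij]

end HolGerm

theorem Finsupp.exists_eq_single_of_degree_eq_one {ι : Type*} {α : ι →₀ ℕ} (h : α.degree = 1) :
    ∃ i, α = single i 1 := by
  have hα : α ≠ 0 := fun e => by simp [e] at h
  obtain ⟨i, hi⟩ := Finsupp.ne_iff.1 hα
  have hle : single i 1 ≤ α := by
    rw [single_le_iff]
    exact Nat.one_le_iff_ne_zero.2 hi
  obtain ⟨β, rfl⟩ := exists_add_of_le hle
  have : β = 0 := by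
    rw [← degree_eq_zero_iff]
    simpa using h
  exact ⟨i, by rw [this, add_zero]⟩

namespace BiholGerm

variable {d : ℕ}

/-- Germs with independent differentials form a coordinate system. -/
theorem exists_pullback_X_eq {u : Fin d → HolGerm d} (h0 : ∀ i, value (u i) = 0)
    (hli : LinearIndependent ℂ fun i => diff (u i)) :
    ∃ Φ : BiholGerm d, ∀ i, Φ.pullback (polyGerm (MvPolynomial.X i)) = u i := by
  choose f hf hfu using fun i => exists_mk (u i)
  let g : (Fin d → ℂ) → (Fin d → ℂ) := fun x i => f i x
  have hg : AnalyticAt ℂ g 0 := analyticAt_pi_iff.2 hf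
  have hg0 : g 0 = 0 := funext fun i => by
    have := h0 i
    rwa [← hfu i, value_mk] at this
  have hgd : ∀ v i, fderiv ℂ g 0 v i = diff (u i) v := fun v i => by
    rw [← hfu i, diff_mk, fderiv_pi fun i => (hf i).differentiableAt]
    rfl
  have hspan := hli.span_eq_top_of_card_eq_finrank' (by
    rw [Subspace.dual_finrank_eq, finrank_fin_fun, Fintype.card_fin])
  have hinj : Function.Injective (fderiv ℂ g 0).toLinearMap := by
    rw [← LinearMap.ker_eq_bot, Submodule.eq_bot_iff]
    intro v hv
    -- The differentials span the dual space, so a vector in the kernel of Dg is killed by every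
    -- linear form; the inverse function theorem then applies.
    refine (forall_dual_apply_eq_zero_iff ℂ v).1 fun l => ?_
    have hl : l ∈ Submodule.span ℂ (Set.range fun i => diff (u i)) := hspan ▸ Submodule.mem_top
    have hle : Submodule.span ℂ (Set.range fun i => diff (u i)) ≤
        LinearMap.ker (Dual.eval ℂ (Fin d → ℂ) v) := by
      rw [Submodule.span_le]
      rintro _ ⟨i, rfl⟩
      change diff (u i) v = 0
      rw [← hgd]
      exact congrFun hv i
    exact hle hl
  let e : (Fin d → ℂ) ≃L[ℂ] (Fin d → ℂ) :=
    (LinearEquiv.ofInjectiveEndo _ hinj).toContinuousLinearEquiv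
  have he : (e : (Fin d → ℂ) →L[ℂ] (Fin d → ℂ)) = fderiv ℂ g 0 := by
    ext1 v
    rfl
  have hs : HasStrictFDerivAt g (e : (Fin d → ℂ) →L[ℂ] (Fin d → ℂ)) 0 := by
    rw [he]
    exact hg.hasStrictFDerivAt
  have hl := hs.localInverse_apply_image
  have han := (hs.toOpenPartialHomeomorph g).analyticAt_symm'
    hs.mem_toOpenPartialHomeomorph_source hg he.symm
  refine ⟨⟨g, hs.localInverse g e 0, hg0, by rwa [hg0] at hl, hg, ?_, hs.eventually_left_inverse,
    ?_⟩, fun i => ?_⟩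
  · have : AnalyticAt ℂ (hs.localInverse g e 0) (g 0) := han
    rwa [hg0] at this
  · have := hs.eventually_right_inverse
    rwa [hg0] at this
  · rw [← hfu i]
    exact ext_of_eventually (fun x => MvPolynomial.eval (g x) (MvPolynomial.X i)) (f i) rfl rfl
      (Eventually.of_forall fun x => MvPolynomial.eval_X i)

/-- The eigenvalues of the linear part of a contracting germ. -/
theorem norm_eigenvalue {F : BiholGerm d}
    (hF : Tendsto (fun n : ℕ => ‖fderiv ℂ F 0 ^ n‖) atTop (𝓝 0)) {l : Dual ℂ (Fin d → ℂ)}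
    (hl : l ≠ 0) {c : ℂ} (h : (fderiv ℂ F 0).toLinearMap.dualMap l = c • l) :
    ‖c‖ < 1 ∧ 0 < ‖c‖ := by
  constructor
  · obtain ⟨v, hv⟩ : ∃ v, l v ≠ 0 := by
      by_contra! h'
      exact hl (LinearMap.ext h')
    have hpow : ∀ (n : ℕ) w, l ((fderiv ℂ F 0 ^ n) w) = c ^ n * l w := fun n => by
      induction n with
      | zero => intro w; simp
      | succ n ih =>
        intro w
        rw [pow_succ, mul_apply_eq_comp, ih, pow_succ, mul_assoc]
        exact congrArg _ (DFunLike.congr_fun h w)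
    rw [← tendsto_pow_atTop_nhds_zero_iff_norm_lt_one]
    have h1 : Tendsto (fun n : ℕ => (fderiv ℂ F 0 ^ n) v) atTop (𝓝 0) := by
      refine squeeze_zero_norm (fun n => (fderiv ℂ F 0 ^ n).le_opNorm v) ?_
      simpa using hF.mul_const ‖v‖
    have h2 := (l.continuous_of_finiteDimensional.tendsto 0).comp h1
    rw [_root_.map_zero] at h2
    have h3 := h2.mul_const (l v)⁻¹
    rw [zero_mul] at h3
    refine h3.congr fun n => ?_
    rw [Function.comp_apply, hpow, mul_assoc, mul_inv_cancel₀ hv, mul_one]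
  · rw [norm_pos_iff]
    rintro rfl
    obtain ⟨φ, rfl⟩ := exists_diff_eq l
    apply hl
    -- If c = 0, then F^*φ has zero differential; pulling back by the inverse germ gives l = 0.
    rw [← F.symm.pullback_symm_pullback φ, diff_pullback]
    have : diff (F.symm.symm.pullback φ) = 0 := by
      rw [zero_smul] at h
      exact (diff_pullback F φ).trans h
    rw [this, LinearMap.zero_comp]

/-- Generalized eigenvectors of the linear part extend to generalized eigenvectors of the germ. -/
theorem exists_mem_maxGenEigenspace_diff_eq {F : BiholGerm d}
    (hF : Tendsto (fun n : ℕ => ‖fderiv ℂ F 0 ^ n‖) atTop (𝓝 0)) {c : ℂ} (hc : c ≠ 0)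
    (hc1 : c ≠ 1) {l : Dual ℂ (Fin d → ℂ)}
    (hl : l ∈ maxGenEigenspace (fderiv ℂ F 0).toLinearMap.dualMap c) :
    ∃ u ∈ maxGenEigenspace F.pullbackEnd c, value u = 0 ∧ diff u = l := by
  obtain ⟨k, hk⟩ := exists_pullback_sub_smul_eq hF hc
  obtain ⟨φ, rfl⟩ := exists_diff_eq l
  -- The exponent k + 2 gives both surjectivity of F^* - c on 𝔪^(k+2) and vanishing of `diff` there.
  obtain ⟨u, hu, hul⟩ := exists_lift_maxGenEigenspace (T := F.pullbackEnd)
    (T' := (fderiv ℂ F 0).toLinearMap.dualMap) (f := diff)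
    (N := (maximalIdeal (HolGerm d) ^ (k + 2)).restrictScalars ℂ)
    (fun φ => diff_pullback F φ) (fun φ hφ => F.pullback_mem_pow hφ)
    (fun φ hφ => diff_eq_zero_of_mem_sq (Ideal.pow_le_pow_right (Nat.le_add_left 2 k) hφ))
    (hk (k + 2) (Nat.le_add_right k 2)) hl
  refine ⟨u, hu, ?_, hul⟩
  obtain ⟨n, hn⟩ := (mem_maxGenEigenspace _ _ _).1 hu
  -- F^* preserves values at 0, so (1 - c)^n value(u) = 0, and c ≠ 1.
  have h := map_sub_smul_pow (T' := (1 : Module.End ℂ ℂ)) value.toLinearMap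
    (T := F.pullbackEnd) (fun φ => F.value_pullback φ) c n u
  rw [hn, _root_.map_zero] at h
  have h1 : (1 : Module.End ℂ ℂ) - c • 1 = (1 - c) • 1 := by rw [sub_smul, one_smul]
  rw [h1, smul_pow, one_pow] at h
  exact (mul_eq_zero.1 h.symm).resolve_left (pow_ne_zero n (sub_ne_zero.2 hc1.symm))

/-- A germ is in Poincaré–Dulac normal form if its linear part is, and the coordinates are
generalized eigenvectors. -/
theorem isPoincareDulac_of_mem_maxGenEigenspace {G : BiholGerm d} {lam : Fin d → ℂ}
    (hlam : NicelyOrdered lam)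
    (hX : ∀ i, polyGerm (MvPolynomial.X i) ∈ maxGenEigenspace G.pullbackEnd (lam i))
    (h : ∀ i, diff (G.pullback (polyGerm (MvPolynomial.X i))) = lam i • LinearMap.proj i ∨
      ∃ j : Fin d, (j : ℕ) + 1 = i ∧ lam j = lam i ∧
        diff (G.pullback (polyGerm (MvPolynomial.X i))) =
          lam i • LinearMap.proj i + LinearMap.proj j) :
    IsPoincareDulac G lam := by
  set A := LinearMap.toMatrix' (fderiv ℂ G 0).toLinearMap with hA
  have hAd : ∀ i v, fderiv ℂ G 0 v i = diff (G.pullback (polyGerm (MvPolynomial.X i))) v :=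
    fun i v => by
      rw [diff_pullback, diff_X]
      rfl
  have hAe : ∀ i k, A i k = diff (G.pullback (polyGerm (MvPolynomial.X i))) (Pi.single k 1) :=
    fun i k => by
      rw [← hAd, hA, LinearMap.toMatrix'_apply]
      rfl
  have hdiag : ∀ i, A i i = lam i := fun i => by
    rcases h i with hi | ⟨j, hj, -, hi⟩
    · simp [hAe, hi]
    · have : j ≠ i := fun e => by
        rw [e] at hj
        omega
      simp [hAe, hi, this]
  have hoff : ∀ i k, i ≠ k → A i k ≠ 0 → (k : ℕ) + 1 = i ∧ A i k = 1 ∧ lam k = lam i :=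
    fun i k hik hne => by
      rcases h i with hi | ⟨j, hj, hji, hi⟩
      · simp [hAe, hi, hik] at hne
      · by_cases hjk : j = k
        · subst hjk
          simp [hAe, hi, hik, hj, hji]
        · simp [hAe, hi, hik, hjk] at hne
  have hN : ∀ i, ∃ N : MvPolynomial (Fin d) ℂ, (∀ α ∈ N.support, IsResonant lam i α) ∧
      ∀ᶠ x in 𝓝 (0 : Fin d → ℂ), G x i - fderiv ℂ G 0 x i = MvPolynomial.eval x N := fun i => by
    set φ := G.pullback (polyGerm (MvPolynomial.X i)) with hφ
    have hφ0 : value φ = 0 := by rw [hφ, value_pullback, value_X]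
    have hsq := sub_linear_part_mem_sq φ
    set L : MvPolynomial (Fin d) ℂ := ∑ k, A i k • MvPolynomial.X k with hL
    have hLφ : polyGerm L = ∑ k, diff φ (Pi.single k 1) • polyGerm (MvPolynomial.X k) := by
      rw [← ofPoly_apply, hL, map_sum]
      exact Finset.sum_congr rfl fun k _ => by rw [map_smul, hAe, ofPoly_apply]
    rw [hφ0, zero_smul, sub_zero, ← hLφ] at hsq
    -- The nonlinear part of the i-th component is a generalized eigenvector for λ_i, hence an
    -- isotypic polynomial; lying in 𝔪², it has no monomial of degree below 2. These are exactly the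
    -- resonance conditions.
    have hmem : φ - polyGerm L ∈ maxGenEigenspace G.pullbackEnd (lam i) := by
      refine sub_mem ?_ ?_
      · exact map_mem_maxGenEigenspace G.pullbackEnd (fun _ => rfl) (hX i)
      · rw [hLφ]
        refine Submodule.sum_mem _ fun k _ => ?_
        rw [← hAe]
        by_cases hk : A i k = 0
        · rw [hk, zero_smul]
          exact zero_mem _
        refine Submodule.smul_mem _ _ ?_
        by_cases hik : i = k
        · rw [hik]
          exact hX k
        · rw [← (hoff i k hik hk).2.2]
          exact hX k
    obtain ⟨p, hp, hsum⟩ := exists_isotypic_parts hlam.1 (φ - polyGerm L)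
    have heq := eq_isotypic_part hX hmem hp hsum
    refine ⟨p (lam i), fun α hα => ⟨Or.inl ?_, hp _ α hα⟩, ?_⟩
    · rw [← Finsupp.degree_eq_sum]
      by_contra! hlt
      refine MvPolynomial.mem_support_iff.1 hα ?_
      rw [heq] at hsq
      by_cases hα0 : α = 0
      · rw [hα0, ← value_polyGerm]
        exact mem_maximalIdeal_iff.1 (Ideal.pow_le_self two_ne_zero hsq)
      · obtain ⟨k, rfl⟩ := Finsupp.exists_eq_single_of_degree_eq_one (α := α) (by
          have := (Finsupp.degree_eq_zero_iff α).not.2 hα0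
          omega)
        rw [← diff_polyGerm, diff_eq_zero_of_mem_sq hsq, LinearMap.zero_apply]
    · have h1 : ((fun x => MvPolynomial.eval (G x) (MvPolynomial.X i) - MvPolynomial.eval x L :
          (Fin d → ℂ) → ℂ) : Germ (𝓝 (0 : Fin d → ℂ)) ℂ) =
          (fun x => MvPolynomial.eval x (p (lam i)) : (Fin d → ℂ) → ℂ) :=
        congrArg Subtype.val heq
      filter_upwards [Germ.coe_eq.1 h1] with x hx
      rw [← hx, MvPolynomial.eval_X, hL, map_sum]
      congr 1
      conv_lhs => rw [← Finset.univ_sum_single x, map_sum, Finset.sum_apply]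
      refine Finset.sum_congr rfl fun k _ => ?_
      rw [MvPolynomial.smul_eval, MvPolynomial.eval_X, hAe, ← hAd, mul_comm, ← smul_eq_mul,
        ← Pi.smul_apply, ← ContinuousLinearMap.map_smul, ← Pi.single_smul, smul_eq_mul, mul_one]
  choose N hNs hNe using hN
  refine ⟨fun i j hij hne => ?_, hdiag, hlam, N, hNs, eventually_all.2 hNe⟩
  obtain ⟨h1, h2, h3⟩ := hoff i j hij hne
  exact ⟨h1, h2, (hdiag i).trans (h3.symm.trans (hdiag j).symm)⟩

/-- Existence of Poincaré–Dulac normal forms. -/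
theorem IsContracting.exists_isPoincareDulacCoord {F : BiholGerm d} (h : F.IsContracting) :
    ∃ (Φ : BiholGerm d) (lam : Fin d → ℂ), IsPoincareDulacCoord F Φ lam := by
  have hF := h.tendsto_norm_pow
  set B := (fderiv ℂ F 0).toLinearMap.dualMap with hB
  obtain ⟨b, lam, hord, hb⟩ := exists_ordered_jordan_basis (n := d)
    (by rw [Subspace.dual_finrank_eq, finrank_fin_fun]) B
  -- A genuine eigenvector for each λ_i, found at the start of its Jordan chain, is needed for the
  -- bounds on |λ_i|.
  have heig : ∀ i, (∃ l, l ≠ 0 ∧ B l = lam i • l) ∧ b i ∈ maxGenEigenspace B (lam i) := fun i => by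
    induction i using WellFoundedLT.induction with
    | ind i ih =>
      rcases hb i with hi | ⟨j, hj, hji, hi⟩
      · refine ⟨⟨b i, b.ne_zero i, hi⟩, (mem_maxGenEigenspace _ _ _).2 ⟨1, ?_⟩⟩
        simp [hi]
      · have hlt : j < i := Fin.lt_def.2 (by omega)
        obtain ⟨h1, h2⟩ := ih j hlt
        rw [hji] at h1 h2
        refine ⟨h1, ?_⟩
        obtain ⟨n, hn⟩ := (mem_maxGenEigenspace _ _ _).1 h2
        refine (mem_maxGenEigenspace _ _ _).2 ⟨n + 1, ?_⟩
        rw [pow_succ, Module.End.mul_apply]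
        simpa [hi] using hn
  have hlam : ∀ i, ‖lam i‖ < 1 ∧ 0 < ‖lam i‖ := fun i => by
    obtain ⟨⟨l, hl, hle⟩, -⟩ := heig i
    exact norm_eigenvalue hF hl hle
  -- The lifted Jordan basis of the dual space serves as the new coordinate system.
  choose u hu hu0 hud using fun i => exists_mem_maxGenEigenspace_diff_eq hF
    (norm_pos_iff.1 (hlam i).2) (fun e => by simpa [e] using (hlam i).1) (heig i).2
  obtain ⟨Φ, hΦ⟩ := exists_pullback_X_eq hu0 (by simpa only [hud] using b.linearIndependent)
  let G := (Φ.comp F).comp Φ.symm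
  have hG : ∀ φ, G.pullback φ = Φ.symm.pullback (F.pullback (Φ.pullback φ)) := fun φ => by
    rw [pullback_comp, pullback_comp]
  have hsymm : ∀ i, Φ.symm.pullback (u i) = polyGerm (MvPolynomial.X i) := fun i => by
    rw [← hΦ i]
    exact Φ.symm.pullback_symm_pullback _
  refine ⟨Φ, lam, G, ?_, ?_⟩
  · filter_upwards [Φ.left_inv] with x hx
    exact congrArg (fun y => Φ (F y)) hx
  have hproj : ∀ i, (b i).comp (fderiv ℂ Φ.symm 0).toLinearMap = LinearMap.proj i := fun i => by
    rw [← hud, ← diff_pullback, hsymm, diff_X]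
  have hdG : ∀ i, diff (G.pullback (polyGerm (MvPolynomial.X i))) =
      (B (b i)).comp (fderiv ℂ Φ.symm 0).toLinearMap := fun i => by
    rw [hG, hΦ, diff_pullback, diff_pullback, hud]
    rfl
  refine isPoincareDulac_of_mem_maxGenEigenspace ⟨hlam, hord⟩ (fun i => ?_) fun i => ?_
  · rw [← hsymm]
    refine map_mem_maxGenEigenspace Φ.symm.pullbackEnd (fun φ => ?_) (hu i)
    refine Eq.trans ?_ (hG _).symm
    exact congrArg (fun ψ => Φ.symm.pullback (F.pullback ψ)) (Φ.pullback_symm_pullback φ).symm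
  · rw [hdG]
    rcases hb i with hi | ⟨j, hj, hji, hi⟩
    · exact Or.inl (by rw [hi, LinearMap.smul_comp, hproj])
    · exact Or.inr ⟨j, hj, hji, by rw [hi, LinearMap.add_comp, LinearMap.smul_comp, hproj, hproj]⟩

end BiholGerm

end

end

theorem mainTheorem3 (d : ℕ) (F : BiholGerm d) (hF : F.IsContracting)
    (I : Ideal (HolGerm d)) (hI : F.LeavesInvariant I) :
    (∃ (Φ : BiholGerm d) (lam : Fin d → ℂ), IsPoincareDulacCoord F Φ lam) ∧
    ∀ (Φ : BiholGerm d) (lam : Fin d → ℂ), IsPoincareDulacCoord F Φ lam →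
      ∃ w : Fin d → ℕ, (∀ k, 0 < w k) ∧
        ∃ (r : ℕ) (P : Fin r → MvPolynomial (Fin d) ℂ),
          (∀ i, IsLambdaHomogeneous lam (P i) ∧
            ∃ n : ℕ, MvPolynomial.IsWeightedHomogeneous w (P i) n) ∧
          I = Ideal.span (Set.range fun i => Φ.pullback (polyGerm (P i))) ∧
          ∀ i : Fin r, F.LeavesInvariant
            (Ideal.span ((fun j => Φ.pullback (polyGerm (P j))) '' {j | j ≤ i})) := by
  exact ⟨hF.exists_isPoincareDulacCoord,
    fun _ _ h => exists_generators_of_isPoincareDulacCoord hI h⟩
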